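/- Conventions. A geometry is a set $X$ of points with a family of subsets (its subspaces) such that $\emptyset$, $X$ and all one-point sets are subspaces, intersections of subspaces are subspaces, the exchange axiom holds (if $S$ is a subspace, $x,y\notin S$ and $y\in S\vee x$, then $x\in S\vee y$), and closure is finitary (a point of the closure $\overline A$ of a set $A$ lies in the closure of a finite subset of $A$). The dimension of a subspace is the cardinality of a basis minus $1$; lines and planes are the subspaces of dimension $1$ and $2$; a hyperplane is a maximal proper subspace. A map of geometries is a morphism if preimages of subspaces are subspaces. A subset $X$ of a geometry is a subgeometry, its subspaces being the traces $S\cap X$ of the subspaces $S$. A geometry of dimension $\ge 2$ has enough points if every plane contains four points, no three of them collinear. For a point $x$ of a geometry $G$, the quotient $G/x$ is the set of classes $[y]$ of points $y\neq x$, where $[y]=[z]$ iff $y\vee x=z\vee x$; its subspaces are the sets $S/x=\{[y] : y\in S,\ y\neq x\}$ with $S$ a subspace through $x$. If $X\subseteq G$ is a subgeometry and $x\in X$, then $X/x=\{[y] : y\in X,\ y\ne x\}$ is a subgeometry of $G/x$. A subgeometry $Y$ of an irreducible projective space $Q$ is affino-projective if $Y\cup H=Q$ for some hyperplane $H$ of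 $Q$. For a left vector space $V$ over a division ring $K$, $\mathbb P(V)$ is the set of one-dimensional subspaces of $V$, a geometry whose subspaces are the sets $\mathbb P(W)$ with $W\subseteq V$ a vector subspace. A semilinear map $\Phi\colon V\to V'$ is an additive map with $\Phi(\lambda v)=\sigma(\lambda)\Phi(v)$ for some ring homomorphism $\sigma\colon K\to K'$ (not necessarily surjective); the partial projective morphism associated to it is the partial map $\phi\colon\mathbb P(V)\dashrightarrow\mathbb P(V')$, $\langle v\rangle\mapsto\langle\Phi(v)\rangle$, defined exactly on $\mathbb P(V)\setminus\mathbb P(\ker\Phi)$. Theorem. Let $\mathbb P=\mathbb P(V)$ and $\mathbb P'=\mathbb P(V')$ be projective spaces over division rings $K$ and $K'$, respectively, with $|K|\ge 4$ or $|K|=3=\operatorname{char}K'$. Let $X\subseteq\mathbb P$ be a subgeometry with enough points and let $\varphi\colon X\to\mathbb P'$ be a morphism of geometries such that: 1. the image of $\varphi$ is not contained in a subspace of $\mathbb P'$ of dimension at most $2$; 2. there are points $x_1,x_2\in X$ such that $\varphi(x_1)\neq\varphi(x_2)$ and, for $i=1,2$, $X/x_i$ is an affino-projective subgeometry of $\mathbb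 P/x_i$. Then $\varphi$ is the restriction to $X$ of a unique partial projective morphism $\phi\colon\mathbb P\dashrightarrow\mathbb P'$; that is, there is exactly one partial projective morphism $\phi$ that is defined at every point of $X$ and satisfies $\phi(x)=\varphi(x)$ for all $x\in X$. -/

import Mathlib

open scoped LinearAlgebra.Projectivization

/-- The closure of `A` with respect to a family of subsets (the flats): the intersection of all
flats containing `A`. -/
def flatClosure {X : Type*} (IsFlat : Set X → Prop) (A : Set X) : Set X :=
  ⋂₀ {S | IsFlat S ∧ A ⊆ S}

/-- A geometry on a set `X` of points: a family of subsets, the flats (or subspaces), satisfying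
the axioms of a finitary simple closure space with the exchange property. -/
structure Geometry (X : Type*) where
  IsFlat : Set X → Prop
  isFlat_empty : IsFlat ∅
  isFlat_univ : IsFlat Set.univ
  isFlat_singleton : ∀ x : X, IsFlat {x}
  isFlat_sInter : ∀ F : Set (Set X), (∀ S ∈ F, IsFlat S) → IsFlat (⋂₀ F)
  exchange : ∀ (S : Set X) (x y : X), IsFlat S → x ∉ S → y ∉ S →
    y ∈ flatClosure IsFlat (insert x S) → x ∈ flatClosure IsFlat (insert y S)
  finitary : ∀ (A : Set X) (x : X), x ∈ flatClosure IsFlat A →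
    ∃ B : Set X, B.Finite ∧ B ⊆ A ∧ x ∈ flatClosure IsFlat B

namespace Geometry

variable {X X' : Type*} (G : Geometry X) (G' : Geometry X')

/-- The closure of a set of points: the least flat containing it. -/
def closure (A : Set X) : Set X := flatClosure G.IsFlat A

theorem isFlat_closure (A : Set X) : G.IsFlat (G.closure A) :=
  G.isFlat_sInter _ fun _ hS => hS.1

theorem subset_closure (A : Set X) : A ⊆ G.closure A :=
  Set.subset_sInter fun _ hS => hS.2

theorem closure_subset {A S : Set X} (hS : G.IsFlat S) (h : A ⊆ S) : G.closure A ⊆ S :=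
  Set.sInter_subset_of_mem ⟨hS, h⟩

theorem closure_mono {A B : Set X} (h : A ⊆ B) : G.closure A ⊆ G.closure B :=
  G.closure_subset (G.isFlat_closure B) (h.trans (G.subset_closure B))

theorem closure_eq {S : Set X} (hS : G.IsFlat S) : G.closure S = S :=
  (G.closure_subset hS subset_rfl).antisymm (G.subset_closure S)

/-- No point of `A` lies in the closure of the other points of `A`. -/
def Independent (A : Set X) : Prop := ∀ a ∈ A, a ∉ G.closure (A \ {a})

/-- `A` is a basis of the flat `S`. -/
def IsBasis (A S : Set X) : Prop := G.Independent A ∧ G.closure A = S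

/-- `S` is a flat of (finite) dimension `r`, i.e. it has a basis of `r + 1` points. -/
def HasDim (S : Set X) (r : ℕ) : Prop := ∃ A : Set X, G.IsBasis A S ∧ A.encard = r + 1

/-- A line is a flat of dimension 1. -/
def IsLine (S : Set X) : Prop := G.HasDim S 1

/-- A plane is a flat of dimension 2. -/
def IsPlane (S : Set X) : Prop := G.HasDim S 2

/-- A hyperplane is a maximal proper flat. -/
def IsHyperplane (H : Set X) : Prop :=
  G.IsFlat H ∧ H ≠ Set.univ ∧ ∀ S, G.IsFlat S → H ⊆ S → S = H ∨ S = Set.univ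

/-- A geometry of dimension at least 2 has enough points when every plane contains four points,
no three of which are collinear. -/
def EnoughPoints : Prop :=
  (∃ A : Set X, G.IsBasis A Set.univ ∧ 3 ≤ A.encard) ∧
  ∀ P : Set X, G.IsPlane P → ∃ Q ⊆ P, Q.encard = 4 ∧
    ∀ T ⊆ Q, T.encard = 3 → ¬ ∃ L, G.IsLine L ∧ T ⊆ L

/-- A morphism of geometries: preimages of flats are flats. -/
def IsMorphism (φ : X → X') : Prop := ∀ S' : Set X', G'.IsFlat S' → G.IsFlat (φ ⁻¹' S')

/-- A set `Y` of points of an irreducible projective space `G` is affino-projective when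
together with some hyperplane it covers `G`. -/
def IsAffinoProjective (Y : Set X) : Prop := ∃ H, G.IsHyperplane H ∧ Y ∪ H = Set.univ

section Sub

variable (A : Set X)

/-- The flats of a subset `A`: the traces on `A` of the flats of the ambient geometry. -/
def SubIsFlat (T : Set A) : Prop := ∃ S : Set X, G.IsFlat S ∧ T = Subtype.val ⁻¹' S

theorem flatClosure_sub (T : Set A) :
    flatClosure (G.SubIsFlat A) T = Subtype.val ⁻¹' G.closure (Subtype.val '' T) := by
  apply Set.Subset.antisymm
  · refine Set.sInter_subset_of_mem ⟨⟨_, G.isFlat_closure _, rfl⟩, ?_⟩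
    exact Set.image_subset_iff.1 (G.subset_closure _)
  · refine Set.subset_sInter ?_
    rintro _ ⟨⟨S, hS, rfl⟩, hT⟩
    exact Set.preimage_mono (G.closure_subset hS (Set.image_subset_iff.2 hT))

/-- The subgeometry of `G` carried by a subset `A`. -/
def sub : Geometry A where
  IsFlat := G.SubIsFlat A
  isFlat_empty := ⟨∅, G.isFlat_empty, by simp⟩
  isFlat_univ := ⟨Set.univ, G.isFlat_univ, by simp⟩
  isFlat_singleton x := ⟨{x.1}, G.isFlat_singleton _, by ext y; simp [Subtype.ext_iff]⟩
  isFlat_sInter F hF := by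
    refine ⟨⋂₀ {S | G.IsFlat S ∧ Subtype.val ⁻¹' S ∈ F}, G.isFlat_sInter _ fun S hS => hS.1, ?_⟩
    ext y
    constructor
    · intro hy S hS
      exact hy _ hS.2
    · intro hy T hT
      obtain ⟨S, hS, rfl⟩ := hF T hT
      exact hy S ⟨hS, hT⟩
  exchange T x y hT hx hy h := by
    obtain ⟨S, hS, rfl⟩ := hT
    rw [flatClosure_sub, Set.image_insert_eq, Subtype.image_preimage_coe] at h ⊢
    have hSA : Subtype.val ⁻¹' G.closure (A ∩ S) = (Subtype.val ⁻¹' S : Set A) := by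
      apply Set.Subset.antisymm
      · exact Set.preimage_mono (G.closure_subset hS Set.inter_subset_right)
      · intro z hz
        exact G.subset_closure _ ⟨z.2, hz⟩
    have key : ∀ z : A, G.closure (insert z.1 (G.closure (A ∩ S))) =
        G.closure (insert z.1 (A ∩ S)) := by
      intro z
      apply Set.Subset.antisymm
      · refine G.closure_subset (G.isFlat_closure _) (Set.insert_subset ?_ ?_)
        · exact G.subset_closure _ (Set.mem_insert _ _)
        · exact G.closure_mono (Set.subset_insert _ _)
      · exact G.closure_mono (Set.insert_subset_insert (G.subset_closure _))
    have hx' : x.1 ∉ G.closure (A ∩ S) := fun hh => hx (hSA.subset hh)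
    have hy' : y.1 ∉ G.closure (A ∩ S) := fun hh => hy (hSA.subset hh)
    have := G.exchange _ x.1 y.1 (G.isFlat_closure (A ∩ S)) hx' hy'
      ((key x).symm.subset h)
    exact (key y).subset this
  finitary T x h := by
    rw [flatClosure_sub] at h
    obtain ⟨B, hB, hBT, hx⟩ := G.finitary _ _ h
    refine ⟨Subtype.val ⁻¹' B, hB.preimage Subtype.val_injective.injOn, ?_, ?_⟩
    · intro z hz
      obtain ⟨w, hw, hwz⟩ := hBT hz
      rwa [← Subtype.ext hwz]
    · rw [flatClosure_sub]
      refine G.closure_mono ?_ hx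
      intro z hz
      obtain ⟨w, hw, rfl⟩ := hBT hz
      exact ⟨w, hz, rfl⟩

end Sub

section Quotient

variable (E : Set X)

/-- Two points outside `E` are equivalent when they have the same join with `E`. -/
def quotSetoid : Setoid {x : X // x ∉ E} where
  r x y := G.closure (insert x.1 E) = G.closure (insert y.1 E)
  iseqv := ⟨fun _ => rfl, fun h => h.symm, fun h h' => h.trans h'⟩

/-- The set of points of the quotient `X / E`. -/
def Quot : Type _ := Quotient (G.quotSetoid E)

/-- The class in `X / E` of a point outside `E`. -/
def toQuot (x : {x : X // x ∉ E}) : G.Quot E := Quotient.mk (G.quotSetoid E) x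

/-- The set of classes in `X / E` of the points of `S` outside `E`. For `S` ranging over the flats
of `X` containing `E`, these are the flats of `X / E`. For an arbitrary subset `S` of `X`
containing `E`, this is the image of the (injective) natural map `S / E → X / E`, `[x] ↦ [x]`,
i.e. the subset of `X / E` carrying the subgeometry `S / E`. -/
def quotImage (S : Set X) : Set (G.Quot E) :=
  {q | ∃ x : {x : X // x ∉ E}, x.1 ∈ S ∧ G.toQuot E x = q}

/-- The flats of `X / E`. -/
def QuotIsFlat (T : Set (G.Quot E)) : Prop :=
  ∃ S : Set X, G.IsFlat S ∧ E ⊆ S ∧ T = G.quotImage E S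

/-- The union of `E` with all points whose class lies in `T`. -/
def quotPull (T : Set (G.Quot E)) : Set X := {x | ∀ h : x ∉ E, G.toQuot E ⟨x, h⟩ ∈ T}

theorem subset_quotPull (T : Set (G.Quot E)) : E ⊆ G.quotPull E T := fun _ hx h => (h hx).elim

theorem quotImage_quotPull (T : Set (G.Quot E)) : G.quotImage E (G.quotPull E T) = T := by
  ext q
  constructor
  · rintro ⟨x, hx, rfl⟩
    exact hx x.2
  · intro hq
    obtain ⟨x, rfl⟩ := Quotient.exists_rep q
    exact ⟨x, fun _ => hq, rfl⟩

theorem quotPull_quotImage {S : Set X} (hS : G.IsFlat S) (hE : E ⊆ S) :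
    G.quotPull E (G.quotImage E S) = S := by
  ext x
  constructor
  · intro hx
    by_cases h : x ∈ E
    · exact hE h
    · obtain ⟨y, hy, hyx⟩ := hx h
      have hc : G.closure (insert y.1 E) = G.closure (insert x E) := Quotient.exact hyx
      have : x ∈ G.closure (insert y.1 E) := hc ▸ G.subset_closure _ (Set.mem_insert _ _)
      exact G.closure_subset hS (Set.insert_subset hy hE) this
  · intro hx h
    exact ⟨⟨x, h⟩, hx, rfl⟩

theorem quotIsFlat_iff (T : Set (G.Quot E)) : G.QuotIsFlat E T ↔ G.IsFlat (G.quotPull E T) := by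
  constructor
  · rintro ⟨S, hS, hE, rfl⟩
    rwa [G.quotPull_quotImage E hS hE]
  · intro h
    exact ⟨_, h, G.subset_quotPull E T, (G.quotImage_quotPull E T).symm⟩

theorem quotPull_mono {T U : Set (G.Quot E)} (h : T ⊆ U) : G.quotPull E T ⊆ G.quotPull E U :=
  fun _ hx hE => h (hx hE)

theorem quotImage_mono {S U : Set X} (h : S ⊆ U) : G.quotImage E S ⊆ G.quotImage E U := by
  rintro q ⟨x, hx, rfl⟩
  exact ⟨x, h hx, rfl⟩

theorem flatClosure_quot (T : Set (G.Quot E)) :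
    flatClosure (G.QuotIsFlat E) T = G.quotImage E (G.closure (G.quotPull E T)) := by
  apply Set.Subset.antisymm
  · refine Set.sInter_subset_of_mem ⟨⟨_, G.isFlat_closure _,
      (G.subset_quotPull E T).trans (G.subset_closure _), rfl⟩, ?_⟩
    rw [← G.quotImage_quotPull E T]
    apply G.quotImage_mono
    rw [G.quotImage_quotPull E T]
    exact G.subset_closure _
  · refine Set.subset_sInter ?_
    rintro U ⟨hU, hT⟩
    rw [← G.quotImage_quotPull E U]
    exact G.quotImage_mono E
      (G.closure_subset ((G.quotIsFlat_iff E U).1 hU) (G.quotPull_mono E hT))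

theorem closure_insert_eq {S : Set X} (x y : X) (hS : G.IsFlat S) (hx : x ∉ S) (hy : y ∉ S)
    (h : y ∈ G.closure (insert x S)) : G.closure (insert y S) = G.closure (insert x S) := by
  have h' : x ∈ G.closure (insert y S) := G.exchange S x y hS hx hy h
  apply Set.Subset.antisymm
  · exact G.closure_subset (G.isFlat_closure _)
      (Set.insert_subset h ((Set.subset_insert _ _).trans (G.subset_closure _)))
  · exact G.closure_subset (G.isFlat_closure _)
      (Set.insert_subset h' ((Set.subset_insert _ _).trans (G.subset_closure _)))

theorem closure_quotPull_insert (x : {x : X // x ∉ E}) (T : Set (G.Quot E)) :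
    G.closure (G.quotPull E (insert (G.toQuot E x) T)) =
      G.closure (insert x.1 (G.quotPull E T)) := by
  apply Set.Subset.antisymm
  · refine G.closure_subset (G.isFlat_closure _) fun y hy => ?_
    by_cases h : y ∈ E
    · exact G.subset_closure _ (Or.inr (G.subset_quotPull E T h))
    · rcases hy h with hyx | hyT
      · have hc : G.closure (insert y E) = G.closure (insert x.1 E) := Quotient.exact hyx
        have hm : y ∈ G.closure (insert x.1 E) := hc ▸ G.subset_closure _ (Set.mem_insert _ _)
        exact G.closure_mono (Set.insert_subset_insert (G.subset_quotPull E T)) hm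
      · exact G.subset_closure _ (Or.inr fun _ => hyT)
  · refine G.closure_mono (Set.insert_subset (fun _ => Or.inl rfl) ?_)
    exact G.quotPull_mono E (Set.subset_insert _ _)

/-- The quotient geometry `X / E` of `X` by a flat `E`. -/
def quotient (hE : G.IsFlat E) : Geometry (G.Quot E) where
  IsFlat := G.QuotIsFlat E
  isFlat_empty := ⟨E, hE, subset_rfl, by
    ext q
    constructor
    · exact False.elim
    · rintro ⟨x, hx, -⟩
      exact x.2 hx⟩
  isFlat_univ := ⟨Set.univ, G.isFlat_univ, Set.subset_univ _, by
    ext q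
    obtain ⟨x, rfl⟩ := Quotient.exists_rep q
    exact ⟨fun _ => ⟨x, trivial, rfl⟩, fun _ => trivial⟩⟩
  isFlat_singleton q := by
    obtain ⟨x, rfl⟩ := Quotient.exists_rep q
    refine ⟨G.closure (insert x.1 E), G.isFlat_closure _,
      (Set.subset_insert _ _).trans (G.subset_closure _), ?_⟩
    ext q
    constructor
    · rintro rfl
      exact ⟨x, G.subset_closure _ (Set.mem_insert _ _), rfl⟩
    · rintro ⟨y, hy, rfl⟩
      exact Quotient.sound (G.closure_insert_eq x.1 y.1 hE x.2 y.2 hy)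
  isFlat_sInter F hF := by
    rw [quotIsFlat_iff]
    have : G.quotPull E (⋂₀ F) = ⋂₀ (G.quotPull E '' F) := by
      ext x
      constructor
      · rintro hx _ ⟨T, hT, rfl⟩ h
        exact hx h T hT
      · intro hx h T hT
        exact hx _ ⟨T, hT, rfl⟩ h
    rw [this]
    apply G.isFlat_sInter
    rintro _ ⟨T, hT, rfl⟩
    exact (G.quotIsFlat_iff E T).1 (hF T hT)
  exchange T p q hT hp hq h := by
    obtain ⟨x, rfl⟩ := Quotient.exists_rep p
    obtain ⟨y, rfl⟩ := Quotient.exists_rep q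
    have hT' := (G.quotIsFlat_iff E T).1 hT
    have hx : x.1 ∉ G.quotPull E T := fun hh => hp (hh x.2)
    have hy : y.1 ∉ G.quotPull E T := fun hh => hq (hh y.2)
    have hsub : ∀ z : {x : X // x ∉ E}, E ⊆ G.closure (insert z.1 (G.quotPull E T)) := fun z =>
      (G.subset_quotPull E T).trans ((Set.subset_insert _ _).trans (G.subset_closure _))
    change G.toQuot E y ∈ flatClosure (G.QuotIsFlat E) (insert (G.toQuot E x) T) at h
    change G.toQuot E x ∈ flatClosure (G.QuotIsFlat E) (insert (G.toQuot E y) T)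
    rw [flatClosure_quot, G.closure_quotPull_insert E] at h ⊢
    have hy' : y.1 ∈ G.closure (insert x.1 (G.quotPull E T)) := by
      rw [← G.quotPull_quotImage E (G.isFlat_closure _) (hsub x)]
      exact fun _ => h
    exact ⟨x, G.exchange _ x.1 y.1 hT' hx hy hy', rfl⟩
  finitary T q h := by
    rw [flatClosure_quot] at h
    obtain ⟨x, hx, rfl⟩ := h
    obtain ⟨B, hB, hBT, hxB⟩ := G.finitary _ _ hx
    refine ⟨G.quotImage E B, ?_, ?_, ?_⟩
    · have : G.quotImage E B = G.toQuot E '' (Subtype.val ⁻¹' B) := by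
        ext q
        rfl
      rw [this]
      exact (hB.preimage Subtype.val_injective.injOn).image _
    · rw [← G.quotImage_quotPull E T]
      exact G.quotImage_mono E hBT
    · rw [flatClosure_quot]
      refine ⟨x, G.closure_mono ?_ hxB, rfl⟩
      intro y hy h
      exact ⟨⟨y, h⟩, hy, rfl⟩

end Quotient

end Geometry

section Projective

variable (K V : Type*) [DivisionRing K] [AddCommGroup V] [Module K V]

/-- The flats of `ℙ K V`: the projectivizations of the vector subspaces of `V`. -/
def ProjIsFlat (S : Set (ℙ K V)) : Prop :=
  ∃ W : Submodule K V, S = {p | p.submodule ≤ W}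

variable {K V}

theorem proj_submodule_le_iff (p : ℙ K V) (W : Submodule K V) : p.submodule ≤ W ↔ p.rep ∈ W := by
  rw [Projectivization.submodule_eq, Submodule.span_singleton_le_iff_mem]

theorem flatClosure_proj (A : Set (ℙ K V)) :
    flatClosure (ProjIsFlat K V) A =
      {p | p.rep ∈ Submodule.span K (Projectivization.rep '' A)} := by
  apply Set.Subset.antisymm
  · refine Set.sInter_subset_of_mem
      ⟨⟨Submodule.span K (Projectivization.rep '' A), ?_⟩, ?_⟩
    · ext p
      exact (proj_submodule_le_iff p (Submodule.span K (Projectivization.rep '' A))).symm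
    · intro p hp
      exact Submodule.subset_span ⟨p, hp, rfl⟩
  · refine Set.subset_sInter ?_
    rintro _ ⟨⟨W, rfl⟩, hA⟩ p hp
    refine (proj_submodule_le_iff p W).2 (Submodule.span_le.2 ?_ hp)
    rintro _ ⟨a, ha, rfl⟩
    exact (proj_submodule_le_iff a W).1 (hA ha)

variable (K V)

/-- The projective space of a vector space `V` over a division ring `K`, as a geometry. -/
def projGeometry : Geometry (ℙ K V) where
  IsFlat := ProjIsFlat K V
  isFlat_empty := ⟨⊥, by
    ext p
    refine ⟨False.elim, fun h => p.rep_nonzero ?_⟩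
    exact (Submodule.mem_bot K).1 ((proj_submodule_le_iff p ⊥).1 h)⟩
  isFlat_univ := ⟨⊤, by simp⟩
  isFlat_singleton p := ⟨p.submodule, by
    ext q
    constructor
    · rintro rfl
      exact le_refl q.submodule
    · intro h
      replace h := (proj_submodule_le_iff q p.submodule).1 h
      rw [Projectivization.submodule_eq, Submodule.mem_span_singleton] at h
      obtain ⟨a, ha⟩ := h
      change q = p
      rw [← q.mk_rep, ← p.mk_rep, Projectivization.mk_eq_mk_iff']
      exact ⟨a, ha⟩⟩
  isFlat_sInter F hF := by
    refine ⟨sInf {W | {p : ℙ K V | p.submodule ≤ W} ∈ F}, ?_⟩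
    ext p
    constructor
    · intro hp
      refine (le_sInf fun W hW => ?_ : p.submodule ≤ _)
      exact hp {q | q.submodule ≤ W} hW
    · intro hp S hS
      obtain ⟨W, rfl⟩ := hF S hS
      exact le_trans (show p.submodule ≤ _ from hp) (sInf_le hS)
  exchange S x y hS hx hy h := by
    obtain ⟨W, rfl⟩ := hS
    rw [flatClosure_proj, Set.image_insert_eq] at h ⊢
    refine (mem_span_insert_exchange h fun hh => hy ?_)
    refine (proj_submodule_le_iff y W).2 (Submodule.span_le.2 ?_ hh)
    rintro _ ⟨a, ha, rfl⟩
    exact (proj_submodule_le_iff a W).1 ha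
  finitary A x h := by
    rw [flatClosure_proj] at h
    obtain ⟨T, hT, hx⟩ := Submodule.mem_span_finite_of_mem_span h
    obtain ⟨B, hBA, hBT⟩ := Set.subset_image_iff.1 hT
    refine ⟨B, ?_, hBA, ?_⟩
    · refine Set.Finite.of_finite_image (f := Projectivization.rep) ?_ ?_
      · rw [hBT]
        exact T.finite_toSet
      · intro p _ q _ hpq
        rw [← p.mk_rep, ← q.mk_rep, Projectivization.mk_eq_mk_iff']
        exact ⟨1, by rw [one_smul]; exact hpq.symm⟩
    · rw [flatClosure_proj, hBT]
      exact hx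

variable {K V}
variable {K' V' : Type*} [DivisionRing K'] [AddCommGroup V'] [Module K' V']

/-- The partial map `⟨v⟩ ↦ ⟨Φ v⟩` induced by a semilinear map `Φ`; it is defined at `⟨v⟩` exactly
when `Φ v ≠ 0`. -/
noncomputable def partialProj {σ : K →+* K'} (Φ : V →ₛₗ[σ] V') : ℙ K V →. ℙ K' V' :=
  fun p => ⟨Φ p.rep ≠ 0, fun h => Projectivization.mk K' (Φ p.rep) h⟩

theorem mem_partialProj_mk {σ : K →+* K'} (Φ : V →ₛₗ[σ] V') (v : V) (hv : v ≠ 0) (q : ℙ K' V') :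
    q ∈ partialProj Φ (Projectivization.mk K v hv) ↔
      ∃ h : Φ v ≠ 0, Projectivization.mk K' (Φ v) h = q := by
  obtain ⟨a, ha⟩ := Projectivization.exists_smul_eq_mk_rep K v hv
  have hrep : Φ (Projectivization.mk K v hv).rep = σ a • Φ v := by
    rw [← ha, Units.smul_def, LinearMap.map_smulₛₗ]
  have hσ : σ (a : K) ≠ 0 := (map_ne_zero σ).2 a.ne_zero
  have hiff : Φ (Projectivization.mk K v hv).rep ≠ 0 ↔ Φ v ≠ 0 := by
    rw [hrep, smul_ne_zero_iff]
    exact and_iff_right hσ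
  have heq : ∀ h h', Projectivization.mk K' (Φ (Projectivization.mk K v hv).rep) h =
      Projectivization.mk K' (Φ v) h' := fun h h' =>
    (Projectivization.mk_eq_mk_iff' K' _ _ h h').2 ⟨σ a, hrep.symm⟩
  constructor
  · rintro ⟨h, rfl⟩
    exact ⟨hiff.1 h, (heq h (hiff.1 h)).symm⟩
  · rintro ⟨h, rfl⟩
    exact ⟨hiff.2 h, heq (hiff.2 h) h⟩

/-- A partial projective morphism is a partial map induced by a semilinear map (with respect to
an arbitrary ring morphism `K →+* K'`). -/
def IsPartialProjectiveMorphism (f : ℙ K V →. ℙ K' V') : Prop :=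
  ∃ (σ : K →+* K') (Φ : V →ₛₗ[σ] V'), f = partialProj Φ

end Projective

/-! Points are replaced by vectors. A morphism becomes a map `f` of vectors that respects linear
dependence (`SpanMorphism`), the value 0 standing for "undefined", and the goal is a semilinear `Φ`
with `span {f v} = span {Φ v}` on the vectors representing points of `X`.

Project `ℙ'` from `φ xᵢ`. The composite kills `xᵢ`, so it lives on `X / xᵢ`, which contains the
complement of a hyperplane of `ℙ / xᵢ`. The central case is therefore a possibly partial morphism
from an affine space `h ≠ 0` whose image lies on no line (`SpanMorphism.exists_semilinear`). If it
is undefined at some point, projecting from that point extends it to all of `V`. Otherwise points at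
infinity are added, for which the images of parallel lines must be concurrent. With three distinct
nonzero scalars this is a Desargues argument: the vertices of the triangles are scaled to have
different values of `h`, so that corresponding sides meet inside the affine space. If 3 = 0 in both
division rings, the common point is a harmonic conjugate determined by a single image line. The
extended map preserves dependence, and the fundamental theorem `exists_semilinear_of_add_mem` makes
it semilinear.

This gives semilinear maps `Φ₁`, `Φ₂` representing `f` modulo the lines `l₁`, `l₂` of `V'` belonging
to `φ x₁`, `φ x₂`. Modulo `l₁ ⊔ l₂` the image still has rank at least two, so there the two maps are
proportional (`exists_eq_smul_of_mem_span`). Since `l₁ ⊓ l₂ = ⊥`, the space `V'` is the fibre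
product of `V' / l₁` and `V' / l₂`, and the two maps glue to `Φ`. It represents `φ` at all points
whose image is off the projective line joining `φ x₁` and `φ x₂`. For `y` mapped onto that line,
take a plane of `X` through `y` whose image meets the line only in `φ y`. Having enough points, the
plane is spanned by three points other than `y`, where `Φ` is already correct, and this forces `Φ y`
into `span {f y}`. Uniqueness follows from proportionality modulo `l₁` and modulo `l₂`. -/

open Submodule

/-! ### Spans of at most three vectors -/

section LinearAlgebra

variable {K V : Type*} [DivisionRing K] [AddCommGroup V] [Module K V] {N : Submodule K V}
  {u v w x y z e p q : V}

theorem mem_of_mem_span_one (h : u ∈ span K {x}) (hx : x ∈ N) : u ∈ N :=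
  span_le.2 (Set.singleton_subset_iff.2 hx) h

theorem mem_of_mem_span_two (h : u ∈ span K {x, y}) (hx : x ∈ N) (hy : y ∈ N) : u ∈ N :=
  span_le.2 (Set.insert_subset hx (Set.singleton_subset_iff.2 hy)) h

theorem mem_of_mem_span_three (h : u ∈ span K {x, y, z}) (hx : x ∈ N) (hy : y ∈ N)
    (hz : z ∈ N) : u ∈ N :=
  span_le.2 (Set.insert_subset hx (Set.insert_subset hy (Set.singleton_subset_iff.2 hz))) h

theorem mem_span_one_self (x : V) : x ∈ span K {x} := mem_span_singleton_self x

theorem left_mem_span_two (x y : V) : x ∈ span K {x, y} := subset_span (by simp)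

theorem right_mem_span_two (x y : V) : y ∈ span K {x, y} := subset_span (by simp)

theorem smul_mem_span_one (a : K) (x : V) : a • x ∈ span K {x} := smul_mem _ a (mem_span_one_self x)

theorem smul_add_smul_mem_span_two (a b : K) (x y : V) : a • x + b • y ∈ span K {x, y} :=
  mem_span_pair.2 ⟨a, b, rfl⟩

theorem mem_of_smul_mem' {a : K} (ha : a ≠ 0) (h : a • x ∈ N) : x ∈ N :=
  (smul_mem_iff _ ha).1 h

theorem mem_span_one_symm (h : x ∈ span K {y}) (hx : x ≠ 0) : y ∈ span K {x} := by
  obtain ⟨a, rfl⟩ := mem_span_singleton.1 h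
  have ha : a ≠ 0 := by rintro rfl; simp at hx
  exact mem_of_smul_mem' ha (mem_span_one_self _)

theorem mem_span_two_exchange (h : x ∈ span K {y, z}) (hx : x ∉ span K {z}) :
    y ∈ span K {x, z} :=
  mem_span_insert_exchange h hx

theorem mem_span_two_exchange' (h : x ∈ span K {z, y}) (hx : x ∉ span K {z}) :
    y ∈ span K {z, x} := by
  rw [Set.pair_comm] at h ⊢
  exact mem_span_insert_exchange h hx

/-- Two independent vectors of a two-generated subspace generate it. -/
theorem mem_span_of_independent (hx : x ∈ span K {u, v}) (hy : y ∈ span K {u, v})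
    (hx0 : x ≠ 0) (hxy : y ∉ span K {x}) : u ∈ span K {x, y} ∧ v ∈ span K {x, y} := by
  by_cases h : x ∈ span K {v}
  · have hv : v ∈ span K {x} := mem_span_one_symm h hx0
    have hv' : v ∈ span K {x, y} := mem_of_mem_span_one hv (left_mem_span_two x y)
    refine ⟨?_, hv'⟩
    have : y ∉ span K {v} := fun hh => hxy (mem_of_mem_span_one hh hv)
    exact mem_of_mem_span_two (mem_span_two_exchange hy this) (right_mem_span_two x y) hv'
  · have hu : u ∈ span K {x, v} := mem_span_two_exchange hx h
    have hy' : y ∈ span K {x, v} :=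
      mem_of_mem_span_two hy hu (right_mem_span_two x v)
    have hv : v ∈ span K {x, y} := mem_span_two_exchange' hy' hxy
    exact ⟨mem_of_mem_span_two hu (left_mem_span_two x y) hv, hv⟩

theorem linearIndependent_three_iff : LinearIndependent K ![x, y, z] ↔
    ∀ a b c : K, a • x + b • y + c • z = 0 → a = 0 ∧ b = 0 ∧ c = 0 := by
  rw [Fintype.linearIndependent_iff]
  constructor
  · intro h a b c habc
    have := h ![a, b, c] (by simpa [Fin.sum_univ_three] using habc)
    exact ⟨this 0, this 1, this 2⟩
  · intro h g hg i
    have := h (g 0) (g 1) (g 2) (by simpa [Fin.sum_univ_three] using hg)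
    fin_cases i
    · exact this.1
    · exact this.2.1
    · exact this.2.2

theorem linearIndependent_three_of_notMem (hx : x ≠ 0) (hy : y ∉ span K {x})
    (hz : z ∉ span K {x, y}) : LinearIndependent K ![x, y, z] := by
  rw [linearIndependent_three_iff]
  intro a b c h
  have hc : c = 0 := by
    by_contra hc
    refine hz (mem_of_smul_mem' hc ?_)
    have : c • z = (-a) • x + (-b) • y := by
      rw [neg_smul, neg_smul, eq_comm, ← sub_eq_zero, ← neg_eq_zero, ← h]; abel
    rw [this]
    exact smul_add_smul_mem_span_two _ _ _ _
  subst hc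
  have hb : b = 0 := by
    by_contra hb
    refine hy (mem_of_smul_mem' hb ?_)
    have : b • y = (-a) • x := by
      rw [neg_smul, eq_comm, ← sub_eq_zero, ← neg_eq_zero, ← h]; simp; abel
    rw [this]
    exact smul_mem_span_one _ _
  subst hb
  refine ⟨?_, rfl, rfl⟩
  simpa [hx] using h

theorem coeff_eq_of_linearIndependent_three (hi : LinearIndependent K ![x, y, z])
    {a b c a' b' c' : K} (h : a • x + b • y + c • z = a' • x + b' • y + c' • z) :
    a = a' ∧ b = b' ∧ c = c' := by
  have := linearIndependent_three_iff.1 hi (a - a') (b - b') (c - c') (by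
    rw [sub_smul, sub_smul, sub_smul, ← sub_eq_zero.2 h]; abel)
  simpa [sub_eq_zero] using this

theorem notMem_span_two_of_linearIndependent (hi : LinearIndependent K ![x, y, z]) :
    x ≠ 0 ∧ y ∉ span K {x} ∧ z ∉ span K {x, y} := by
  rw [linearIndependent_three_iff] at hi
  refine ⟨?_, ?_, ?_⟩
  · rintro rfl
    simpa using (hi 1 0 0 (by simp)).1
  · intro h
    obtain ⟨a, rfl⟩ := mem_span_singleton.1 h
    simpa using (hi (-a) 1 0 (by simp)).2.1
  · intro h
    obtain ⟨a, b, rfl⟩ := mem_span_pair.1 h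
    simpa using (hi (-a) (-b) 1 (by simp; abel)).2.2

/-- Three independent vectors do not lie in a two-generated subspace. -/
theorem not_linearIndependent_three_of_mem (hx : x ∈ span K {u, v}) (hy : y ∈ span K {u, v})
    (hz : z ∈ span K {u, v}) : ¬ LinearIndependent K ![x, y, z] := by
  intro hi
  obtain ⟨h1, h2, h3⟩ := notMem_span_two_of_linearIndependent hi
  obtain ⟨hu, hv⟩ := mem_span_of_independent hx hy h1 h2
  exact h3 (mem_of_mem_span_two hz hu hv)

/-- In the coordinates `e, p, q`, the first span forces equal coefficients at `e` and `p`, the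
second at `e` and `q`. This locates the fourth vertex of a parallelogram from incidences alone. -/
theorem mem_span_add_add (hi : LinearIndependent K ![e, p, q]) (h : w ∈ span K {e + p, q})
    (h' : w ∈ span K {e + q, p}) : w ∈ span K {e + p + q} := by
  obtain ⟨a, b, rfl⟩ := mem_span_pair.1 h
  obtain ⟨c, d, h2⟩ := mem_span_pair.1 h'
  obtain ⟨rfl, rfl, rfl⟩ := coeff_eq_of_linearIndependent_three hi
    (a := c) (b := d) (c := c) (a' := a) (b' := a) (c' := b) (by
      simp only [smul_add] at h2; rw [← h2]; abel)
  rw [← smul_add]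
  exact smul_mem_span_one _ _

/-- Projecting the fourth vertex of the parallelogram from `e` onto the line through `p` and `q`
gives the sum; the proof compares coordinates. -/
theorem mem_span_add_of_mem (hi : LinearIndependent K ![e, p, q]) (h : w ∈ span K {p, q})
    (h' : w ∈ span K {e, e + p + q}) : w ∈ span K {p + q} := by
  obtain ⟨a, b, rfl⟩ := mem_span_pair.1 h
  obtain ⟨c, d, h2⟩ := mem_span_pair.1 h'
  obtain ⟨-, rfl, rfl⟩ := coeff_eq_of_linearIndependent_three hi
    (a := c + d) (b := d) (c := d) (a' := 0) (b' := a) (c' := b) (by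
      rw [zero_smul, zero_add, ← h2, add_smul]; simp only [smul_add]; abel)
  rw [← smul_add]
  exact smul_mem_span_one _ _

/-- The difference of the two multiples of `w` lies in `span {y}`, so `u ≠ v` would put `w`, and
with it `e`, there. Hence a representative normalised against `e` is unique. -/
theorem eq_of_add_mem_span_one (he : e ∉ span K {y}) (hu : u ∈ span K {y}) (hv : v ∈ span K {y})
    (hu' : e + u ∈ span K {w}) (hv' : e + v ∈ span K {w}) : u = v := by
  obtain ⟨s, hs⟩ := mem_span_singleton.1 hu'
  obtain ⟨t, ht⟩ := mem_span_singleton.1 hv'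
  have h : (s - t) • w = u - v := by rw [sub_smul, hs, ht]; abel
  by_contra huv
  have hst : s - t ≠ 0 := by
    intro h0
    rw [h0, zero_smul] at h
    exact huv (sub_eq_zero.1 h.symm)
  have hw : w ∈ span K {y} := mem_of_smul_mem' hst (h ▸ sub_mem hu hv)
  refine he ?_
  have : e = s • w - u := by rw [hs]; abel
  rw [this]
  exact sub_mem (smul_mem _ _ hw) hu

theorem span_one_eq_iff : span K {x} = span K {y} ↔ x ∈ span K {y} ∧ y ∈ span K {x} := by
  constructor
  · intro h
    exact ⟨h ▸ mem_span_one_self x, h.symm ▸ mem_span_one_self y⟩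
  · rintro ⟨h, h'⟩
    exact le_antisymm (by simpa using h) (by simpa using h')

end LinearAlgebra

/-! ### The fundamental theorem for maps given by representatives -/

section Semilinear

variable {K V L W : Type*} [DivisionRing K] [AddCommGroup V] [Module K V]
  [DivisionRing L] [AddCommGroup W] [Module L W]

/-- An additive map of rank at least two mapping vector lines into vector lines is semilinear. -/
theorem exists_semilinear_of_additive (Φ : V →+ W) (h : ∀ (k : K) x, Φ (k • x) ∈ span L {Φ x})
    (h0 : ∃ x, Φ x ≠ 0) (hr : ∀ y : W, ∃ x, Φ x ∉ span L {y}) :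
    ∃ (σ : K →+* L) (Ψ : V →ₛₗ[σ] W), ∀ x, Ψ x = Φ x := by
  obtain ⟨o, ho⟩ := h0
  choose c hc using fun (k : K) x => mem_span_singleton.1 (h k x)
  have hind : ∀ k x y, Φ x ≠ 0 → Φ y ∉ span L {Φ x} → c k x = c k y := by
    intro k x y hx hy
    -- Two expansions of `Φ (k • (x + y))`; independence of `Φ x` and `Φ y` makes both coefficients
    -- vanish.
    have h1 : (c k (x + y) - c k x) • Φ x = (c k y - c k (x + y)) • Φ y := by
      have := hc k (x + y)
      rw [smul_add k, map_add, map_add, ← hc k x, ← hc k y, smul_add] at this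
      rw [sub_smul, sub_smul, sub_eq_sub_iff_add_eq_add, this]
      abel
    have h2 : c k y - c k (x + y) = 0 := by
      by_contra hne
      exact hy (mem_of_smul_mem' hne (h1 ▸ smul_mem_span_one _ _))
    rw [h2, zero_smul, smul_eq_zero, or_iff_left hx] at h1
    rw [← sub_eq_zero.1 h1, sub_eq_zero.1 h2]
  have hcon : ∀ k x, Φ x ≠ 0 → c k x = c k o := by
    intro k x hx
    by_cases hxo : Φ x ∈ span L {Φ o}
    -- When `Φ x` and `Φ o` are dependent, both are compared with a `z` whose image is independent
    -- of each.
    · obtain ⟨z, hz⟩ := hr (Φ o)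
      rw [hind k o z ho hz, hind k x z hx fun hh => hz (mem_of_mem_span_one hh hxo)]
    · exact (hind k o x ho hxo).symm
  have key : ∀ k x, Φ (k • x) = c k o • Φ x := by
    intro k x
    by_cases hx : Φ x = 0
    · have := h k x
      rw [hx] at this ⊢
      rw [smul_zero]
      simpa using this
    · rw [← hcon k x hx, hc]
  have inj : ∀ a b : L, a • Φ o = b • Φ o → a = b := fun a b hab => smul_left_injective L ho hab
  refine ⟨{ toFun := fun k => c k o
            map_one' := inj _ _ (by rw [← key]; simp)
            map_mul' := fun a b => inj _ _ (by rw [← key, mul_smul, key, key, mul_smul])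
            map_zero' := inj _ _ (by rw [← key]; simp)
            map_add' := fun a b => inj _ _ (by rw [← key, add_smul, map_add, key, key, add_smul]) },
    { toFun := Φ, map_add' := map_add Φ, map_smul' := key }, fun _ => rfl⟩

end Semilinear

section Fundamental

variable {K V L W : Type*} [DivisionRing K] [AddCommGroup V] [Module K V]
  [DivisionRing L] [AddCommGroup W] [Module L W]

/-- The fundamental theorem for partial morphisms of projective spaces, in terms of
representatives. -/
theorem exists_semilinear_of_add_mem (g : V → W) (hadd : ∀ x y, g (x + y) ∈ span L {g x, g y})
    (hsmul : ∀ (k : K) x, g (k • x) ∈ span L {g x}) (hr : ∀ y z : W, ∃ x, g x ∉ span L {y, z}) :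
    ∃ (σ : K →+* L) (Φ : V →ₛₗ[σ] W), ∀ x, span L {g x} = span L {Φ x} := by
  have hneg : ∀ x, g (-x) ∈ span L {g x} := fun x => by simpa using hsmul (-1) x
  have hsub : ∀ x y, g (x - y) ∈ span L {g x, g y} := fun x y => by
    rw [sub_eq_add_neg]
    exact mem_of_mem_span_two (hadd x (-y)) (left_mem_span_two _ _)
      (mem_of_mem_span_one (hneg y) (right_mem_span_two _ _))
  have hl : ∀ x y, g x ∈ span L {g (x + y), g y} := fun x y => by simpa using hsub (x + y) y
  have hrt : ∀ x y, g y ∈ span L {g (x + y), g x} := fun x y => by simpa using hsub (x + y) x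
  obtain ⟨o, ho⟩ := hr 0 0
  have ho : g o ≠ 0 := fun h => ho (by rw [h]; exact zero_mem _)
  set e := g o with he
  have hswap : ∀ x, g x ∉ span L {e} → e ∉ span L {g x} := fun x hx h =>
    hx (mem_span_one_symm h ho)
  -- The multiple of `g x` normalised so that `e + v` represents the image of `o + x`. On `span {e}`
  -- there is no such normalisation, and 0 is a filler.
  have hex : ∀ x, ∃ v, g x ∉ span L {e} → v ∈ span L {g x} ∧ e + v ∈ span L {g (o + x)} := by
    intro x
    by_cases hx : g x ∈ span L {e}
    · exact ⟨0, fun h => (h hx).elim⟩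
    · obtain ⟨a, b, hab⟩ := mem_span_pair.1 (hadd o x)
      have ha : a ≠ 0 := by
        rintro rfl
        refine hswap x hx (mem_of_mem_span_two (hl o x) ?_ (mem_span_one_self _))
        rw [← hab, zero_smul, zero_add]
        exact smul_mem_span_one _ _
      refine ⟨(a⁻¹ * b) • g x, fun _ => ⟨smul_mem_span_one _ _, ?_⟩⟩
      refine mem_of_smul_mem' ha ?_
      rw [smul_add, smul_smul, mul_inv_cancel_left₀ ha, hab]
      exact mem_span_one_self _
  choose φ hφ using hex
  have huniq : ∀ x v, g x ∉ span L {e} → v ∈ span L {g x} → e + v ∈ span L {g (o + x)} →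
      v = φ x := fun x v hx h h' =>
    eq_of_add_mem_span_one (hswap x hx) h (hφ x hx).1 h' (hφ x hx).2
  have hφ0 : ∀ x, g x ∉ span L {e} → φ x ≠ 0 := by
    intro x hx h0
    have h1 := (hφ x hx).2
    rw [h0, add_zero] at h1
    refine hx (mem_of_mem_span_two (hrt o x) ?_ (mem_span_one_self _))
    exact mem_span_one_symm h1 ho
  have hgφ : ∀ x, g x ∉ span L {e} → g x ∈ span L {φ x} := fun x hx =>
    mem_span_one_symm (hφ x hx).1 (hφ0 x hx)
  have hgoφ : ∀ x, g x ∉ span L {e} → g (o + x) ∈ span L {e + φ x} := by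
    intro x hx
    refine mem_span_one_symm (hφ x hx).2 fun h0 => hswap x hx ?_
    rw [eq_neg_of_add_eq_zero_left h0]
    exact neg_mem (hφ x hx).1
  -- Parallelogram law: `g (o + x + y)` is found as the intersection of two lines, then projected
  -- from `e` to give `g (x + y)`.
  have hadd1 : ∀ x y, g x ∉ span L {e} → g y ∉ span L {e, g x} → φ (x + y) = φ x + φ y := by
    intro x y hx hy
    have hye : g y ∉ span L {e} := fun h => hy (mem_of_mem_span_one h (left_mem_span_two _ _))
    have hxyD : g (x + y) ∉ span L {e} := fun h =>
      hy (mem_of_mem_span_two (hrt x y) (mem_of_mem_span_one h (left_mem_span_two _ _))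
        (right_mem_span_two _ _))
    have hi : LinearIndependent L ![e, φ x, φ y] := by
      refine linearIndependent_three_of_notMem ho ?_ ?_
      · exact fun h => hx (mem_of_mem_span_one (hgφ x hx) h)
      · refine fun h => hy (mem_of_mem_span_one (hgφ y hye)
          (mem_of_mem_span_two h (left_mem_span_two _ _) ?_))
        exact mem_of_mem_span_one (hφ x hx).1 (right_mem_span_two _ _)
    obtain ⟨-, hi2, hi3⟩ := notMem_span_two_of_linearIndependent hi
    symm
    have h1 : g (o + (x + y)) ∈ span L {e + φ x + φ y} := by
      refine mem_span_add_add hi ?_ ?_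
      · rw [← add_assoc]
        exact mem_of_mem_span_two (hadd _ _)
          (mem_of_mem_span_one (hgoφ x hx) (left_mem_span_two _ _))
          (mem_of_mem_span_one (hgφ y hye) (right_mem_span_two _ _))
      · rw [add_comm x, ← add_assoc]
        exact mem_of_mem_span_two (hadd _ _)
          (mem_of_mem_span_one (hgoφ y hye) (left_mem_span_two _ _))
          (mem_of_mem_span_one (hgφ x hx) (right_mem_span_two _ _))
    have h1' : g (o + (x + y)) ≠ 0 := by
      intro h0
      have h2 := hl (o + x) y
      rw [add_assoc, h0] at h2
      have h3 : e + φ x ∈ span L {φ y} := mem_of_mem_span_one (hφ x hx).2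
        (mem_of_mem_span_two h2 (zero_mem _) (hgφ y hye))
      obtain ⟨a, ha⟩ := mem_span_singleton.1 h3
      have := (coeff_eq_of_linearIndependent_three hi (a := 1) (b := 1) (c := 0) (a' := 0)
        (b' := 0) (c' := a) (by simp [ha])).1
      exact one_ne_zero this
    have h4 : g (x + y) ∈ span L {φ x + φ y} := by
      refine mem_span_add_of_mem hi ?_ ?_
      · exact mem_of_mem_span_two (hadd _ _)
          (mem_of_mem_span_one (hgφ x hx) (left_mem_span_two _ _))
          (mem_of_mem_span_one (hgφ y hye) (right_mem_span_two _ _))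
      · exact mem_of_mem_span_two (hrt o (x + y))
          (mem_of_mem_span_one h1 (right_mem_span_two _ _)) (left_mem_span_two _ _)
    refine huniq _ _ hxyD (mem_span_one_symm h4 ?_) ?_
    · intro h0
      exact hxyD (h0 ▸ zero_mem _)
    · rw [← add_assoc e]
      exact mem_span_one_symm h1 h1'
  -- a vector independent from `e` and `g x`, and the behaviour of `φ` when adding it
  have hD : ∀ x z, g z ∉ span L {e, g x} → g z ∉ span L {e} := fun x z h h' =>
    h (mem_of_mem_span_one h' (left_mem_span_two _ _))
  have hDadd : ∀ x z, g z ∉ span L {e, g x} → g (z + x) ∉ span L {e} := fun x z h h' =>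
    h (mem_of_mem_span_two (hl z x) (mem_of_mem_span_one h' (left_mem_span_two _ _))
      (right_mem_span_two _ _))
  -- For `g x` in `span {e}` the missing value is the increment `φ (z + x) - φ z`. It does not
  -- depend on `z`: evaluate `φ (z + x + z')` in two ways if `e`, `g z`, `g z'` are independent, and
  -- pass through a third vector otherwise.
  have hex2 : ∀ x, ∃ v, (g x ∉ span L {e} → v = φ x) ∧
      ∀ z, g z ∉ span L {e, g x} → φ (z + x) = φ z + v := by
    intro x
    by_cases hx : g x ∈ span L {e}
    · have hle : ∀ z, g z ∉ span L {e} → g z ∉ span L {e, g x} := fun z hz h =>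
        hz (mem_of_mem_span_two h (mem_span_one_self _) hx)
      have hind : ∀ z z', g z ∉ span L {e} → g z' ∉ span L {e, g z} →
          φ (z + x) - φ z = φ (z' + x) - φ z' := by
        intro z z' hz hz'
        have hz'e := hD z z' hz'
        have h1 := hadd1 (z + x) z' (hDadd x z (hle z hz)) fun h => hz' <|
          mem_of_mem_span_two h (left_mem_span_two _ _) <| mem_of_mem_span_two (hadd z x)
            (right_mem_span_two _ _) (mem_of_mem_span_one hx (left_mem_span_two _ _))
        have h2 := hadd1 z (z' + x) hz fun h => hz' <|
          mem_of_mem_span_two (hl z' x) h (mem_of_mem_span_one hx (left_mem_span_two _ _))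
        have h3 : z + x + z' = z + (z' + x) := by abel
        rw [h3, h2] at h1
        rw [sub_eq_sub_iff_add_eq_add, ← h1, add_comm]
      obtain ⟨z₀, hz₀⟩ := hr e e
      have hz₀ : g z₀ ∉ span L {e} := fun h => hz₀ (by simpa using h)
      refine ⟨φ (z₀ + x) - φ z₀, fun h => (h hx).elim, fun z hz => ?_⟩
      have hze := hD x z hz
      rw [← sub_eq_iff_eq_add']
      by_cases hzz : g z ∈ span L {e, g z₀}
      · obtain ⟨z₁, hz₁⟩ := hr e (g z₀)
        rw [hind z₀ z₁ hz₀ hz₁]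
        refine hind z z₁ hze fun h => hz₁ ?_
        exact mem_of_mem_span_two h (left_mem_span_two _ _) hzz
      · exact (hind z₀ z hz₀ hzz).symm
    · refine ⟨φ x, fun _ => rfl, fun z hz => ?_⟩
      rw [add_comm, hadd1 x z hx hz, add_comm]
  choose Φ hΦ hΦz using hex2
  have hΦmem : ∀ x, Φ x ∈ span L {g x} := by
    intro x
    by_cases hx : g x ∈ span L {e}
    · obtain ⟨z, hz⟩ := hr e e
      have hz : g z ∉ span L {e} := fun h => hz (by simpa using h)
      obtain ⟨z', hz'⟩ := hr e (g z)
      have hmem : ∀ z, g z ∉ span L {e} → Φ x ∈ span L {g x, g z} := by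
        intro z hz
        have hz1 : g z ∉ span L {e, g x} := fun h =>
          hz (mem_of_mem_span_two h (mem_span_one_self _) hx)
        have : Φ x = φ (z + x) - φ z := by rw [hΦz x z hz1]; abel
        rw [this]
        refine sub_mem ?_ ?_
        · refine mem_of_mem_span_one (hφ _ (hDadd x z hz1)).1 ?_
          exact mem_of_mem_span_two (hadd _ _) (right_mem_span_two _ _) (left_mem_span_two _ _)
        · exact mem_of_mem_span_one (hφ _ hz).1 (right_mem_span_two _ _)
      -- Otherwise `g z` and `g z'` would both lie in the span of `g x` and `Φ x`, so `g z'` would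
      -- lie in that of `e` and `g z`.
      by_contra hcon
      have h1 : g z ∈ span L {g x, Φ x} := mem_span_two_exchange' (hmem z hz) hcon
      have h2 : g z' ∈ span L {g x, Φ x} := mem_span_two_exchange' (hmem z' (hD _ _ hz')) hcon
      have h3 : Φ x ∈ span L {g x, g z} := hmem z hz
      refine hz' (mem_of_mem_span_two h2 ?_ (mem_of_mem_span_two h3 ?_ (right_mem_span_two _ _)))
      all_goals exact mem_of_mem_span_one hx (left_mem_span_two _ _)
    · rw [hΦ x hx]
      exact (hφ x hx).1
  have hΦadd : ∀ x y, Φ (x + y) = Φ x + Φ y := by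
    intro x y
    by_cases h : g x ∉ span L {e} ∧ g y ∉ span L {e, g x}
    · have hxy : g (x + y) ∉ span L {e} := by
        rw [add_comm]
        exact hDadd x y h.2
      rw [hΦ _ hxy, hΦ x h.1, hΦ y (hD _ _ h.2), hadd1 x y h.1 h.2]
    -- Now `e`, `g x`, `g y` lie in a two-generated subspace. A `z` mapped outside it gives two
    -- expressions for `φ (z + x + y)`, from which additivity is read off.
    · obtain ⟨a, b, z, ha, hx, hy, hz⟩ : ∃ (a b : W) (z : V), e ∈ span L {a, b} ∧
          g x ∈ span L {a, b} ∧ g y ∈ span L {a, b} ∧ g z ∉ span L {a, b} := by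
        by_cases hx : g x ∈ span L {e}
        · obtain ⟨z, hz⟩ := hr e (g y)
          exact ⟨e, g y, z, left_mem_span_two _ _, mem_of_mem_span_one hx (left_mem_span_two _ _),
            right_mem_span_two _ _, hz⟩
        · obtain ⟨z, hz⟩ := hr e (g x)
          exact ⟨e, g x, z, left_mem_span_two _ _, right_mem_span_two _ _,
            not_not.1 fun hy => h ⟨hx, hy⟩, hz⟩
      have h1 := hΦz (x + y) z fun h => hz <|
        mem_of_mem_span_two h ha (mem_of_mem_span_two (hadd x y) hx hy)
      have h2 := hΦz x z fun h => hz (mem_of_mem_span_two h ha hx)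
      have h3 := hΦz y (z + x) fun h => hz <|
        mem_of_mem_span_two (hl z x) (mem_of_mem_span_two h ha hy) hx
      rw [add_assoc, h1, h2, add_assoc] at h3
      exact add_left_cancel h3
  have hgΦ : ∀ x, g x ∈ span L {Φ x} := by
    intro x
    by_cases hx0 : g x = 0
    · rw [hx0]; exact zero_mem _
    refine mem_span_one_symm (hΦmem x) fun h0 => hx0 ?_
    obtain ⟨z, hz⟩ := hr e (g x)
    have h1 := hΦz x z hz
    rw [h0, add_zero] at h1
    have h2 := (hφ _ (hDadd x z hz)).1
    rw [h1] at h2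
    have h3 : g (z + x) ∈ span L {g z} :=
      mem_of_mem_span_one (mem_span_one_symm h2 (hφ0 _ (hD _ _ hz))) (hφ z (hD _ _ hz)).1
    by_contra hx0
    refine hz (mem_of_mem_span_one (mem_span_one_symm ?_ hx0) (right_mem_span_two _ _))
    exact mem_of_mem_span_two (hrt z x) h3 (mem_span_one_self _)
  obtain ⟨σ, Ψ, hΨ⟩ := exists_semilinear_of_additive (K := K) (L := L) (AddMonoidHom.mk' Φ hΦadd)
    (fun k x => mem_of_mem_span_one (hΦmem (k • x)) (mem_of_mem_span_one (hsmul k x) (hgΦ x)))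
    ⟨o, fun h => ho (by
      have := hgΦ o
      rw [show Φ o = 0 from h] at this
      simpa using this)⟩
    (fun y => by
      obtain ⟨x, hx⟩ := hr y y
      refine ⟨x, fun h => hx ?_⟩
      simpa using mem_of_mem_span_one (hgΦ x) h)
  refine ⟨σ, Ψ, fun x => ?_⟩
  rw [hΨ x]
  exact span_one_eq_iff.2 ⟨hgΦ x, hΦmem x⟩

end Fundamental

/-! ### Maps that respect linear dependence -/

section SpanMorphism

variable {K V L W : Type*} [DivisionRing K] [AddCommGroup V] [Module K V]
  [DivisionRing L] [AddCommGroup W] [Module L W]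

variable (K L) in
/-- A map defined on a set `D` of vectors, which represents a partial morphism of geometries from
the corresponding set of points: it respects linear dependence. -/
def SpanMorphism (D : Set V) (f : V → W) : Prop :=
  ∀ S ⊆ D, ∀ x ∈ D, x ∈ span K S → f x ∈ span L (f '' S)

namespace SpanMorphism

variable {D : Set V} {f : V → W} (hf : SpanMorphism K L D f) {x y z w : V}
include hf

theorem one (hx : x ∈ D) (hy : y ∈ D) (a : K) (h : x = a • y) : f x ∈ span L {f y} := by
  simpa using hf {y} (by simpa using hy) x hx (mem_span_singleton.2 ⟨a, h.symm⟩)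

theorem two (hx : x ∈ D) (hy : y ∈ D) (hz : z ∈ D) (a b : K) (h : x = a • y + b • z) :
    f x ∈ span L {f y, f z} := by
  simpa [Set.image_pair] using hf {y, z} (Set.insert_subset hy (by simpa using hz)) x hx
    (mem_span_pair.2 ⟨a, b, h.symm⟩)

theorem three (hx : x ∈ D) (hy : y ∈ D) (hz : z ∈ D) (hw : w ∈ D) (a b c : K)
    (h : x = a • y + b • z + c • w) : f x ∈ span L {f y, f z, f w} := by
  simpa [Set.image_insert_eq] using
    hf {y, z, w} (Set.insert_subset hy (Set.insert_subset hz (by simpa using hw))) x hx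
    (mem_span_triple.2 ⟨a, b, c, h.symm⟩)

end SpanMorphism

section

variable {h : V →ₗ[K] K} {f : V → W} (hf : SpanMorphism K L {x | h x ≠ 0} f) {a b c u v : V}
include hf

/-- Since `f e = 0`, adding multiples of `e` inside the domain does not change the span of `f x`.
With `h e = 1`, the vector `e + (x - h x • e)` lies in the domain for every `x` of `V`, so
projection from `e` yields a map defined on all of `V`, to which the fundamental theorem applies. -/
theorem SpanMorphism.exists_semilinear_of_zero {e : V} (he : h e ≠ 0) (hfe : f e = 0)
    (hr : ∀ y z : W, ∃ x, h x ≠ 0 ∧ f x ∉ span L {y, z}) :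
    ∃ (σ : K →+* L) (Φ : V →ₛₗ[σ] W), ∀ x, h x ≠ 0 → span L {f x} = span L {Φ x} := by
  wlog he1 : h e = 1 generalizing e
  · have h1 : h ((h e)⁻¹ • e) = 1 := by simp [he]
    refine this (e := (h e)⁻¹ • e) (by simp [h1]) ?_ h1
    have := hf.one (x := (h e)⁻¹ • e) (y := e) (by simp [he]) he _ rfl
    simpa [hfe] using this
  have hD : ∀ x, e + (x - h x • e) ∈ {x | h x ≠ 0} := fun x => by simp [he1]
  have hg : ∀ x, h x ≠ 0 → span L {f (e + (x - h x • e))} = span L {f x} := by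
    intro x hx
    refine span_one_eq_iff.2 ⟨?_, ?_⟩
    · refine mem_of_mem_span_two (hf.two (hD x) he hx (1 - h x) 1 ?_) (by simp [hfe])
        (mem_span_one_self _)
      match_scalars <;> simp [sub_eq_add_neg]
    · refine mem_of_mem_span_two (hf.two hx he (hD x) (h x - 1) 1 ?_) (by simp [hfe])
        (mem_span_one_self _)
      match_scalars <;> simp [sub_eq_add_neg, add_assoc]
  suffices H : ∃ (σ : K →+* L) (Φ : V →ₛₗ[σ] W),
      ∀ x, span L {f (e + (x - h x • e))} = span L {Φ x} by
    obtain ⟨σ, Φ, hΦ⟩ := H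
    exact ⟨σ, Φ, fun x hx => by rw [← hΦ x, hg x hx]⟩
  refine exists_semilinear_of_add_mem (K := K) (L := L) (fun x => f (e + (x - h x • e))) ?_ ?_ ?_
  · intro x y
    refine mem_of_mem_span_three (hf.three (hD (x + y)) he (hD x) (hD y) (-1) 1 1 ?_)
      (by simp [hfe]) (left_mem_span_two _ _) (right_mem_span_two _ _)
    rw [map_add]
    match_scalars <;> simp
    abel
  · intro k x
    refine mem_of_mem_span_two (hf.two (hD (k • x)) he (hD x) (1 - k) k ?_)
      (by simp [hfe]) (mem_span_one_self _)
    rw [map_smul, smul_eq_mul]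
    match_scalars <;> simp
    noncomm_ring
  · intro y z
    obtain ⟨x, hx, hxyz⟩ := hr y z
    refine ⟨x, fun hh => hxyz ?_⟩
    exact mem_of_mem_span_one (hg x hx ▸ mem_span_one_self (f x)) hh

theorem SpanMorphism.mem_line (ha : h a ≠ 0) (hu : h u = 0) {k : K} (hk : k ≠ 0) (j : K) :
    f (k • a + j • u) ∈ span L {f a, f (a + u)} := by
  refine hf.two (by simp [ha, hu, hk]) ha (by simp [ha, hu]) (k - j) j ?_
  match_scalars <;> simp

/-- Moving the base point along an affine line is reversible, so the inclusion obtained from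
`mem_line`, used twice, is an equality. -/
theorem SpanMorphism.line_eq (ha : h a ≠ 0) (hu : h u = 0) {k : K} (hk : k ≠ 0) (j : K) :
    span L {f (k • a + j • u), f (k • a + j • u + u)} = span L {f a, f (a + u)} := by
  have h1 : ∀ {a : V} {k : K} (j : K), h a ≠ 0 → k ≠ 0 →
      span L {f (k • a + j • u), f (k • a + j • u + u)} ≤ span L {f a, f (a + u)} := by
    intro a k j ha hk
    refine span_le.2 (Set.insert_subset (hf.mem_line ha hu hk j)
      (Set.singleton_subset_iff.2 ?_))
    have := hf.mem_line ha hu hk (j + 1)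
    rwa [add_smul, one_smul, ← add_assoc] at this
  refine le_antisymm (h1 j ha hk) ?_
  have := h1 (a := k • a + j • u) (k := k⁻¹) (-(k⁻¹ * j)) (by simp [hk, ha, hu])
    (inv_ne_zero hk)
  have h2 : k⁻¹ • (k • a + j • u) + -(k⁻¹ * j) • u = a := by
    match_scalars <;> simp [hk]
  rwa [h2] at this

end

end SpanMorphism

/-! ### Images of parallel affine lines -/

section AffineMorphism

variable {K V L W : Type*} [DivisionRing K] [AddCommGroup V] [Module K V]
  [DivisionRing L] [AddCommGroup W] [Module L W]

variable (L) in
/-- A map representing an everywhere defined morphism from the affine space `h ≠ 0`. -/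
structure AffineMorphism (h : V →ₗ[K] K) (f : V → W) : Prop where
  mor : SpanMorphism K L {x | h x ≠ 0} f
  ne_zero : ∀ x, h x ≠ 0 → f x ≠ 0

namespace AffineMorphism

variable {h : V →ₗ[K] K} {f : V → W} (hf : AffineMorphism L h f) {a b c u v : V}
include hf

/-- Otherwise the common span of `line_eq` would be generated by one vector: a line is either mapped
to one point or keeps the two points apart at every position. -/
theorem line_noncollapsed (ha : h a ≠ 0) (hu : h u = 0) (hau : f (a + u) ∉ span L {f a}) {k : K}
    (hk : k ≠ 0) (j : K) : f (k • a + j • u + u) ∉ span L {f (k • a + j • u)} := by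
  intro hh
  have h1 := hf.mor.line_eq ha hu hk j
  have h2 : ∀ x ∈ span L {f a, f (a + u)}, x ∈ span L {f (k • a + j • u)} := fun x hx => by
    rw [← h1] at hx
    exact mem_of_mem_span_two hx (mem_span_one_self _) hh
  refine hau (mem_of_mem_span_one (h2 _ (right_mem_span_two _ _)) ?_)
  exact mem_span_one_symm (h2 _ (left_mem_span_two _ _)) (hf.ne_zero a ha)

theorem linearIndependent (ha : h a ≠ 0) (hau : f (a + u) ∉ span L {f a})
    (hb : f b ∉ span L {f a, f (a + u)}) : LinearIndependent L ![f a, f (a + u), f b] :=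
  linearIndependent_three_of_notMem (hf.ne_zero a ha) hau hb

theorem parallel_notMem (ha : h a ≠ 0) (hb : h b ≠ 0) (hu : h u = 0)
    (hbl : f b ∉ span L {f a, f (a + u)}) : f (b + u) ∉ span L {f a, f (a + u)} := by
  intro hh
  refine hbl (mem_of_mem_span_three (hf.mor.three hb (x := b) (y := b + u) (z := a) (w := a + u)
    (by simp [hb, hu]) ha (by simp [ha, hu]) 1 1 (-1) ?_) hh (left_mem_span_two _ _)
    (right_mem_span_two _ _))
  match_scalars <;> simp

/-- If `f a` were in the span, so would be `f (a + u)`, since `a + u = (b + u) + a - b`. The two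
image lines would then coincide and contain `f b`. -/
theorem parallel_notMem' (ha : h a ≠ 0) (hb : h b ≠ 0) (hu : h u = 0)
    (hau : f (a + u) ∉ span L {f a})
    (hbl : f b ∉ span L {f a, f (a + u)}) : f a ∉ span L {f b, f (b + u)} := by
  intro hh
  have h1 : f (a + u) ∈ span L {f b, f (b + u)} := by
    refine mem_of_mem_span_three (hf.mor.three (x := a + u) (y := b + u) (z := a) (w := b)
      (by simp [ha, hu]) (by simp [hb, hu]) ha hb 1 1 (-1) ?_) (right_mem_span_two _ _) hh
      (left_mem_span_two _ _)
    match_scalars <;> simp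
  exact hbl (mem_span_of_independent hh h1 (hf.ne_zero a ha) hau).1

/-- If the parallel through `b` were mapped to a point, write `a + t • b = (a + u) + t • (b - t⁻¹ •
u)`. The image of this vector would lie on the lines joining `f b` to `f a` and to `f (a + u)`,
hence in `span {f b}`, and then so would `f a`. -/
theorem parallel_noncollapsed (hK : ∃ k : K, k ≠ 0 ∧ k ≠ 1) (ha : h a ≠ 0) (hb : h b ≠ 0)
    (hu : h u = 0) (hau : f (a + u) ∉ span L {f a})
    (hbl : f b ∉ span L {f a, f (a + u)}) : f (b + u) ∉ span L {f b} := by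
  intro hh
  obtain ⟨k, hk0, hk1⟩ := hK
  -- With this `t` the value of `h` at `a + t • b` is `(1 - k) * h a`, which is why a scalar other
  -- than 0 and 1 is needed.
  obtain ⟨t, ht0, ht⟩ : ∃ t : K, t ≠ 0 ∧ h a + t * h b ≠ 0 := by
    refine ⟨-(k * (h a * (h b)⁻¹)), by simp [*], ?_⟩
    have : h a + -(k * (h a * (h b)⁻¹)) * h b = (1 - k) * h a := by
      rw [sub_mul, neg_mul, mul_assoc, mul_assoc, inv_mul_cancel₀ hb]; simp [sub_eq_add_neg]
    rw [this]
    exact mul_ne_zero (sub_ne_zero.2 hk1.symm) ha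
  have hi := hf.linearIndependent ha hau hbl
  have h1 : f (b + (-t⁻¹) • u) ∈ span L {f b} := by
    have := hf.mor.mem_line hb hu one_ne_zero (-t⁻¹)
    rw [one_smul] at this
    exact mem_of_mem_span_two this (mem_span_one_self _) hh
  have hm : h (a + t • b) ≠ 0 := by simpa using ht
  have h2 : f (a + t • b) ∈ span L {f a, f b} :=
    hf.mor.two hm ha hb 1 t (by simp)
  have h3 : f (a + t • b) ∈ span L {f (a + u), f b} := by
    refine mem_of_mem_span_two (hf.mor.two hm (y := a + u) (z := b + (-t⁻¹) • u) (by simp [ha, hu])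
      (by simp [hb, hu]) 1 t ?_) (left_mem_span_two _ _)
      (mem_of_mem_span_one h1 (right_mem_span_two _ _))
    match_scalars <;> simp [ht0]
  obtain ⟨p, q, hpq⟩ := mem_span_pair.1 h2
  obtain ⟨p', q', hpq'⟩ := mem_span_pair.1 h3
  obtain ⟨rfl, -, -⟩ := coeff_eq_of_linearIndependent_three hi
    (a := p) (b := 0) (c := q) (a' := 0) (b' := p') (c' := q') (by simp [hpq, hpq'])
  rw [zero_smul, zero_add] at hpq
  have h4 : f a ∈ span L {f b} := by
    refine mem_of_mem_span_two (hf.mor.two ha hm hb 1 (-t) ?_) ?_ (mem_span_one_self _)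
    · match_scalars <;> simp
    · rw [← hpq]
      exact smul_mem_span_one _ _
  exact hbl (mem_of_mem_span_one (mem_span_one_symm h4 (hf.ne_zero a ha)) (left_mem_span_two _ _))

/-- Desargues: two triangles in perspective from a line are in perspective from a point. -/
theorem exists_mem_lines_of_triangles (ha : h a ≠ 0) (hb : h b ≠ 0) (hc : h c ≠ 0)
    (hab : h a ≠ h b) (hac : h a ≠ h c) (hbc : h b ≠ h c) (hv : h v = 0)
    (hi : LinearIndependent L ![f a, f b, f c])
    (hi' : LinearIndependent L ![f (a + v), f (b + v), f (c + v)])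
    (hav : f (a + v) ∉ span L {f a}) :
    ∃ m ≠ 0, m ∈ span L {f a, f (a + v)} ∧ m ∈ span L {f b, f (b + v)} ∧
      m ∈ span L {f c, f (c + v)} := by
  -- Corresponding sides meet in the image of `x - y = (x + v) - (y + v)`, a vector of the domain
  -- because `h x ≠ h y`.
  have hsub : ∀ {x y : V}, h x ≠ 0 → h y ≠ 0 → h x ≠ h y →
      (∃ r s : L, r • f x + s • f y = f (x - y)) ∧
      ∃ r s : L, r • f (x + v) + s • f (y + v) = f (x - y) := by
    intro x y hx hy hxy
    have hxy' : h (x - y) ≠ 0 := by simpa [sub_eq_zero] using hxy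
    exact ⟨mem_span_pair.1 (hf.mor.two hxy' hx hy 1 (-1) (by simp [sub_eq_add_neg])),
      mem_span_pair.1 (hf.mor.two hxy' (y := x + v) (z := y + v) (by simp [hx, hv])
        (by simp [hy, hv]) 1 (-1) (by match_scalars <;> simp))⟩
  obtain ⟨⟨α₁, β₁, h1⟩, α₂, β₂, h2⟩ := hsub ha hb hab
  obtain ⟨⟨γ₁, δ₁, h3⟩, γ₂, δ₂, h4⟩ := hsub hb hc hbc
  obtain ⟨⟨ε₁, ζ₁, h5⟩, ε₂, ζ₂, h6⟩ := hsub ha hc hac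
  have hab' : h (a - b) ≠ 0 := by simpa [sub_eq_zero] using hab
  have hbc' : h (b - c) ≠ 0 := by simpa [sub_eq_zero] using hbc
  have hac' : h (a - c) ≠ 0 := by simpa [sub_eq_zero] using hac
  -- The three meeting points are collinear since `a - c = (a - b) + (b - c)`: this is the Desargues
  -- axis.
  obtain ⟨l, m, h7⟩ := mem_span_pair.1 (hf.mor.two hac' hab' hbc' 1 1 (by simp))
  obtain ⟨hfa, hfb, hfc⟩ := notMem_span_two_of_linearIndependent hi
  have hα₁ : α₁ ≠ 0 := by
    rintro rfl
    have : f a ∈ span L {f b} := by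
      refine mem_of_mem_span_two (hf.mor.two ha hab' hb 1 1 (by simp)) ?_ (mem_span_one_self _)
      rw [← h1, zero_smul, zero_add]
      exact smul_mem_span_one _ _
    exact hfb (mem_span_one_symm this hfa)
  have hl : l ≠ 0 := by
    rintro rfl
    have : f a ∈ span L {f b, f c} := by
      refine mem_of_mem_span_two (hf.mor.two ha hac' hc 1 1 (by simp)) ?_ (right_mem_span_two _ _)
      rw [← h7, zero_smul, zero_add, ← h3]
      exact smul_mem _ _ (smul_add_smul_mem_span_two _ _ _ _)
    obtain ⟨r, s, hrs⟩ := mem_span_pair.1 this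
    exact one_ne_zero (coeff_eq_of_linearIndependent_three hi (a := 1) (b := 0) (c := 0) (a' := 0)
      (b' := r) (c' := s) (by simp [hrs])).1
  -- The point for `a - c` has no component along the vertex coming from `b`, in either triangle.
  -- These two cancellations turn the three side relations into a common vector of the lines joining
  -- corresponding vertices.
  obtain ⟨-, h8, -⟩ := coeff_eq_of_linearIndependent_three hi (a := l * α₁)
    (b := l * β₁ + m * γ₁) (c := m * δ₁) (a' := ε₁) (b' := 0) (c' := ζ₁) (by
      rw [zero_smul, add_zero, h5, ← h7, ← h1, ← h3]
      match_scalars <;> simp)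
  obtain ⟨-, h9, -⟩ := coeff_eq_of_linearIndependent_three hi' (a := l * α₂)
    (b := l * β₂ + m * γ₂) (c := m * δ₂) (a' := ε₂) (b' := 0) (c' := ζ₂) (by
      rw [zero_smul, add_zero, h6, ← h7, ← h2, ← h4]
      match_scalars <;> simp)
  have e1 : (l * α₁) • f a + (-(l * α₂)) • f (a + v) =
      (-(l * β₁)) • f b + (l * β₂) • f (b + v) := by
    have : l • (α₁ • f a + β₁ • f b) = l • (α₂ • f (a + v) + β₂ • f (b + v)) := by rw [h1, h2]
    rw [← sub_eq_zero] at this ⊢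
    rw [← this]
    match_scalars <;> simp
  have e2 : (-(l * β₁)) • f b + (l * β₂) • f (b + v) =
      (-(m * δ₁)) • f c + (m * δ₂) • f (c + v) := by
    have : m • (γ₁ • f b + δ₁ • f c) = m • (γ₂ • f (b + v) + δ₂ • f (c + v)) := by rw [h3, h4]
    rw [eq_neg_of_add_eq_zero_left h8, eq_neg_of_add_eq_zero_left h9]
    rw [← sub_eq_zero] at this ⊢
    rw [← this]
    match_scalars <;> simp
  refine ⟨_, ?_, smul_add_smul_mem_span_two (l * α₁) (-(l * α₂)) _ _, ?_, ?_⟩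
  · intro h0
    rw [neg_smul, ← sub_eq_add_neg, sub_eq_zero] at h0
    have hne : (l * α₁) • f a ≠ 0 := smul_ne_zero (mul_ne_zero hl hα₁) hfa
    have : l * α₂ ≠ 0 := by
      intro hh
      rw [hh, zero_smul] at h0
      exact hne h0
    exact hav (mem_of_smul_mem' this (h0 ▸ smul_mem_span_one _ _))
  · rw [e1]
    exact smul_add_smul_mem_span_two _ _ _ _
  · rw [e1, e2]
    exact smul_add_smul_mem_span_two _ _ _ _

end AffineMorphism

end AffineMorphism

/-! ### Concurrence of the images of three parallel lines -/

namespace AffineMorphism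

variable {K V L W : Type*} [DivisionRing K] [AddCommGroup V] [Module K V]
  [DivisionRing L] [AddCommGroup W] [Module L W]

variable {h : V →ₗ[K] K} {f : V → W} (hf : AffineMorphism L h f) {a b c u v : V}
include hf

/-- Desargues applies once some translate of the triangle by `j • u`, `j ≠ 0`, has an independent
image. A degenerate translate has its vertices on the axis; if this happened for `j = 1` and `j =
k`, the axis would contain `f a`, hence also `f b` and `f c`. -/
theorem exists_mem_lines_of_ne (hK : ∃ k : K, k ≠ 0 ∧ k ≠ 1) (ha : h a ≠ 0) (hb : h b ≠ 0)
    (hc : h c ≠ 0) (hab : h a ≠ h b) (hac : h a ≠ h c) (hbc : h b ≠ h c) (hu : h u = 0)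
    (hi : LinearIndependent L ![f a, f b, f c]) (hau : f (a + u) ∉ span L {f a})
    (hbl : f b ∉ span L {f a, f (a + u)}) :
    ∃ m ≠ 0, m ∈ span L {f a, f (a + u)} ∧ m ∈ span L {f b, f (b + u)} ∧
      m ∈ span L {f c, f (c + u)} := by
  obtain ⟨hfa, hfb, hfc⟩ := notMem_span_two_of_linearIndependent hi
  have hmem : ∀ {x} (j : K), h x ≠ 0 → f (x + j • u) ∈ span L {f x, f (x + u)} := by
    intro x j hx
    simpa using hf.mor.mem_line hx hu one_ne_zero j
  have hle : ∀ {x} (j : K), h x ≠ 0 →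
      span L {f x, f (x + j • u)} ≤ span L {f x, f (x + u)} := fun j hx =>
    span_le.2 (Set.insert_subset (left_mem_span_two _ _)
      (Set.singleton_subset_iff.2 (hmem j hx)))
  have hab' : h (a - b) ≠ 0 := by simpa [sub_eq_zero] using hab
  have hbc' : h (b - c) ≠ 0 := by simpa [sub_eq_zero] using hbc
  have hD : ∀ {x} (j : K), h x ≠ 0 → h (x + j • u) ≠ 0 := fun j hx => by simpa [hu] using hx
  -- A degenerate image triangle spans one line, and that line contains the two distinct axis points
  -- `f (a - b)` and `f (b - c)`.
  have hbad : ∀ j : K, ¬ LinearIndependent L ![f (a + j • u), f (b + j • u), f (c + j • u)] →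
      f (a + j • u) ∈ span L {f (a - b), f (b - c)} := by
    intro j hj
    have hbj : f (b + j • u) ∉ span L {f (a + j • u)} := fun hh =>
      hf.parallel_notMem ha hb (u := j • u) (by simp [hu]) (fun h' => hbl (hle j ha h'))
        (mem_of_mem_span_one hh (right_mem_span_two _ _))
    have hcj : f (c + j • u) ∈ span L {f (a + j • u), f (b + j • u)} := by
      by_contra hcj
      exact hj (linearIndependent_three_of_notMem (hf.ne_zero _ (hD j ha)) hbj hcj)
    have hr : f (a - b) ∈ span L {f (a + j • u), f (b + j • u)} :=
      hf.mor.two hab' (hD j ha) (hD j hb) 1 (-1) (by match_scalars <;> simp)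
    have hs : f (b - c) ∈ span L {f (a + j • u), f (b + j • u)} :=
      mem_of_mem_span_two (hf.mor.two hbc' (hD j hb) (hD j hc) 1 (-1)
        (by match_scalars <;> simp)) (right_mem_span_two _ _) hcj
    refine (mem_span_of_independent hr hs (hf.ne_zero _ hab') fun hrs => hfc ?_).1
    have h1 : f (b - c) ∈ span L {f a, f b} := mem_of_mem_span_one hrs
      (hf.mor.two hab' ha hb 1 (-1) (by simp [sub_eq_add_neg]))
    exact mem_of_mem_span_two (hf.mor.two hc hb hbc' 1 (-1) (by simp))
      (right_mem_span_two _ _) h1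
  obtain ⟨j, hj0, hj⟩ : ∃ j : K, j ≠ 0 ∧
      LinearIndependent L ![f (a + j • u), f (b + j • u), f (c + j • u)] := by
    by_contra! hcon
    obtain ⟨k, hk0, hk1⟩ := hK
    have h1 := hbad 1 (hcon 1 one_ne_zero)
    have h2 := hbad k (hcon k hk0)
    have hka : 1 - k ≠ 0 := sub_ne_zero.2 hk1.symm
    have hfa' : f a ∈ span L {f (a - b), f (b - c)} := by
      refine mem_of_mem_span_two (hf.mor.two ha (hD 1 ha) (hD k ha) (-(1 - k)⁻¹ * k)
        ((1 - k)⁻¹) ?_) h1 h2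
      match_scalars
      · have : -(1 - k)⁻¹ * k + (1 - k)⁻¹ = (1 - k)⁻¹ * (1 - k) := by noncomm_ring
        simpa [hka] using this.symm
      · simp
    have hfb' : f b ∈ span L {f (a - b), f (b - c)} :=
      mem_of_mem_span_two (hf.mor.two hb ha hab' 1 (-1) (by simp)) hfa' (left_mem_span_two _ _)
    have hfc' : f c ∈ span L {f (a - b), f (b - c)} :=
      mem_of_mem_span_two (hf.mor.two hc hb hbc' 1 (-1) (by simp)) hfb' (right_mem_span_two _ _)
    exact not_linearIndependent_three_of_mem hfa' hfb' hfc' hi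
  obtain ⟨m, hm, h1, h2, h3⟩ := hf.exists_mem_lines_of_triangles ha hb hc hab hac hbc
    (v := j • u) (by simp [hu]) hi hj (fun hh => hau <| by
      refine mem_of_mem_span_two (hf.mor.two (x := a + u) (by simp [ha, hu]) ha (hD j ha)
        (1 - j⁻¹) j⁻¹ ?_) (mem_span_one_self _) hh
      match_scalars <;> simp [hj0])
  exact ⟨m, hm, hle j ha h1, hle j hb h2, hle j hc h3⟩

/-- Scaling a base vector changes neither its image point nor its image line, so `h` can be given
three different nonzero values at the vertices, as Desargues requires. -/
theorem exists_mem_three_lines_of_card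
    (hK : ∃ α β γ : K, α ≠ 0 ∧ β ≠ 0 ∧ γ ≠ 0 ∧ α ≠ β ∧ α ≠ γ ∧ β ≠ γ)
    (ha : h a ≠ 0) (hb : h b ≠ 0) (hc : h c ≠ 0) (hu : h u = 0)
    (hau : f (a + u) ∉ span L {f a}) (hab : f b ∉ span L {f a, f (a + u)})
    (hac : f c ∉ span L {f a, f (a + u)}) :
    ∃ m ≠ 0, m ∈ span L {f a, f (a + u)} ∧ m ∈ span L {f b, f (b + u)} ∧
      m ∈ span L {f c, f (c + u)} := by
  obtain ⟨α, β, γ, hα, hβ, hγ, hαβ, hαγ, hβγ⟩ := hK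
  have hK' : ∃ k : K, k ≠ 0 ∧ k ≠ 1 := by
    refine ⟨α⁻¹ * β, by simp [*], fun h1 => hαβ ?_⟩
    rw [inv_mul_eq_one₀ hα] at h1
    exact h1
  have hfba : f b ∉ span L {f a} := fun hh => hab (mem_of_mem_span_one hh (left_mem_span_two _ _))
  -- If `f c` is on the line of `f a` and `f b`, then `f (c + u)` is not, and `c + u` lies on the
  -- same parallel.
  wlog hi : f c ∉ span L {f a, f b} generalizing c
  · have hcu : f (c + u) ∉ span L {f a, f b} := by
      intro hcu
      refine hf.parallel_notMem' ha hc hu hau hac ?_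
      refine (mem_span_of_independent (not_not.1 hi) hcu (hf.ne_zero c hc) ?_).1
      exact hf.parallel_noncollapsed hK' ha hc hu hau hac
    have h1 := this (c := c + u) (by simp [hc, hu])
      (hf.parallel_notMem ha hc hu hac) hcu
    have h2 := hf.mor.line_eq hc hu one_ne_zero (1 : K)
    rw [one_smul, one_smul] at h2
    rwa [h2] at h1
  have hline : ∀ {x : V} {k : K}, h x ≠ 0 → k ≠ 0 →
      span L {f ((k * (h x)⁻¹) • x), f ((k * (h x)⁻¹) • x + u)} = span L {f x, f (x + u)} ∧
      h ((k * (h x)⁻¹) • x) = k ∧ f ((k * (h x)⁻¹) • x) ∈ span L {f x} ∧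
      f x ∈ span L {f ((k * (h x)⁻¹) • x)} := by
    intro x k hx hk
    have h1 := hf.mor.line_eq hx hu (k := k * (h x)⁻¹) (by simp [hx, hk]) 0
    have h2 : h ((k * (h x)⁻¹) • x) = k := by simp [hx]
    have h3 : f ((k * (h x)⁻¹) • x) ∈ span L {f x} :=
      hf.mor.one (x := (k * (h x)⁻¹) • x) (by rw [Set.mem_ofPred_eq, h2]; exact hk) hx _ rfl
    refine ⟨by simpa using h1, h2, h3, mem_span_one_symm h3 (hf.ne_zero _ (by rwa [h2]))⟩
  obtain ⟨la, xa, ma, ma'⟩ := hline ha hα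
  obtain ⟨lb, xb, mb, mb'⟩ := hline hb hβ
  obtain ⟨lc, xc, mc, mc'⟩ := hline hc hγ
  have hfa0 := hf.ne_zero a ha
  rw [← la, ← lb, ← lc]
  refine hf.exists_mem_lines_of_ne hK' (by rwa [xa]) (by rwa [xb]) (by rwa [xc])
    (by rwa [xa, xb]) (by rwa [xa, xc]) (by rwa [xb, xc]) hu ?_ ?_ ?_
  · refine linearIndependent_three_of_notMem (hf.ne_zero _ (by rwa [xa])) ?_ ?_
    · exact fun hh => hfba (mem_of_mem_span_one mb' (mem_of_mem_span_one hh ma))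
    · refine fun hh => hi (mem_of_mem_span_one mc' (mem_of_mem_span_two hh ?_ ?_))
      · exact mem_of_mem_span_one ma (left_mem_span_two _ _)
      · exact mem_of_mem_span_one mb (right_mem_span_two _ _)
  · simpa using hf.line_noncollapsed ha hu hau (k := α * (h a)⁻¹) (by simp [hα, ha]) 0
  · rw [la]
    exact fun hh => hab (mem_of_mem_span_one mb' hh)

/-- In characteristic three, the direction of an affine line is the harmonic conjugate of one of
its three points with respect to the two others. -/
theorem exists_harmonic (h3 : (3 : K) = 0) (h3' : (3 : L) = 0) (ha : h a ≠ 0) (hb : h b = h a)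
    (hu : h u = 0) (hau : f (a + u) ∉ span L {f a}) (hab : f b ∉ span L {f a, f (a + u)}) :
    ∃ x ∈ span L {f a}, ∃ y ∈ span L {f (a + u)}, x ≠ 0 ∧ y ≠ 0 ∧ x + y ∈ span L {f (a - u)} ∧
      y - x ∈ span L {f b, f (b + u)} := by
  have hi := hf.linearIndependent ha hau hab
  have h2 : (2 : K) = -1 := by
    rw [eq_neg_iff_add_eq_zero, ← h3]; norm_num
  have h1 : (1 : K) = -1 + -1 := by
    rw [← sub_eq_zero, ← h3]; norm_num
  have h20 : (2 : K) ≠ 0 := by rw [h2]; simp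
  have hb0 : h b ≠ 0 := hb ▸ ha
  -- As 3 = 0, the nine vectors `a + i • u`, `b + i • u`, `-a - b + i • u` with `i` in `{0, 1, -1}`
  -- share one value of `h`. They form an affine plane of order three, whose incidences determine
  -- the coordinates below.
  have hdau : h (a + u) ≠ 0 := by simp [ha, hu]
  have hdbu : h (b + u) ≠ 0 := by simp [hb, ha, hu]
  have hd20 : h (a - u) ≠ 0 := by simp [ha, hu]
  have hs : -h a - h a ≠ 0 := by
    have : -h a - h a = -(2 * h a) := by noncomm_ring
    rw [this]
    exact neg_ne_zero.2 (mul_ne_zero h20 ha)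
  have hd02 : h (-a - b) ≠ 0 := by simpa [hb] using hs
  have hd12 : h (-a - b + u) ≠ 0 := by simpa [hb, hu] using hs
  have hd22 : h (-a - b - u) ≠ 0 := by simpa [hb, hu] using hs
  obtain ⟨α, β, γ, h11⟩ := mem_span_triple.1 (hf.mor.three hdbu ha hdau hb0 (-1) 1 1
    (by match_scalars <;> simp))
  have hα : α ≠ 0 := by
    rintro rfl
    have : f a ∈ span L {f (a + u), f b} := by
      refine mem_of_mem_span_three (hf.mor.three ha hdau hb0 hdbu 1 1 (-1)
        (by match_scalars <;> simp)) (left_mem_span_two _ _) (right_mem_span_two _ _) ?_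
      rw [← h11, zero_smul, zero_add]
      exact smul_add_smul_mem_span_two _ _ _ _
    obtain ⟨r, s, hrs⟩ := mem_span_pair.1 this
    exact one_ne_zero (coeff_eq_of_linearIndependent_three hi (a := 1) (b := 0) (c := 0) (a' := 0)
      (b' := r) (c' := s) (by simp [hrs])).1
  have hβ : β ≠ 0 := by
    rintro rfl
    have : f (a + u) ∈ span L {f a, f b} := by
      refine mem_of_mem_span_three (hf.mor.three hdau ha hb0 hdbu 1 (-1) 1
        (by match_scalars <;> simp)) (left_mem_span_two _ _) (right_mem_span_two _ _) ?_
      rw [← h11, zero_smul, add_zero]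
      exact smul_add_smul_mem_span_two _ _ _ _
    obtain ⟨r, s, hrs⟩ := mem_span_pair.1 this
    exact one_ne_zero (coeff_eq_of_linearIndependent_three hi (a := 0) (b := 1) (c := 0) (a' := r)
      (b' := 0) (c' := s) (by simp [hrs])).2.1
  have hγ : γ ≠ 0 := by
    rintro rfl
    refine hf.parallel_notMem ha hb0 hu hab ?_
    rw [← h11, zero_smul, add_zero]
    exact smul_add_smul_mem_span_two _ _ _ _
  -- coordinates in which the image of the affine plane is the standard one
  set E := (-α) • f a with hE
  set A := β • f (a + u) with hA
  set B := γ • f b with hB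
  have hEa : f a ∈ span L {E} := mem_of_smul_mem' (neg_ne_zero.2 hα) (mem_span_one_self _)
  have hAa : f (a + u) ∈ span L {A} := mem_of_smul_mem' hβ (mem_span_one_self _)
  have hBa : f b ∈ span L {B} := mem_of_smul_mem' hγ (mem_span_one_self _)
  have hi' : LinearIndependent L ![E, A, B] := by
    rw [linearIndependent_three_iff] at hi ⊢
    intro x y z hxyz
    rw [hE, hA, hB, smul_smul, smul_smul, smul_smul] at hxyz
    simpa [hα, hβ, hγ] using hi _ _ _ hxyz
  obtain ⟨hE0, hAE, -⟩ := notMem_span_two_of_linearIndependent hi'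
  have hA0 : A ≠ 0 := fun h0 => hAE (h0 ▸ zero_mem _)
  have h11' : f (b + u) = A + B - E := by
    rw [← h11, hE, neg_smul]; abel
  have hEm : E ∈ span L {f a} := smul_mem_span_one _ _
  have hAm : A ∈ span L {f (a + u)} := smul_mem_span_one _ _
  clear_value E A B
  have hL : ∀ {w x y x' y' : W}, w ∈ span L {x, y} → x ∈ span L {x'} → y ∈ span L {y'} →
      w ∈ span L {x', y'} := fun hw hx hy => mem_of_mem_span_two hw
    (mem_of_mem_span_one hx (left_mem_span_two _ _))
    (mem_of_mem_span_one hy (right_mem_span_two _ _))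
  have hBB : A + B - E ∈ span L {A + B - E} := mem_span_one_self _
  -- the point `- a - b - u`
  have h22 : f (-a - b - u) ∈ span L {A + B} := by
    have p1 := hf.mor.two hd22 ha hdbu (-1) (-1) (by match_scalars <;> simp)
    rw [h11'] at p1
    obtain ⟨s, t, p1⟩ := mem_span_pair.1 (hL p1 hEa hBB)
    obtain ⟨s', t', p2⟩ := mem_span_pair.1 (hL
      (hf.mor.two hd22 hdau hb0 (-1) (-1) (by match_scalars <;> simp)) hAa hBa)
    obtain ⟨-, rfl, rfl⟩ := coeff_eq_of_linearIndependent_three hi' (a := s - t) (b := t) (c := t)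
      (a' := 0) (b' := s') (c' := t') (by
        rw [zero_smul, zero_add, p2, ← p1]; match_scalars <;> simp [sub_eq_add_neg])
    rw [← p2, ← smul_add]
    exact smul_mem_span_one _ _
  -- the point `a - u`
  obtain ⟨x, hx, hx'⟩ : ∃ x : L, f (a - u) ∈ span L {A + x • E} ∧
      A + x • E ∈ span L {f (a - u)} := by
    obtain ⟨s, t, p1⟩ := mem_span_pair.1 (hL
      (hf.mor.two hd20 ha hdau 2 (-1) (by match_scalars <;> norm_num)) hEa hAa)
    have ht : t ≠ 0 := by
      rintro rfl
      rw [zero_smul, add_zero] at p1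
      refine hau (mem_of_mem_span_two (hf.mor.two hdau ha hd20 2 (-1)
        (by match_scalars <;> norm_num)) (mem_span_one_self _) ?_)
      rw [← p1, hE]
      exact smul_mem _ _ (smul_mem_span_one _ _)
    have p2 : f (a - u) = t • (A + (t⁻¹ * s) • E) := by
      rw [← p1]; match_scalars <;> simp [ht]
    refine ⟨t⁻¹ * s, p2 ▸ smul_mem_span_one _ _, mem_of_smul_mem' ht ?_⟩
    rw [← p2]
    exact mem_span_one_self _
  -- the point `- a - b`
  obtain ⟨y, hy⟩ : ∃ y : L, f (-a - b) ∈ span L {B + y • E} := by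
    obtain ⟨s, t, p1⟩ := mem_span_pair.1 (hL
      (hf.mor.two hd02 ha hb0 (-1) (-1) (by match_scalars <;> simp)) hEa hBa)
    have ht : t ≠ 0 := by
      rintro rfl
      rw [zero_smul, add_zero] at p1
      refine hab (mem_of_mem_span_two (hf.mor.two hb0 ha hd02 (-1) (-1)
        (by match_scalars <;> simp)) (left_mem_span_two _ _) ?_)
      rw [← p1, hE]
      exact smul_mem _ _ (smul_mem _ _ (left_mem_span_two _ _))
    have p2 : f (-a - b) = t • (B + (t⁻¹ * s) • E) := by
      rw [← p1]; match_scalars <;> simp [ht]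
    exact ⟨t⁻¹ * s, p2 ▸ smul_mem_span_one _ _⟩
  -- The point `b + u` is collinear with `a - u` and `-a - b`.
  have hxy : x + y = -1 := by
    have p1 := hf.mor.two hdbu hd20 hd02 (-1) (-1) (by match_scalars <;> simp)
    rw [h11'] at p1
    obtain ⟨s, t, p2⟩ := mem_span_pair.1 (hL p1 hx hy)
    obtain ⟨p3, rfl, rfl⟩ := coeff_eq_of_linearIndependent_three hi' (a := s * x + t * y) (b := s)
      (c := t) (a' := -1) (b' := 1) (c' := 1) (by
        rw [eq_comm, ← sub_eq_zero] at p2 ⊢; rw [← p2]; match_scalars <;> simp)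
    simpa using p3
  -- The point `-a - b + u` lies on the lines joining `a + u` to `b + u`, `-a - b - u` to `-a - b`,
  -- and `a - u` to `b`.
  have hxyy : x = y * y := by
    have q1 := hf.mor.two hd12 hdau hdbu (-1) (-1) (by
      match_scalars <;> simp
      exact h1)
    rw [h11'] at q1
    obtain ⟨p, q, q1⟩ := mem_span_pair.1 (hL q1 hAa hBB)
    obtain ⟨p', q', q2⟩ := mem_span_pair.1 (hL
      (hf.mor.two hd12 hd22 hd02 (-1) 2 (by match_scalars <;> norm_num)) h22 hy)
    obtain ⟨r1, r2, r3⟩ := coeff_eq_of_linearIndependent_three hi' (a := -q) (b := p + q)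
      (c := q) (a' := q' * y) (b' := p') (c' := p' + q') (by
        rw [← sub_eq_zero] at q1 q2 ⊢
        have := congrArg₂ (· - ·) q1 q2
        simp only [sub_zero] at this
        rw [← this]
        match_scalars <;> simp)
    have q3 : A + x • E ∈ span L {B, f (-a - b + u)} := by
      refine mem_of_mem_span_one hx' (mem_of_mem_span_two (hf.mor.two hd20 hb0 hd12 (-1) (-1)
        (by match_scalars <;> simp)) ?_ (right_mem_span_two _ _))
      exact mem_of_mem_span_one hBa (left_mem_span_two _ _)
    obtain ⟨s, d, q3⟩ := mem_span_pair.1 q3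
    obtain ⟨s1, s2, s3⟩ := coeff_eq_of_linearIndependent_three hi' (a := x) (b := 1)
      (c := 0) (a' := d * (q' * y)) (b' := d * p') (c' := s + d * (p' + q')) (by
        rw [← q2] at q3
        rw [eq_comm, ← sub_eq_zero] at q3
        rw [← sub_eq_zero, ← q3]
        match_scalars <;> simp [mul_add])
    have t1 : d * q' = y := by
      have : d * q = -x := by rw [s1, ← r1]; simp
      rw [r3, mul_add, ← s2] at this
      rw [← sub_eq_zero] at hxy this ⊢
      have e1 : d * q' - y = (1 + d * q' - -x) - (x + y - -1) := by abel
      rw [e1, hxy, this, sub_zero]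
    rw [s1, ← mul_assoc, t1]
  -- The two relations and 3 = 0 give `(y - 1) ^ 2 = 0`.
  have hy1 : y = 1 := by
    have e1 : (y - 1) * (y - 1) = (x + y + 1) - 3 * y + (y * y - x) := by noncomm_ring
    rw [hxy, h3', ← hxyy] at e1
    simpa [sub_eq_zero] using e1
  have hx1 : x = 1 := by
    rw [hy1] at hxyy
    simpa using hxyy
  refine ⟨E, hEm, A, hAm, hE0, hA0, ?_, ?_⟩
  · rwa [hx1, one_smul, add_comm] at hx'
  · have : A - E = f (b + u) - B := by rw [h11']; abel
    rw [this, hB]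
    exact sub_mem (right_mem_span_two _ _) (smul_mem _ _ (left_mem_span_two _ _))

end AffineMorphism

namespace AffineMorphism

variable {K V L W : Type*} [DivisionRing K] [AddCommGroup V] [Module K V]
  [DivisionRing L] [AddCommGroup W] [Module L W]

/-- The harmonic conjugate depends only on `f a`, `f (a + u)` and `f (a - u)`, all on the first
line. So `b` and `c` yield the same point. -/
theorem exists_mem_three_lines_of_three_eq_zero {h : V →ₗ[K] K} {f : V → W}
    (hf : AffineMorphism L h f) {a b c u : V} (h3 : (3 : K) = 0) (h3' : (3 : L) = 0)
    (ha : h a ≠ 0) (hb : h b ≠ 0) (hc : h c ≠ 0) (hu : h u = 0)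
    (hau : f (a + u) ∉ span L {f a}) (hab : f b ∉ span L {f a, f (a + u)})
    (hac : f c ∉ span L {f a, f (a + u)}) :
    ∃ m ≠ 0, m ∈ span L {f a, f (a + u)} ∧ m ∈ span L {f b, f (b + u)} ∧
      m ∈ span L {f c, f (c + u)} := by
  have key : ∀ b, h b ≠ 0 → f b ∉ span L {f a, f (a + u)} →
      ∃ x ∈ span L {f a}, ∃ y ∈ span L {f (a + u)}, x ≠ 0 ∧ y ≠ 0 ∧ x + y ∈ span L {f (a - u)} ∧
      y - x ∈ span L {f b, f (b + u)} := by
    intro b hb hab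
    have hk : h a * (h b)⁻¹ ≠ 0 := mul_ne_zero ha (inv_ne_zero hb)
    have h1 := hf.mor.line_eq hb hu hk 0
    rw [zero_smul, add_zero] at h1
    rw [← h1]
    refine hf.exists_harmonic h3 h3' ha (by simp [hb]) hu hau fun hh => hab ?_
    refine mem_of_mem_span_one (hf.mor.one hb (y := (h a * (h b)⁻¹) • b) (by simp [ha, hb])
      (h a * (h b)⁻¹)⁻¹ ?_) hh
    rw [inv_smul_smul₀ hk]
  obtain ⟨x, hx, y, hy, hx0, hy0, hxy, hm⟩ := key b hb hab
  obtain ⟨x', hx', y', hy', hx0', hy0', hxy', hm'⟩ := key c hc hac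
  have hind : ∀ s t : L, s • x = t • y → s = 0 := by
    intro s t hst
    by_contra hs
    have h1 : x ∈ span L {y} := mem_of_smul_mem' hs (hst ▸ smul_mem_span_one _ _)
    refine hau (mem_of_mem_span_one (mem_span_one_symm hy hy0) ?_)
    exact mem_of_mem_span_one (mem_span_one_symm h1 hx0) hx
  have hyx : y - x ≠ 0 := fun h0 => one_ne_zero (hind 1 1 (by
    rw [one_smul, one_smul, sub_eq_zero.1 h0]))
  obtain ⟨s, rfl⟩ := mem_span_singleton.1 (mem_of_mem_span_one hx' (mem_span_one_symm hx hx0))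
  obtain ⟨t, rfl⟩ := mem_span_singleton.1 (mem_of_mem_span_one hy' (mem_span_one_symm hy hy0))
  have hs : s ≠ 0 := by rintro rfl; simp at hx0'
  have hxy0 : x + y ≠ 0 := fun h0 => one_ne_zero (hind 1 (-1) (by
    rw [one_smul, neg_smul, one_smul, eq_neg_of_add_eq_zero_left h0]))
  -- Both sums represent `f (a - u)`, so the two pairs of representatives differ by one common
  -- scalar, and so do their differences.
  obtain ⟨r, hr⟩ := mem_span_singleton.1 (mem_of_mem_span_one hxy' (mem_span_one_symm hxy hxy0))
  have hrs : r - s = 0 := hind (r - s) (t - r) (by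
    rw [← sub_eq_zero] at hr ⊢; rw [← hr]; match_scalars <;> simp)
  have hrt : s = t := by
    rw [← sub_eq_zero.1 hrs, smul_add, add_left_cancel_iff] at hr
    exact smul_left_injective L hy0 hr ▸ (sub_eq_zero.1 hrs).symm
  subst hrt
  refine ⟨y - x, hyx, ?_, hm, ?_⟩
  · exact sub_mem (mem_of_mem_span_one hy (right_mem_span_two _ _))
      (mem_of_mem_span_one hx (left_mem_span_two _ _))
  · rw [← smul_sub] at hm'
    exact mem_of_smul_mem' hs hm'

/-! ### Directions as points at infinity -/

variable (L) in
/-- The vector `p` represents the common point at infinity of the images of the lines with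
direction `u`. -/
def IsDirection (h : V →ₗ[K] K) (f : V → W) (u : V) (p : W) : Prop :=
  ∀ a, h a ≠ 0 → p ∈ span L {f a, f (a + u)} ∧ f (a + u) ∈ span L {f a, p}

/-- Two image lines that are distinct and not collapsed determine the point at infinity as their
intersection; concurrence puts it on all other lines that are not collapsed. A collapsed line must
be mapped to this very point. -/
theorem exists_isDirection {h : V →ₗ[K] K} {f : V → W} (hf : AffineMorphism L h f) {u : V}
    (hK : ∃ k : K, k ≠ 0 ∧ k ≠ 1)
    (hlines : ∀ a b c, h a ≠ 0 → h b ≠ 0 → h c ≠ 0 → f (a + u) ∉ span L {f a} →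
      f b ∉ span L {f a, f (a + u)} → f c ∉ span L {f a, f (a + u)} →
      ∃ m ≠ 0, m ∈ span L {f a, f (a + u)} ∧ m ∈ span L {f b, f (b + u)} ∧
        m ∈ span L {f c, f (c + u)})
    (hr : ∀ y z : W, ∃ x, h x ≠ 0 ∧ f x ∉ span L {y, z}) (hu : h u = 0) :
    ∃ p, IsDirection L h f u p := by
  by_cases hcol : ∀ a, h a ≠ 0 → f (a + u) ∈ span L {f a}
  -- All lines with direction `u` collapse: the point at infinity is undefined, which 0 encodes.
  · exact ⟨0, fun a ha => ⟨zero_mem _, mem_of_mem_span_one (hcol a ha) (left_mem_span_two _ _)⟩⟩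
  push Not at hcol
  obtain ⟨a, ha, hau⟩ := hcol
  obtain ⟨b, hb, hab⟩ := hr (f a) (f (a + u))
  have hbu := hf.parallel_noncollapsed hK ha hb hu hau hab
  have hba := hf.parallel_notMem' ha hb hu hau hab
  have hD : ∀ {x}, h x ≠ 0 → h (x + u) ≠ 0 := fun hx => by simpa [hu] using hx
  obtain ⟨α, β, γ, hp⟩ := mem_span_triple.1 (hf.mor.three (hD hb) ha (hD ha) hb (-1) 1 1
    (by match_scalars <;> simp))
  -- From `b + u = -a + (a + u) + b`, the part of `f (b + u)` along the first line is the common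
  -- point of the two image lines.
  obtain ⟨p, hpdef⟩ : ∃ p, p = α • f a + β • f (a + u) := ⟨_, rfl⟩
  have hpa : p ∈ span L {f a, f (a + u)} := hpdef ▸ smul_add_smul_mem_span_two _ _ _ _
  have hpb' : f (b + u) = p + γ • f b := by rw [hpdef, hp]
  have hpb : p ∈ span L {f b, f (b + u)} := by
    rw [eq_sub_of_add_eq hpb'.symm]
    exact sub_mem (right_mem_span_two _ _) (smul_mem _ _ (left_mem_span_two _ _))
  have hp0 : p ≠ 0 := by
    rintro rfl
    rw [zero_add] at hpb'
    exact hbu (hpb' ▸ smul_mem_span_one _ _)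
  have hLab : ∀ m, m ∈ span L {f a, f (a + u)} → m ∈ span L {f b, f (b + u)} → m ∈ span L {p} := by
    intro m hma hmb
    by_contra hm
    exact hba (mem_of_mem_span_two (mem_span_of_independent hpa hma hp0 hm).1 hpb hmb)
  have hline : ∀ c, h c ≠ 0 → f (c + u) ∉ span L {f c} → p ∈ span L {f c, f (c + u)} := by
    intro c hc hcu
    by_cases hac : f c ∈ span L {f a, f (a + u)}
    · have hacu : f (c + u) ∈ span L {f a, f (a + u)} :=
        mem_of_mem_span_three (hf.mor.three (hD hc) ha (hD ha) hc (-1) 1 1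
          (by match_scalars <;> simp)) (left_mem_span_two _ _) (right_mem_span_two _ _) hac
      obtain ⟨h1, h2⟩ := mem_span_of_independent hac hacu (hf.ne_zero c hc) hcu
      exact mem_of_mem_span_two hpa h1 h2
    · obtain ⟨m, hm0, hma, hmb, hmc⟩ := hlines a b c ha hb hc hau hab hac
      exact mem_of_mem_span_one (mem_span_one_symm (hLab m hma hmb) hm0) hmc
  refine ⟨p, fun c hc => ?_⟩
  by_cases hcu : f (c + u) ∈ span L {f c}
  · refine ⟨?_, mem_of_mem_span_one hcu (left_mem_span_two _ _)⟩
    suffices p ∈ span L {f c} from mem_of_mem_span_one this (left_mem_span_two _ _)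
    -- If `f c` were on both lines it would represent the same point as `p`. So it is off one of
    -- them, and then the line through `c` cannot collapse.
    by_contra hpc
    by_cases h1 : f c ∈ span L {f a, f (a + u)}
    · by_cases h2 : f c ∈ span L {f b, f (b + u)}
      · exact hpc (mem_span_one_symm (hLab _ h1 h2) (hf.ne_zero c hc))
      · exact hf.parallel_noncollapsed hK hb hc hu hbu h2 hcu
    · exact hf.parallel_noncollapsed hK ha hc hu hau h1 hcu
  · have h1 := hline c hc hcu
    refine ⟨h1, mem_span_two_exchange' h1 fun hpc => ?_⟩
    obtain ⟨d, hd, hcd⟩ := hr (f c) (f (c + u))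
    refine hf.parallel_notMem' hc hd hu hcu hcd ?_
    exact mem_of_mem_span_one (mem_span_one_symm hpc hp0)
      (hline d hd (hf.parallel_noncollapsed hK hc hd hu hcu hcd))

namespace IsDirection

variable {h : V →ₗ[K] K} {f : V → W} {u v : V} {p q m : W}

/-- Seen from an `a` with `f a` outside the span of `p` and `q`, both would be points at infinity of
the same image line, which forces `f a` into that span. -/
theorem mem_of_isDirection (hr : ∀ y z : W, ∃ x, h x ≠ 0 ∧ f x ∉ span L {y, z})
    (hp : IsDirection L h f u p) (hq : IsDirection L h f u q) : q ∈ span L {p} := by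
  by_contra hpq
  obtain ⟨a, ha, hfa⟩ := hr q p
  have h1 : q ∈ span L {f a, p} :=
    mem_of_mem_span_two (hq a ha).1 (left_mem_span_two _ _) (hp a ha).2
  exact hfa (mem_span_two_exchange h1 hpq)

theorem smul_left (hf : SpanMorphism K L {x | h x ≠ 0} f) (hu : h u = 0)
    (hp : IsDirection L h f u p) {k : K} (hk : k ≠ 0) :
    IsDirection L h f (k • u) p := by
  intro a ha
  refine ⟨mem_of_mem_span_two (hp a ha).1 (left_mem_span_two _ _) ?_,
    mem_of_mem_span_two (hf.two (x := a + k • u) (by simpa [hu] using ha) ha (z := a + u)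
      (by simpa [hu] using ha) (1 - k) k (by match_scalars <;> simp)) (left_mem_span_two _ _)
      (hp a ha).2⟩
  exact hf.two (x := a + u) (by simpa [hu] using ha) ha (z := a + k • u)
      (by simpa [hu] using ha) (1 - k⁻¹) k⁻¹ (by match_scalars <;> simp [hk])

theorem smul_right (hp : IsDirection L h f u p) {s : L} (hs : s ≠ 0) :
    IsDirection L h f u (s • p) := fun a ha =>
  ⟨smul_mem _ _ (hp a ha).1, mem_of_mem_span_two (hp a ha).2 (left_mem_span_two _ _)
    (mem_of_smul_mem' hs (right_mem_span_two _ _))⟩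

theorem neg_left (hf : SpanMorphism K L {x | h x ≠ 0} f) (hu : h u = 0)
    (hp : IsDirection L h f u p) : IsDirection L h f (-u) p := by
  simpa using hp.smul_left hf hu (k := -1) (by simp)

/-- Normalisation of the direction of a line with respect to a point on it. -/
theorem exists_add_smul (hf : SpanMorphism K L {x | h x ≠ 0} f) (hu : h u = 0)
    (hp : IsDirection L h f u p) {a : V} (ha : h a ≠ 0) (hap : f a ∉ span L {p})
    (hpa : p ∉ span L {f a}) : ∃ s : L, s ≠ 0 ∧ f (a + u) ∈ span L {f a + s • p} ∧
      f a + s • p ∈ span L {f (a + u)} := by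
  obtain ⟨s, t, hst⟩ := mem_span_pair.1 (hp a ha).2
  have hs : s ≠ 0 := by
    rintro rfl
    rw [zero_smul, zero_add] at hst
    have h1 := (hp.neg_left hf hu (a + u) (by simpa [hu] using ha)).2
    rw [add_neg_cancel_right] at h1
    exact hap (mem_of_mem_span_two h1 (hst ▸ smul_mem_span_one _ _) (mem_span_one_self _))
  have ht : t ≠ 0 := by
    rintro rfl
    rw [zero_smul, add_zero] at hst
    exact hpa (mem_of_mem_span_two (hp a ha).1 (mem_span_one_self _)
      (hst ▸ smul_mem_span_one _ _))
  have h1 : f (a + u) = s • (f a + (s⁻¹ * t) • p) := by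
    rw [← hst]; match_scalars <;> simp [hs]
  refine ⟨s⁻¹ * t, by simp [hs, ht], h1 ▸ smul_mem_span_one _ _, mem_of_smul_mem' hs ?_⟩
  rw [← h1]
  exact mem_span_one_self _

/-- The points at infinity form a morphism. -/
theorem sub_mem (hf : AffineMorphism L h f) (hK : ∃ k : K, k ≠ 0 ∧ k ≠ 1)
    (hr : ∀ y z : W, ∃ x, h x ≠ 0 ∧ f x ∉ span L {y, z}) (hu : h u = 0) (hv : h v = 0)
    (hp : IsDirection L h f u p) (hq : IsDirection L h f v q)
    (hm : IsDirection L h f (u - v) m) : m ∈ span L {p, q} := by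
  -- Degenerate case, including `p = 0` or `q = 0`: both lie in one `span {r}`, and the path `a`, `a
  -- + u`, `a + u - v` stays in the span of `f a` and `r`.
  by_cases hdep : ∃ r ∈ span L {p, q}, p ∈ span L {r} ∧ q ∈ span L {r}
  · obtain ⟨r, hr', hpr, hqr⟩ := hdep
    refine mem_of_mem_span_one (x := r) ?_ hr'
    by_contra hmr
    obtain ⟨a, ha, hfa⟩ := hr m r
    refine hfa (mem_span_two_exchange (mem_of_mem_span_two (hm a ha).1
      (left_mem_span_two _ _) ?_) hmr)
    have h1 := (hq.neg_left hf.mor hv (a + u) (by simpa [hu] using ha)).2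
    rw [add_assoc, ← sub_eq_add_neg] at h1
    refine mem_of_mem_span_two h1 ?_ (mem_of_mem_span_one hqr (right_mem_span_two _ _))
    exact mem_of_mem_span_two (hp a ha).2 (left_mem_span_two _ _)
      (mem_of_mem_span_one hpr (right_mem_span_two _ _))
  have hp0 : p ≠ 0 := fun h0 => hdep
    ⟨q, right_mem_span_two _ _, h0 ▸ zero_mem _, mem_span_one_self _⟩
  have hqp : q ∉ span L {p} := fun hh => hdep
    ⟨p, left_mem_span_two _ _, mem_span_one_self _, hh⟩
  have hq0 : q ≠ 0 := fun h0 => hqp (h0 ▸ zero_mem _)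
  obtain ⟨a, ha, hfa⟩ := hr p q
  have hfa0 := hf.ne_zero a ha
  have hfp : f a ∉ span L {p} := fun hh => hfa (mem_of_mem_span_one hh (left_mem_span_two _ _))
  have hfq : f a ∉ span L {q} := fun hh => hfa (mem_of_mem_span_one hh (right_mem_span_two _ _))
  have hpf : p ∉ span L {f a} := fun hh => hfp (mem_span_one_symm hh hp0)
  have hqf : q ∉ span L {f a} := fun hh => hfq (mem_span_one_symm hh hq0)
  have hi : LinearIndependent L ![f a, p, q] := by
    refine linearIndependent_three_of_notMem hfa0 hpf fun hh => hfa ?_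
    have := mem_span_two_exchange hh hqp
    rwa [Set.pair_comm] at this
  obtain ⟨s, hs, h1, -⟩ := hp.exists_add_smul hf.mor hu ha hfp hpf
  obtain ⟨t, ht, h2, -⟩ := hq.exists_add_smul hf.mor hv ha hfq hqf
  -- The scalars are absorbed into `p` and `q`, so that `f a + p` and `f a + q` represent the images
  -- of `a + u` and `a + v`.
  suffices m ∈ span L {s • p, t • q} from mem_of_mem_span_two this
    (smul_mem _ _ (left_mem_span_two _ _)) (smul_mem _ _ (right_mem_span_two _ _))
  replace hp := hp.smul_right hs
  replace hq := hq.smul_right ht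
  have hsm : ∀ {p q : W} {s t : L}, s ≠ 0 → t ≠ 0 → LinearIndependent L ![f a, p, q] →
      LinearIndependent L ![f a, s • p, t • q] := by
    intro p q s t hs ht hi
    rw [linearIndependent_three_iff] at hi ⊢
    intro x y z hxyz
    rw [smul_smul, smul_smul] at hxyz
    simpa [hs, ht] using hi _ _ _ hxyz
  replace hi := hsm hs ht hi
  clear hdep hp0 hqp hq0 hfa hfp hfq hpf hqf
  generalize s • p = p at *
  generalize t • q = q at *
  clear hs ht s t
  obtain ⟨-, hpf, hqf⟩ := notMem_span_two_of_linearIndependent hi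
  replace hqf : q ∉ span L {f a} := fun hh => hqf (mem_of_mem_span_one hh (left_mem_span_two _ _))
  have hfp : f a ∉ span L {p} := fun hh => hpf (mem_span_one_symm hh hfa0)
  have hfq : f a ∉ span L {q} := fun hh => hqf (mem_span_one_symm hh hfa0)
  obtain ⟨k, hk0, hk1⟩ := hK
  obtain ⟨s, hs, h3, -⟩ := (hp.smul_left hf.mor hu hk0).exists_add_smul hf.mor (by simp [hu]) ha
    hfp hpf
  obtain ⟨t, ht, h4, -⟩ := (hq.smul_left hf.mor hv hk0).exists_add_smul hf.mor (by simp [hv]) ha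
    hfq hqf
  have hD : ∀ {x} {k l : K}, h x ≠ 0 → h (x + k • u + l • v) ≠ 0 := fun hx => by
    simpa [hu, hv] using hx
  have hDu : ∀ {x} {k : K}, h x ≠ 0 → h (x + k • u) ≠ 0 := fun hx => by simpa [hu] using hx
  have hDv : ∀ {x} {k : K}, h x ≠ 0 → h (x + k • v) ≠ 0 := fun hx => by simpa [hv] using hx
  have h5 : f (a + u + v) ∈ span L {f a + p + q} := by
    refine mem_span_add_add hi ?_ ?_
    · exact mem_of_mem_span_two (hq (a + u) (by simpa [hu] using ha)).2
        (mem_of_mem_span_one h1 (left_mem_span_two _ _)) (right_mem_span_two _ _)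
    · rw [add_right_comm]
      exact mem_of_mem_span_two (hp (a + v) (by simpa [hv] using ha)).2
        (mem_of_mem_span_one h2 (left_mem_span_two _ _)) (right_mem_span_two _ _)
  have h6 : f (a + k • u + k • v) ∈ span L {f a + s • p + t • q} := by
    refine mem_span_add_add (hsm hs ht hi) ?_ ?_
    · exact mem_of_mem_span_two ((hq.smul_left hf.mor hv hk0).smul_right ht _ (hDu ha)).2
        (mem_of_mem_span_one h3 (left_mem_span_two _ _)) (right_mem_span_two _ _)
    · rw [add_right_comm]
      exact mem_of_mem_span_two ((hp.smul_left hf.mor hu hk0).smul_right hs _ (hDv ha)).2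
        (mem_of_mem_span_one h4 (left_mem_span_two _ _)) (right_mem_span_two _ _)
  -- The vector `a + k • u + k • v` lies on the line through `a` with direction `u + v`, which ties
  -- the two scalars together.
  obtain rfl : s = t := by
    have h7 : f (a + k • u + k • v) ∈ span L {f a, f a + p + q} :=
      mem_of_mem_span_two (hf.mor.two (hD ha) ha (z := a + u + v) (by simpa [hu, hv] using ha)
        (1 - k) k (by match_scalars <;> simp)) (left_mem_span_two _ _)
        (mem_of_mem_span_one h5 (right_mem_span_two _ _))
    have h8 := mem_of_mem_span_one (mem_span_one_symm h6 (hf.ne_zero _ (hD ha))) h7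
    obtain ⟨x, y, hxy⟩ := mem_span_pair.1 h8
    obtain ⟨-, e1, e2⟩ := coeff_eq_of_linearIndependent_three hi (a := x + y) (b := y) (c := y)
      (a' := 1) (b' := s) (c' := t) (by
        rw [← sub_eq_zero] at hxy ⊢; rw [← hxy]; match_scalars <;> simp)
    rw [← e1, ← e2]
  have hs1 : s ≠ 1 := by
    rintro rfl
    rw [one_smul] at h3
    have hk : 1 - k ≠ 0 := sub_ne_zero.2 hk1.symm
    have h7 : f a ∈ span L {f a + p} := by
      refine mem_of_mem_span_two (hf.mor.two ha (y := a + u) (z := a + k • u)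
        (by simpa [hu] using ha) (hDu ha) (-(1 - k)⁻¹ * k) (1 - k)⁻¹ ?_) h1 h3
      match_scalars
      · have : -(1 - k)⁻¹ * k + (1 - k)⁻¹ = (1 - k)⁻¹ * (1 - k) := by noncomm_ring
        simpa [hk] using this.symm
      · simp
    obtain ⟨x, hx⟩ := mem_span_singleton.1 h7
    obtain ⟨e1, e2, -⟩ := coeff_eq_of_linearIndependent_three hi (a := x) (b := x) (c := 0)
      (a' := 1) (b' := 0) (c' := 0) (by
        rw [← sub_eq_zero] at hx ⊢; rw [← hx]; match_scalars <;> simp)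
    exact one_ne_zero (e1.symm.trans e2)
  have h7 : m ∈ span L {f a + p, f a + q} := by
    have := (hm (a + v) (by simpa [hv] using ha)).1
    rw [show a + v + (u - v) = a + u by abel] at this
    exact mem_of_mem_span_two this (mem_of_mem_span_one h2 (right_mem_span_two _ _))
      (mem_of_mem_span_one h1 (left_mem_span_two _ _))
  have h8 : m ∈ span L {f a + s • p, f a + s • q} := by
    have := (hm.smul_left hf.mor (by simp [hu, hv]) hk0 (a + k • v) (hDv ha)).1
    rw [show a + k • v + k • (u - v) = a + k • u by rw [smul_sub]; abel] at this
    exact mem_of_mem_span_two this (mem_of_mem_span_one h4 (right_mem_span_two _ _))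
      (mem_of_mem_span_one h3 (left_mem_span_two _ _))
  obtain ⟨x, y, h7⟩ := mem_span_pair.1 h7
  obtain ⟨z, w, h8⟩ := mem_span_pair.1 h8
  obtain ⟨e1, e2, e3⟩ := coeff_eq_of_linearIndependent_three hi (a := x + y) (b := x) (c := y)
    (a' := z + w) (b' := z * s) (c' := w * s) (by
      rw [← h8, ← sub_eq_zero] at h7
      rw [← sub_eq_zero, ← h7]; match_scalars <;> simp)
  -- The direction of `u - v` lies on two lines, one from the pair `a + u`, `a + v` and one from `a
  -- + k • u`, `a + k • v`. As `s ≠ 1`, they meet only in `span {p - q}`.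
  have e4 : x + y = 0 := by
    have : (z + w) * (s - 1) = 0 := by
      rw [mul_sub, add_mul, ← e2, ← e3, e1, mul_one, sub_self]
    rw [e1]
    exact (mul_eq_zero.1 this).resolve_right (sub_ne_zero.2 hs1)
  have : m = x • p + y • q := by
    rw [← h7, ← sub_eq_zero]
    have e5 : x • (f a + p) + y • (f a + q) - (x • p + y • q) = (x + y) • f a := by
      match_scalars <;> simp
    rw [e5, e4, zero_smul]
  rw [this]
  exact smul_add_smul_mem_span_two _ _ _ _

end IsDirection

end AffineMorphism

/-! ### The fundamental theorem on the complement of a hyperplane -/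

section

variable {K V L W : Type*} [DivisionRing K] [AddCommGroup V] [Module K V]
  [DivisionRing L] [AddCommGroup W] [Module L W]

/-- The fundamental theorem for partial morphisms defined on the complement of a hyperplane. -/
theorem SpanMorphism.exists_semilinear {h : V →ₗ[K] K} {f : V → W}
    (hf : SpanMorphism K L {x | h x ≠ 0} f) (hK : ∃ k : K, k ≠ 0 ∧ k ≠ 1)
    (hK' : (∃ α β γ : K, α ≠ 0 ∧ β ≠ 0 ∧ γ ≠ 0 ∧ α ≠ β ∧ α ≠ γ ∧ β ≠ γ) ∨
      ((3 : K) = 0 ∧ (3 : L) = 0))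
    (hr : ∀ y z : W, ∃ x, h x ≠ 0 ∧ f x ∉ span L {y, z}) :
    ∃ (σ : K →+* L) (Φ : V →ₛₗ[σ] W), ∀ x, h x ≠ 0 → span L {f x} = span L {Φ x} := by
  by_cases hE : ∃ e, h e ≠ 0 ∧ f e = 0
  · obtain ⟨e, he, hfe⟩ := hE
    exact hf.exists_semilinear_of_zero he hfe hr
  have hA : AffineMorphism L h f := ⟨hf, fun x hx h0 => hE ⟨x, hx, h0⟩⟩
  have hdir : ∀ u, ∃ p, h u = 0 → AffineMorphism.IsDirection L h f u p := by
    intro u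
    by_cases hu : h u = 0
    · obtain ⟨p, hp⟩ := hA.exists_isDirection (u := u) hK (fun a b c ha hb hc hau hab hac => by
        rcases hK' with hK' | ⟨h3, h3'⟩
        · exact hA.exists_mem_three_lines_of_card hK' ha hb hc hu hau hab hac
        · exact hA.exists_mem_three_lines_of_three_eq_zero h3 h3' ha hb hc hu hau hab hac) hr hu
      exact ⟨p, fun _ => hp⟩
    · exact ⟨0, fun hu' => (hu hu').elim⟩
  choose d hd using hdir
  classical
  -- The affine map completed by its points at infinity on the hyperplane `h x = 0`.
  let g : V → W := fun x => if h x = 0 then d x else f x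
  have hg0 : ∀ {x}, h x = 0 → g x = d x := fun hx => if_pos hx
  have hg1 : ∀ {x}, h x ≠ 0 → g x = f x := fun hx => if_neg hx
  suffices H : ∃ (σ : K →+* L) (Φ : V →ₛₗ[σ] W), ∀ x, span L {g x} = span L {Φ x} by
    obtain ⟨σ, Φ, hΦ⟩ := H
    exact ⟨σ, Φ, fun x hx => by rw [← hΦ, hg1 hx]⟩
  refine exists_semilinear_of_add_mem (K := K) g ?_ ?_ ?_
  · intro x y
    by_cases hx : h x = 0
    · by_cases hy : h y = 0
      · have hxy : h (x + y) = 0 := by simp [hx, hy]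
        rw [hg0 hx, hg0 hy, hg0 hxy]
        refine AffineMorphism.IsDirection.sub_mem (u := x) (v := -y) hA hK hr hx (by simp [hy])
          (hd x hx) ((hd y hy).neg_left hf hy) ?_
        rw [sub_neg_eq_add]
        exact hd _ hxy
      · have hxy : h (x + y) ≠ 0 := by simp [hx, hy]
        rw [hg0 hx, hg1 hy, hg1 hxy, add_comm, Set.pair_comm]
        exact (hd x hx y hy).2
    · by_cases hy : h y = 0
      · have hxy : h (x + y) ≠ 0 := by simp [hx, hy]
        rw [hg1 hx, hg0 hy, hg1 hxy]
        exact (hd y hy x hx).2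
      · by_cases hxy : h (x + y) = 0
        · rw [hg1 hx, hg1 hy, hg0 hxy]
          have := (hd _ hxy (-x) (by simpa using hx)).1
          rw [neg_add_cancel_left] at this
          refine mem_of_mem_span_two this (mem_of_mem_span_one (hf.one (y := x)
            (by simpa using hx) hx (-1) (by simp)) (left_mem_span_two _ _))
            (right_mem_span_two _ _)
        · rw [hg1 hx, hg1 hy, hg1 hxy]
          exact hf.two hxy hx hy 1 1 (by simp)
  · intro k x
    by_cases hk : k = 0
    · subst hk
      rw [zero_smul, hg0 (map_zero h)]
      -- Being a direction for `u = 0` places `d 0` in every `span {f a}`, which is impossible for a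
      -- nonzero vector by the rank hypothesis.
      have h0 : d 0 = 0 := by
        by_contra h0
        obtain ⟨a, ha, hfa⟩ := hr (d 0) 0
        have := (hd 0 (map_zero h) a ha).1
        rw [add_zero, Set.pair_eq_singleton] at this
        exact hfa (mem_of_mem_span_one (mem_span_one_symm this h0) (left_mem_span_two _ _))
      rw [h0]
      exact zero_mem _
    · by_cases hx : h x = 0
      · have hkx : h (k • x) = 0 := by simp [hx]
        rw [hg0 hx, hg0 hkx]
        exact AffineMorphism.IsDirection.mem_of_isDirection hr ((hd x hx).smul_left hf hx hk)
          (hd _ hkx)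
      · have hkx : h (k • x) ≠ 0 := by simp [hx, hk]
        rw [hg1 hx, hg1 hkx]
        exact hf.one hkx hx k rfl
  · intro y z
    obtain ⟨x, hx, hfx⟩ := hr y z
    exact ⟨x, by rwa [hg1 hx]⟩

end

/-! ### Proportionality of semilinear maps -/

section

variable {K V L W : Type*} [DivisionRing K] [AddCommGroup V] [Module K V]
  [DivisionRing L] [AddCommGroup W] [Module L W]

/-- A scalar multiple is semilinear for the ring morphism conjugated by `l`; over a noncommutative
`L` this changes `σ`. -/
theorem exists_semilinear_smul {σ : K →+* L} (Φ : V →ₛₗ[σ] W) {l : L} (hl : l ≠ 0) :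
    ∃ (τ : K →+* L) (Ψ : V →ₛₗ[τ] W), ∀ v, Ψ v = l • Φ v := by
  refine ⟨{ toFun := fun k => l * σ k * l⁻¹
            map_one' := by simp [hl]
            map_mul' := fun a b => by simp [mul_assoc, hl]
            map_zero' := by simp
            map_add' := fun a b => by simp [mul_add, add_mul] },
    { toFun := fun v => l • Φ v
      map_add' := fun a b => by simp
      map_smul' := fun k v => ?_ }, fun _ => rfl⟩
  change l • Φ (k • v) = (l * σ k * l⁻¹) • l • Φ v
  rw [LinearMap.map_smulₛₗ, smul_smul, smul_smul, inv_mul_cancel_right₀ hl]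

/-- Two semilinear maps of rank at least two which agree up to scalars on sufficiently many
vectors are proportional. -/
theorem exists_eq_smul_of_mem_span {σ τ : K →+* L} (Φ : V →ₛₗ[σ] W) (Ψ : V →ₛₗ[τ] W)
    (hK : ∃ k : K, k ≠ 0 ∧ k ≠ 1) {D : Set V} {x₁ : V} {h : V →ₗ[K] K} (h0 : h ≠ 0)
    (hD : ∀ v, h v ≠ 0 → ∃ s : K, v + s • x₁ ∈ D) (hΦ : Φ x₁ = 0) (hΨ : Ψ x₁ = 0)
    (hΦΨ : ∀ v ∈ D, Ψ v ∈ span L {Φ v}) (hr : ∀ y : W, ∃ v, Φ v ∉ span L {y}) :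
    ∃ l : L, ∀ v, Ψ v = l • Φ v := by
  obtain ⟨k, hk0, hk1⟩ := hK
  obtain ⟨a, ha⟩ : ∃ a, h a ≠ 0 := by
    by_contra! hcon
    exact h0 (LinearMap.ext hcon)
  have hmem : ∀ v, h v ≠ 0 → Ψ v ∈ span L {Φ v} := by
    intro v hv
    obtain ⟨s, hs⟩ := hD v hv
    simpa [LinearMap.map_smulₛₗ, hΦ, hΨ] using hΦΨ _ hs
  replace hr : ∀ y : W, ∃ v, h v ≠ 0 ∧ Φ v ∉ span L {y} := by
    intro y
    by_contra! hcon
    obtain ⟨v, hv⟩ := hr y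
    by_cases hhv : h v = 0
    · refine hv ?_
      have : Φ v = Φ (a + v) - Φ a := by simp
      rw [this]
      exact Submodule.sub_mem _ (hcon _ (by simpa [hhv] using ha)) (hcon _ ha)
    · exact hv (hcon v hhv)
  have hex : ∀ v, ∃ c : L, h v ≠ 0 → c • Φ v = Ψ v := by
    intro v
    by_cases hv : h v = 0
    · exact ⟨0, fun hh => (hh hv).elim⟩
    · obtain ⟨c, hc⟩ := mem_span_singleton.1 (hmem v hv)
      exact ⟨c, fun _ => hc⟩
  choose c hc using hex
  have hadd : ∀ x y, h x ≠ 0 → h y ≠ 0 → h (x + y) ≠ 0 → Φ x ≠ 0 → Φ y ∉ span L {Φ x} →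
      c x = c (x + y) ∧ c y = c (x + y) := by
    intro x y hx hy hxy hΦx hΦy
    have h1 : (c (x + y) - c x) • Φ x = (c y - c (x + y)) • Φ y := by
      have := hc _ hxy
      rw [map_add, map_add, ← hc x hx, ← hc y hy, smul_add] at this
      rw [sub_smul, sub_smul, sub_eq_sub_iff_add_eq_add, this]
      abel
    have h2 : c y - c (x + y) = 0 := by
      by_contra hne
      exact hΦy (mem_of_smul_mem' hne (h1 ▸ smul_mem_span_one _ _))
    rw [h2, zero_smul, smul_eq_zero, or_iff_left hΦx] at h1
    exact ⟨(sub_eq_zero.1 h1).symm, sub_eq_zero.1 h2⟩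
  have hind : ∀ x y, h x ≠ 0 → h y ≠ 0 → Φ x ≠ 0 → Φ y ∉ span L {Φ x} → c x = c y := by
    intro x y hx hy hΦx hΦy
    by_cases hxy : h (x + y) = 0
    · have hxy' : h x = -h y := by
        rw [map_add] at hxy
        exact eq_neg_of_add_eq_zero_left hxy
      have hσk : σ k ≠ 0 := (map_ne_zero σ).2 hk0
      have ht : h (x + k • y) ≠ 0 := by
        have : h (x + k • y) = (k - 1) * h y := by
          rw [map_add, map_smul, smul_eq_mul, hxy']; noncomm_ring
        rw [this]
        exact mul_ne_zero (sub_ne_zero.2 hk1) hy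
      have hty : h (y + (x + k • y)) ≠ 0 := by
        have : h (y + (x + k • y)) = k * h y := by
          rw [map_add, map_add, map_smul, smul_eq_mul, hxy']; abel
        rw [this]
        exact mul_ne_zero hk0 hy
      have hΦy0 : Φ y ≠ 0 := fun hh => hΦy (hh ▸ zero_mem _)
      have h1 := (hadd x (k • y) hx (by simp [hk0, hy]) ht hΦx (by
        rw [LinearMap.map_smulₛₗ]
        exact fun hh => hΦy (mem_of_smul_mem' hσk hh))).1
      have h2 := hadd y (x + k • y) hy ht hty hΦy0 (by
        rw [map_add, LinearMap.map_smulₛₗ]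
        intro hh
        have h3 : Φ x ∈ span L {Φ y} := by
          have := Submodule.sub_mem _ hh (smul_mem_span_one (σ k) (Φ y))
          rwa [add_sub_cancel_right] at this
        exact hΦy (mem_span_one_symm h3 hΦx))
      rw [h1, h2.1, h2.2]
    · obtain ⟨h1, h2⟩ := hadd x y hx hy hxy hΦx hΦy
      rw [h1, h2]
  obtain ⟨o, ho, hΦo⟩ := hr 0
  replace hΦo : Φ o ≠ 0 := fun hh => hΦo (by rw [hh]; exact zero_mem _)
  have hcon : ∀ x, h x ≠ 0 → Ψ x = c o • Φ x := by
    intro x hx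
    by_cases hΦx : Φ x = 0
    · have := hmem x hx
      rw [hΦx] at this ⊢
      simpa using this
    · rw [← hc x hx]
      congr 1
      by_cases hxo : Φ x ∈ span L {Φ o}
      · obtain ⟨z, hz, hΦz⟩ := hr (Φ o)
        rw [hind o z ho hz hΦo hΦz,
          hind x z hx hz hΦx fun hh => hΦz (mem_of_mem_span_one hh hxo)]
      · exact (hind o x ho hx hΦo hxo).symm
  refine ⟨c o, fun v => ?_⟩
  by_cases hv : h v = 0
  · have h1 := hcon (a + v) (by simpa [hv] using ha)
    rw [map_add, map_add, hcon a ha, smul_add] at h1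
    exact add_left_cancel h1
  · exact hcon v hv

end

/-! ### Extension modulo an image point, and gluing -/

section

variable {K V L V' W : Type*} [DivisionRing K] [AddCommGroup V] [Module K V]
  [DivisionRing L] [AddCommGroup V'] [Module L V'] [AddCommGroup W] [Module L W]

/-- Extension of a morphism after projection from the image of a point `x₁` in whose quotient the
domain contains the complement of a hyperplane. -/
theorem SpanMorphism.exists_semilinear_comp {D : Set V} {f : V → V'} (hf : SpanMorphism K L D f)
    (hK : ∃ k : K, k ≠ 0 ∧ k ≠ 1)
    (hK' : (∃ α β γ : K, α ≠ 0 ∧ β ≠ 0 ∧ γ ≠ 0 ∧ α ≠ β ∧ α ≠ γ ∧ β ≠ γ) ∨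
      ((3 : K) = 0 ∧ (3 : L) = 0))
    {x₁ : V} (hx₁ : x₁ ∈ D) {h : V →ₗ[K] K} (h0 : h ≠ 0) (hhx₁ : h x₁ = 0)
    (hD : ∀ v, h v ≠ 0 → ∃ s : K, v + s • x₁ ∈ D) (π : V' →ₗ[L] W) (hπ : π (f x₁) = 0)
    (hr : ∀ y z : W, ∃ x ∈ D, π (f x) ∉ span L {y, z}) :
    ∃ (σ : K →+* L) (Φ : V →ₛₗ[σ] W), ∀ v ∈ D, span L {π (f v)} = span L {Φ v} := by
  have hex : ∀ v, ∃ s : K, h v ≠ 0 → v + s • x₁ ∈ D := by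
    intro v
    by_cases hv : h v = 0
    · exact ⟨0, fun hh => (hh hv).elim⟩
    · obtain ⟨s, hs⟩ := hD v hv
      exact ⟨s, fun _ => hs⟩
  choose s hs using hex
  obtain ⟨a₀, ha₀⟩ : ∃ a, h a ≠ 0 := by
    by_contra! hcon
    exact h0 (LinearMap.ext hcon)
  have hmap : ∀ {x : V'} {S : Set V'}, x ∈ span L S → π x ∈ span L (π '' S) := fun hx => by
    rw [← Submodule.map_span]
    exact Submodule.mem_map_of_mem hx
  have hmap2 : ∀ {x y z : V'}, x ∈ span L {y, z} → π x ∈ span L {π y, π z} := fun hx => by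
    simpa [Set.image_pair] using hmap hx
  -- Vectors off the hyperplane are moved into `D` along `x₁`. As `π` kills `f x₁`, the chosen
  -- multiple of `x₁` affects `g` only up to a scalar.
  let g : V → W := fun v => π (f (v + s v • x₁))
  have hg : SpanMorphism K L {x | h x ≠ 0} g := by
    intro S hS x hx hxS
    have h1 : x + s x • x₁ ∈ span K (insert x₁ ((fun v => v + s v • x₁) '' S)) := by
      refine add_mem ?_ (smul_mem _ _ (subset_span (Set.mem_insert _ _)))
      refine span_le.2 (fun v hv => ?_) hxS
      have : v = (v + s v • x₁) - s v • x₁ := by abel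
      rw [this]
      exact Submodule.sub_mem _ (subset_span (Set.mem_insert_of_mem _ ⟨v, hv, rfl⟩))
        (smul_mem _ _ (subset_span (Set.mem_insert _ _)))
    have h2 := hmap (hf _ (Set.insert_subset hx₁ (by
      rintro _ ⟨v, hv, rfl⟩
      exact hs v (hS hv))) _ (hs x hx) h1)
    refine span_le.2 ?_ h2
    rintro _ ⟨_, ⟨_, rfl | ⟨v, hv, rfl⟩, rfl⟩, rfl⟩
    · rw [hπ]
      exact zero_mem _
    · exact subset_span ⟨v, hv, rfl⟩
  have hgD : ∀ v ∈ D, h v ≠ 0 → span L {g v} = span L {π (f v)} := by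
    intro v hv hhv
    refine span_one_eq_iff.2 ⟨?_, ?_⟩
    · exact mem_of_mem_span_two (hmap2 (hf.two (hs v hhv) hv hx₁ 1 (s v) (by simp)))
        (mem_span_one_self _) (hπ ▸ zero_mem _)
    · exact mem_of_mem_span_two (hmap2 (hf.two hv (hs v hhv) hx₁ 1 (-s v) (by
        match_scalars <;> simp))) (mem_span_one_self _) (hπ ▸ zero_mem _)
  -- points of `D` in the hyperplane
  have hgadd : ∀ v ∈ D, h v = 0 → ∀ a, h a ≠ 0 → g (a + v) ∈ span L {g a, π (f v)} ∧
      π (f v) ∈ span L {g a, g (a + v)} := by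
    intro v hv hhv a ha
    have hav : h (a + v) ≠ 0 := by simpa [hhv] using ha
    constructor
    · have := hmap (hf.three (hs _ hav) (hs a ha) hv hx₁ 1 1 (s (a + v) - s a) (by
        match_scalars <;> simp))
      rw [Set.image_insert_eq, Set.image_pair, hπ] at this
      exact mem_of_mem_span_three this (left_mem_span_two _ _) (right_mem_span_two _ _)
        (zero_mem _)
    · have := hmap (hf.three hv (hs a ha) (hs _ hav) hx₁ (-1) 1 (s a - s (a + v)) (by
        match_scalars <;> simp))
      rw [Set.image_insert_eq, Set.image_pair, hπ] at this
      exact mem_of_mem_span_three this (left_mem_span_two _ _) (right_mem_span_two _ _)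
        (zero_mem _)
  have hrg : ∀ y z : W, ∃ x, h x ≠ 0 ∧ g x ∉ span L {y, z} := by
    intro y z
    by_contra! hcon
    obtain ⟨x, hx, hfx⟩ := hr y z
    by_cases hhx : h x = 0
    · exact hfx (mem_of_mem_span_two (hgadd x hx hhx a₀ ha₀).2 (hcon _ ha₀)
        (hcon _ (by simpa [hhx] using ha₀)))
    · exact hfx (mem_of_mem_span_one (hgD x hx hhx ▸ mem_span_one_self (π (f x))) (hcon x hhx))
  obtain ⟨σ, Φ, hΦ⟩ := hg.exists_semilinear hK hK' hrg
  refine ⟨σ, Φ, fun v hv => ?_⟩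
  by_cases hhv : h v = 0
  · have hgΦ : ∀ {a}, h a ≠ 0 → g a ∈ span L {Φ a} ∧ Φ a ∈ span L {g a} := fun ha =>
      span_one_eq_iff.1 (hΦ _ ha)
    -- For `v` in the hyperplane, each of `Φ v` and `π (f v)` lies in the span of `g a` and the
    -- other. Taking `g a` outside their span makes them generate the same subspace.
    obtain ⟨a, ha, hga⟩ := hrg (Φ v) (π (f v))
    have hav : h (a + v) ≠ 0 := by simpa [hhv] using ha
    obtain ⟨h1, h2⟩ := hgadd v hv hhv a ha
    have h3 : π (f v) ∈ span L {g a, Φ v} := by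
      refine mem_of_mem_span_two h2 (left_mem_span_two _ _)
        (mem_of_mem_span_one (hgΦ hav).1 ?_)
      rw [map_add]
      exact add_mem (mem_of_mem_span_one (hgΦ ha).2 (left_mem_span_two _ _))
        (right_mem_span_two _ _)
    have h4 : Φ v ∈ span L {g a, π (f v)} := by
      have : Φ v = Φ (a + v) - Φ a := by simp
      rw [this]
      refine Submodule.sub_mem _ (mem_of_mem_span_one (hgΦ hav).2 h1)
        (mem_of_mem_span_one (hgΦ ha).2 (left_mem_span_two _ _))
    refine span_one_eq_iff.2 ⟨?_, ?_⟩
    · by_contra hcon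
      refine hga ?_
      rw [Set.pair_comm]
      exact mem_span_two_exchange h3 hcon
    · by_contra hcon
      exact hga (mem_span_two_exchange h4 hcon)
  · rw [← hgD v hv hhv, hΦ v hhv]

/-- A two-generated subspace of the quotient lifts to a subspace with three generators, one of them
`x₁`. So factoring out an image point costs one dimension of the room left by the hypothesis. -/
theorem exists_mkQ_notMem {ι : Type*} {D : Set ι} {f : ι → V'}
    (hr : ∀ y z w : V', ∃ x ∈ D, f x ∉ span L {y, z, w}) (x₁ : V') (y z : V' ⧸ span L {x₁}) :
    ∃ x ∈ D, (span L {x₁}).mkQ (f x) ∉ span L {y, z} := by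
  obtain ⟨y, rfl⟩ := Submodule.mkQ_surjective _ y
  obtain ⟨z, rfl⟩ := Submodule.mkQ_surjective _ z
  obtain ⟨x, hx, hfx⟩ := hr y z x₁
  refine ⟨x, hx, fun hh => hfx ?_⟩
  obtain ⟨a, b, hab⟩ := mem_span_pair.1 hh
  rw [← map_smul, ← map_smul, ← map_add, eq_comm, ← sub_eq_zero, ← map_sub,
    Submodule.mkQ_apply, Submodule.Quotient.mk_eq_zero] at hab
  obtain ⟨c, hc⟩ := mem_span_singleton.1 hab
  refine mem_span_triple.2 ⟨a, b, c, ?_⟩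
  rw [hc]; abel

theorem exists_mkQ_sup_notMem {ι : Type*} {D : Set ι} {f : ι → V'}
    (hr : ∀ y z w : V', ∃ x ∈ D, f x ∉ span L {y, z, w}) (x₁ x₂ : V')
    (y : V' ⧸ (span L {x₁} ⊔ span L {x₂})) :
    ∃ x ∈ D, (span L {x₁} ⊔ span L {x₂}).mkQ (f x) ∉ span L {y} := by
  obtain ⟨y, rfl⟩ := Submodule.mkQ_surjective _ y
  obtain ⟨x, hx, hfx⟩ := hr y x₁ x₂
  refine ⟨x, hx, fun hh => hfx ?_⟩
  obtain ⟨a, ha⟩ := mem_span_singleton.1 hh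
  rw [← map_smul, eq_comm, ← sub_eq_zero, ← map_sub,
    Submodule.mkQ_apply, Submodule.Quotient.mk_eq_zero, ← span_insert] at ha
  obtain ⟨b, c, hbc⟩ := mem_span_pair.1 ha
  refine mem_span_triple.2 ⟨a, b, c, ?_⟩
  rw [add_assoc, hbc]; abel

/-- Two semilinear maps representing the same morphism are proportional. -/
theorem exists_eq_smul_of_span_eq {D : Set V} {f : V → V'}
    (hK : ∃ k : K, k ≠ 0 ∧ k ≠ 1) {x₁ x₂ : V} (hx₁ : x₁ ∈ D) (hx₂ : x₂ ∈ D)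
    (hfx : span L {f x₁} ⊓ span L {f x₂} = ⊥)
    {h₁ h₂ : V →ₗ[K] K} (h₁0 : h₁ ≠ 0) (h₂0 : h₂ ≠ 0)
    (hD₁ : ∀ v, h₁ v ≠ 0 → ∃ s : K, v + s • x₁ ∈ D)
    (hD₂ : ∀ v, h₂ v ≠ 0 → ∃ s : K, v + s • x₂ ∈ D)
    (hr : ∀ y z w : V', ∃ x ∈ D, f x ∉ span L {y, z, w})
    {σ τ : K →+* L} (Φ : V →ₛₗ[σ] V') (Ψ : V →ₛₗ[τ] V')
    (hΦ : ∀ v ∈ D, span L {f v} = span L {Φ v}) (hΨ : ∀ v ∈ D, span L {f v} = span L {Ψ v}) :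
    ∃ l : L, ∀ v, Ψ v = l • Φ v := by
  have key : ∀ {x : V}, x ∈ D → ∀ {h : V →ₗ[K] K}, h ≠ 0 →
      (∀ v, h v ≠ 0 → ∃ s : K, v + s • x ∈ D) →
      ∃ l : L, ∀ v, Ψ v - l • Φ v ∈ span L {f x} := by
    intro x hx h h0 hD
    have hzero : ∀ {w : V'}, w ∈ span L {f x} → (span L {f x}).mkQ w = 0 := fun hw => by
      rwa [Submodule.mkQ_apply, Submodule.Quotient.mk_eq_zero]
    obtain ⟨l, hl⟩ := exists_eq_smul_of_mem_span ((span L {f x}).mkQ.comp Φ)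
      ((span L {f x}).mkQ.comp Ψ) hK h0 hD
      (hzero (hΦ x hx ▸ mem_span_one_self _)) (hzero (hΨ x hx ▸ mem_span_one_self _))
      (fun v hv => by
        have h1 : Ψ v ∈ span L {Φ v} := by
          rw [← hΦ v hv, hΨ v hv]
          exact mem_span_one_self _
        obtain ⟨c, hc⟩ := mem_span_singleton.1 h1
        refine mem_span_singleton.2 ⟨c, ?_⟩
        rw [LinearMap.comp_apply, LinearMap.comp_apply, ← hc, map_smul])
      (fun y => by
        obtain ⟨v, hv, hfv⟩ := exists_mkQ_notMem hr (f x) y y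
        refine ⟨v, fun hh => hfv ?_⟩
        have h1 : f v ∈ span L {Φ v} := hΦ v hv ▸ mem_span_one_self _
        obtain ⟨c, hc⟩ := mem_span_singleton.1 h1
        rw [Set.pair_eq_singleton, ← hc, map_smul]
        exact smul_mem _ _ hh)
    refine ⟨l, fun v => ?_⟩
    have := hl v
    rw [LinearMap.comp_apply, LinearMap.comp_apply, ← map_smul, ← sub_eq_zero, ← map_sub,
      Submodule.mkQ_apply, Submodule.Quotient.mk_eq_zero] at this
    exact this
  obtain ⟨l, hl⟩ := key hx₁ h₁0 hD₁
  obtain ⟨m, hm⟩ := key hx₂ h₂0 hD₂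
  obtain ⟨v, hv, hfv⟩ := hr (f x₁) (f x₂) 0
  -- Otherwise `Φ v`, and hence `f v`, would lie in the sum of the two lines.
  have hlm : l - m = 0 := by
    by_contra hne
    refine hfv (mem_of_mem_span_one (hΦ v hv ▸ mem_span_one_self (f v))
      (mem_of_smul_mem' hne ?_))
    have : (l - m) • Φ v = (Ψ v - m • Φ v) - (Ψ v - l • Φ v) := by rw [sub_smul]; abel
    rw [this]
    exact Submodule.sub_mem _ (mem_of_mem_span_one (hm v) (subset_span (by simp)))
      (mem_of_mem_span_one (hl v) (subset_span (by simp)))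
  obtain rfl := sub_eq_zero.1 hlm
  refine ⟨l, fun v => ?_⟩
  rw [← sub_eq_zero, ← Submodule.mem_bot L, ← hfx]
  exact ⟨hl v, hm v⟩

/-- Extension of a morphism to a semilinear map. -/
theorem SpanMorphism.exists_semilinear_of_quadrangle {D : Set V} {f : V → V'}
    (hf : SpanMorphism K L D f) (hf0 : ∀ v ∈ D, f v ≠ 0)
    (hK : ∃ k : K, k ≠ 0 ∧ k ≠ 1)
    (hK' : (∃ α β γ : K, α ≠ 0 ∧ β ≠ 0 ∧ γ ≠ 0 ∧ α ≠ β ∧ α ≠ γ ∧ β ≠ γ) ∨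
      ((3 : K) = 0 ∧ (3 : L) = 0))
    {x₁ x₂ : V} (hx₁ : x₁ ∈ D) (hx₂ : x₂ ∈ D) (hfx : span L {f x₁} ⊓ span L {f x₂} = ⊥)
    {h₁ h₂ : V →ₗ[K] K} (h₁0 : h₁ ≠ 0) (h₂0 : h₂ ≠ 0) (hhx₁ : h₁ x₁ = 0) (hhx₂ : h₂ x₂ = 0)
    (hD₁ : ∀ v, h₁ v ≠ 0 → ∃ s : K, v + s • x₁ ∈ D)
    (hD₂ : ∀ v, h₂ v ≠ 0 → ∃ s : K, v + s • x₂ ∈ D)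
    (hr : ∀ y z w : V', ∃ x ∈ D, f x ∉ span L {y, z, w})
    (hQ : ∀ y ∈ D, ∀ p ∈ D, ∀ q ∈ D, LinearIndependent L ![f y, f p, f q] →
      ∃ S ⊆ D, y ∈ span K S ∧ ∀ w ∈ S, w ∈ span K {y, p, q} ∧ w ∉ span K {y}) :
    ∃ (σ : K →+* L) (Φ : V →ₛₗ[σ] V'), ∀ v ∈ D, span L {f v} = span L {Φ v} := by
  set l₁ := span L {f x₁} with hl₁
  set l₂ := span L {f x₂} with hl₂
  have hz₁ : l₁.mkQ (f x₁) = 0 := by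
    rw [Submodule.mkQ_apply, Submodule.Quotient.mk_eq_zero]
    exact mem_span_one_self _
  have hz₂ : l₂.mkQ (f x₂) = 0 := by
    rw [Submodule.mkQ_apply, Submodule.Quotient.mk_eq_zero]
    exact mem_span_one_self _
  obtain ⟨σ₁, Φ₁, hΦ₁⟩ := hf.exists_semilinear_comp hK hK' hx₁ h₁0 hhx₁ hD₁ l₁.mkQ hz₁
    (exists_mkQ_notMem hr (f x₁))
  obtain ⟨σ₂, Φ₂, hΦ₂⟩ := hf.exists_semilinear_comp hK hK' hx₂ h₂0 hhx₂ hD₂ l₂.mkQ hz₂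
    (exists_mkQ_notMem hr (f x₂))
  -- the two maps agree modulo `l₁ ⊔ l₂`, up to a scalar
  set ρ₁ : V' ⧸ l₁ →ₗ[L] V' ⧸ (l₁ ⊔ l₂) := Submodule.factor le_sup_left with hρ₁
  set ρ₂ : V' ⧸ l₂ →ₗ[L] V' ⧸ (l₁ ⊔ l₂) := Submodule.factor le_sup_right with hρ₂
  have hρ₁' : ∀ w, ρ₁ (l₁.mkQ w) = (l₁ ⊔ l₂).mkQ w := fun w => by
    rw [hρ₁, Submodule.factor_mk]
  have hρ₂' : ∀ w, ρ₂ (l₂.mkQ w) = (l₁ ⊔ l₂).mkQ w := fun w => by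
    rw [hρ₂, Submodule.factor_mk]
  have hmapspan : ∀ {A B : Type _} [AddCommGroup A] [AddCommGroup B] [Module L A] [Module L B]
      (ρ : A →ₗ[L] B) {x y : A}, span L {x} = span L {y} → span L {ρ x} = span L {ρ y} := by
    intro A B _ _ _ _ ρ x y hxy
    have := congrArg (Submodule.map ρ) hxy
    simpa [Submodule.map_span] using this
  have hm₁ : ∀ v ∈ D, span L {(l₁ ⊔ l₂).mkQ (f v)} = span L {ρ₁ (Φ₁ v)} := fun v hv => by
    rw [← hρ₁']
    exact hmapspan ρ₁ (hΦ₁ v hv)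
  have hm₂ : ∀ v ∈ D, span L {(l₁ ⊔ l₂).mkQ (f v)} = span L {ρ₂ (Φ₂ v)} := fun v hv => by
    rw [← hρ₂']
    exact hmapspan ρ₂ (hΦ₂ v hv)
  have hzz : (l₁ ⊔ l₂).mkQ (f x₁) = 0 := by rw [← hρ₁', hz₁, map_zero]
  obtain ⟨l, hl⟩ := exists_eq_smul_of_mem_span (ρ₁.comp Φ₁) (ρ₂.comp Φ₂) hK h₁0 hD₁
    (by
      have := hm₁ x₁ hx₁
      rw [hzz, Submodule.span_zero_singleton, eq_comm, Submodule.span_singleton_eq_bot] at this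
      exact this)
    (by
      have := hm₂ x₁ hx₁
      rw [hzz, Submodule.span_zero_singleton, eq_comm, Submodule.span_singleton_eq_bot] at this
      exact this)
    (fun v hv => by
      have h1 : ρ₂ (Φ₂ v) ∈ span L {ρ₁ (Φ₁ v)} := by
        rw [← hm₁ v hv, hm₂ v hv]
        exact mem_span_one_self _
      exact h1)
    (fun y => by
      obtain ⟨v, hv, hfv⟩ := exists_mkQ_sup_notMem hr (f x₁) (f x₂) y
      refine ⟨v, fun hh => hfv ?_⟩
      exact mem_of_mem_span_one (hm₁ v hv ▸ mem_span_one_self _) hh)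
  obtain ⟨v₀, hv₀, hfv₀⟩ := exists_mkQ_sup_notMem hr (f x₁) (f x₂) 0
  have hv₀' : ρ₂ (Φ₂ v₀) ≠ 0 := by
    intro hh
    refine hfv₀ ?_
    have h1 := hm₂ v₀ hv₀
    rw [hh] at h1
    exact h1 ▸ mem_span_one_self _
  have hl0 : l ≠ 0 := by
    rintro rfl
    have := hl v₀
    rw [zero_smul] at this
    exact hv₀' this
  obtain ⟨σ, Φ₁', hΦ₁'⟩ := exists_semilinear_smul Φ₁ hl0
  have heq : ∀ v, ρ₁ (Φ₁' v) = ρ₂ (Φ₂ v) := fun v => by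
    rw [hΦ₁', map_smul]
    exact (hl v).symm
  replace hΦ₁ : ∀ v ∈ D, span L {l₁.mkQ (f v)} = span L {Φ₁' v} := by
    intro v hv
    rw [hΦ₁ v hv, hΦ₁']
    exact span_one_eq_iff.2 ⟨mem_of_smul_mem' hl0 (mem_span_one_self _), smul_mem_span_one _ _⟩
  have hσ : σ = σ₂ := by
    ext k
    have h1 := heq (k • v₀)
    simp only [LinearMap.map_smulₛₗ, RingHom.id_apply] at h1
    rw [heq] at h1
    exact smul_left_injective L hv₀' h1
  subst hσ
  clear hl hΦ₁' hm₁ hm₂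
  -- the fibre product
  have huniq : ∀ w w' : V', l₁.mkQ w = l₁.mkQ w' → l₂.mkQ w = l₂.mkQ w' → w = w' := by
    intro w w' h1 h2
    rw [← sub_eq_zero, ← map_sub, Submodule.mkQ_apply, Submodule.Quotient.mk_eq_zero] at h1 h2
    rw [← sub_eq_zero, ← Submodule.mem_bot L, ← hfx]
    exact ⟨h1, h2⟩
  -- Lifts of the two values differ by some `a + b` with `a` in `l₁` and `b` in `l₂`; correcting by
  -- these makes them equal.
  have hex : ∀ v, ∃ w, l₁.mkQ w = Φ₁' v ∧ l₂.mkQ w = Φ₂ v := by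
    intro v
    obtain ⟨w₁, hw₁⟩ := Submodule.mkQ_surjective _ (Φ₁' v)
    obtain ⟨w₂, hw₂⟩ := Submodule.mkQ_surjective _ (Φ₂ v)
    have h1 := heq v
    rw [← hw₁, ← hw₂, hρ₁', hρ₂', ← sub_eq_zero, ← map_sub, Submodule.mkQ_apply,
      Submodule.Quotient.mk_eq_zero] at h1
    obtain ⟨a, ha, b, hb, hab⟩ := Submodule.mem_sup.1 h1
    refine ⟨w₁ - a, ?_, ?_⟩
    · rw [map_sub, hw₁, Submodule.mkQ_apply _ a, (Submodule.Quotient.mk_eq_zero _).2 ha, sub_zero]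
    · have : w₁ - a = w₂ + b := by
        rw [sub_eq_iff_eq_add, add_assoc, add_comm b, hab]; abel
      rw [this, map_add, hw₂, Submodule.mkQ_apply _ b, (Submodule.Quotient.mk_eq_zero _).2 hb,
        add_zero]
  choose φ hφ₁ hφ₂ using hex
  let Φ : V →ₛₗ[σ] V' :=
    { toFun := φ
      map_add' := fun v w => huniq _ _ (by rw [map_add, hφ₁, hφ₁, hφ₁, map_add])
        (by rw [map_add, hφ₂, hφ₂, hφ₂, map_add])
      map_smul' := fun k v => huniq _ _
        (by rw [map_smul, hφ₁, hφ₁, LinearMap.map_smulₛₗ])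
        (by rw [map_smul, hφ₂, hφ₂, LinearMap.map_smulₛₗ]) }
  have hmod : ∀ {l : Submodule L V'} {w w' : V'}, l.mkQ w ∈ span L {l.mkQ w'} →
      ∃ c : L, w - c • w' ∈ l := by
    intro l w w' hw
    obtain ⟨c, hc⟩ := mem_span_singleton.1 hw
    rw [← map_smul, eq_comm, ← sub_eq_zero, ← map_sub, Submodule.mkQ_apply,
      Submodule.Quotient.mk_eq_zero] at hc
    exact ⟨c, hc⟩
  have hΦmem₁ : ∀ v ∈ D, ∃ c : L, Φ v - c • f v ∈ l₁ := fun v hv => hmod (by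
    rw [hΦ₁ v hv]
    change l₁.mkQ (φ v) ∈ _
    rw [hφ₁]
    exact mem_span_one_self _)
  have hΦmem₂ : ∀ v ∈ D, ∃ c : L, Φ v - c • f v ∈ l₂ := fun v hv => hmod (by
    rw [hΦ₂ v hv]
    change l₂.mkQ (φ v) ∈ _
    rw [hφ₂]
    exact mem_span_one_self _)
  have hΦ0 : ∀ v ∈ D, Φ v ≠ 0 := by
    intro v hv h0
    change φ v = 0 at h0
    refine hf0 v hv (huniq _ _ ?_ ?_)
    · have := hΦ₁ v hv
      rw [← hφ₁, h0, map_zero, Submodule.span_zero_singleton,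
        Submodule.span_singleton_eq_bot] at this
      rw [this, map_zero]
    · have := hΦ₂ v hv
      rw [← hφ₂, h0, map_zero, Submodule.span_zero_singleton,
        Submodule.span_singleton_eq_bot] at this
      rw [this, map_zero]
  have hsup : l₁ ⊔ l₂ = span L {f x₁, f x₂} := (span_insert _ _).symm
  -- Modulo each line `Φ v` is a multiple of `f v`. As `f v` avoids `l₁ ⊔ l₂`, the two coefficients
  -- agree, and `l₁ ⊓ l₂ = ⊥` finishes.
  have hgood : ∀ v ∈ D, f v ∉ l₁ ⊔ l₂ → Φ v ∈ span L {f v} := by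
    intro v hv hfv
    obtain ⟨c, hc⟩ := hΦmem₁ v hv
    obtain ⟨d, hd⟩ := hΦmem₂ v hv
    have hcd : c - d = 0 := by
      by_contra hne
      refine hfv (mem_of_smul_mem' hne ?_)
      have : (c - d) • f v = -(Φ v - c • f v) + (Φ v - d • f v) := by rw [sub_smul]; abel
      rw [this]
      exact Submodule.add_mem_sup (neg_mem hc) hd
    obtain rfl := sub_eq_zero.1 hcd
    have : Φ v - c • f v = 0 := by
      rw [← Submodule.mem_bot L, ← hfx]
      exact ⟨hc, hd⟩
    rw [sub_eq_zero.1 this]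
    exact smul_mem_span_one _ _
  suffices H : ∀ v ∈ D, Φ v ∈ span L {f v} from ⟨σ, Φ, fun v hv =>
    span_one_eq_iff.2 ⟨mem_span_one_symm (H v hv) (hΦ0 v hv), H v hv⟩⟩
  intro y hy
  by_cases hfy : f y ∈ l₁ ⊔ l₂
  swap
  · exact hgood y hy hfy
  have hΦy : Φ y ∈ l₁ ⊔ l₂ := by
    obtain ⟨c, hc⟩ := hΦmem₁ y hy
    have := add_mem (Submodule.mem_sup_left (T := l₂) hc) (smul_mem _ c hfy)
    rwa [sub_add_cancel] at this
  -- Images independent modulo `l₁ ⊔ l₂`, so that the plane of `f y`, `f p`, `f q` meets `l₁ ⊔ l₂`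
  -- only in `span {f y}`.
  obtain ⟨p, hp, hfp⟩ := hr (f x₁) (f x₂) (f x₂)
  obtain ⟨q, hq, hfq⟩ := hr (f x₁) (f x₂) (f p)
  have hle : l₁ ⊔ l₂ ≤ span L {f x₁, f x₂, f p} := by
    rw [hsup]
    exact span_mono (by simp [Set.insert_subset_iff])
  replace hfp : f p ∉ l₁ ⊔ l₂ := by
    rw [hsup]
    simpa using hfp
  have hcap : ∀ w, w ∈ span L {f y, f p, f q} → w ∈ l₁ ⊔ l₂ → w ∈ span L {f y} := by
    intro w hw hw'
    obtain ⟨a, b, c, rfl⟩ := mem_span_triple.1 hw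
    have hc : c = 0 := by
      by_contra hc
      refine hfq (mem_of_smul_mem' hc ?_)
      have : c • f q = (a • f y + b • f p + c • f q) - a • f y - b • f p := by abel
      rw [this]
      exact Submodule.sub_mem _ (Submodule.sub_mem _ (hle hw') (hle (smul_mem _ _ hfy)))
        (smul_mem _ _ (subset_span (by simp)))
    subst hc
    have hb : b = 0 := by
      by_contra hb
      refine hfp (mem_of_smul_mem' hb ?_)
      have : b • f p = (a • f y + b • f p + (0 : L) • f q) - a • f y := by simp
      rw [this]
      exact Submodule.sub_mem _ hw' (smul_mem _ _ hfy)
    subst hb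
    rw [zero_smul, zero_smul, add_zero, add_zero]
    exact smul_mem_span_one _ _
  have hi : LinearIndependent L ![f y, f p, f q] := by
    refine linearIndependent_three_of_notMem (hf0 y hy)
      (fun hh => hfp (mem_of_mem_span_one hh hfy)) fun hh => hfq ?_
    exact mem_of_mem_span_two hh (hle hfy) (subset_span (by simp))
  obtain ⟨S, hSD, hyS, hS⟩ := hQ y hy p hp q hq hi
  refine hcap _ ?_ hΦy
  have hΦS : Φ y ∈ span L (Φ '' S) := by
    refine Submodule.span_induction (p := fun x _ => Φ x ∈ span L (Φ '' S)) ?_ ?_ ?_ ?_ hyS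
    · exact fun x hx => subset_span ⟨x, hx, rfl⟩
    · rw [map_zero]
      exact zero_mem _
    · intro a b _ _ ha hb
      rw [map_add]
      exact add_mem ha hb
    · intro k a _ ha
      rw [LinearMap.map_smulₛₗ]
      exact smul_mem _ _ ha
  refine span_le.2 ?_ hΦS
  rintro _ ⟨w, hw, rfl⟩
  obtain ⟨hwypq, hwy⟩ := hS w hw
  have hwD := hSD hw
  obtain ⟨a, b, c, habc⟩ := mem_span_triple.1 hwypq
  have hfw := hf.three hwD hy hp hq a b c habc.symm
  refine mem_of_mem_span_one (hgood w hwD fun hfw' => ?_) hfw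
  have hfwy := hcap _ hfw hfw'
  obtain ⟨-, hi2, hi3⟩ := notMem_span_two_of_linearIndependent hi
  by_cases hc : c = 0
  · subst hc
    have hb : b ≠ 0 := by
      rintro rfl
      refine hwy (mem_span_singleton.2 ⟨a, ?_⟩)
      rw [← habc]; simp
    refine hi2 (mem_of_mem_span_two (hf.two hp hy hwD (-(b⁻¹ * a)) b⁻¹ ?_)
      (mem_span_one_self _) hfwy)
    rw [← habc]
    match_scalars <;> simp [hb]
  · refine hi3 (mem_of_mem_span_three (hf.three hq hy hp hwD (-(c⁻¹ * a)) (-(c⁻¹ * b)) c⁻¹ ?_)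
      (left_mem_span_two _ _) (right_mem_span_two _ _)
      (mem_of_mem_span_one hfwy (left_mem_span_two _ _)))
    rw [← habc]
    match_scalars <;> simp [hc]

end

/-! ### Scalars supplied by the cardinality assumption -/

section Cardinality

theorem exists_notMem_of_lt_card {K : Type*} (s : Finset K) (h : (s.card : ℕ∞) < ENat.card K) :
    ∃ k, k ∉ s := by
  by_contra! hcon
  refine h.not_ge ?_
  rw [← Set.encard_univ, ← Set.encard_coe_eq_coe_finsetCard]
  exact Set.encard_le_encard fun k _ => hcon k

theorem three_eq_zero_of_card {K : Type*} [Ring K] (h : ENat.card K = 3) : (3 : K) = 0 := by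
  have h1 : Nat.card K = 3 := by
    rw [← Set.ncard_univ, Set.ncard_def, Set.encard_univ, h]
    rfl
  have h2 := card_nsmul_eq_zero' (x := (1 : K))
  rw [h1] at h2
  simpa using h2

end Cardinality

/-! ### Translation between points and vectors -/

namespace Projectivization

variable {K V : Type*} [DivisionRing K] [AddCommGroup V] [Module K V]

theorem mk_eq_of_mem {v : V} (hv : v ≠ 0) {p : ℙ K V} (h : v ∈ span K {p.rep}) :
    mk K v hv = p := by
  obtain ⟨a, ha⟩ := mem_span_singleton.1 h
  rw [← p.mk_rep, mk_eq_mk_iff']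
  exact ⟨a, ha⟩

theorem mem_span_rep_mk {v : V} (hv : v ≠ 0) : v ∈ span K {(mk K v hv).rep} := by
  obtain ⟨a, ha⟩ := exists_smul_eq_mk_rep K v hv
  rw [← ha, Units.smul_def]
  exact mem_of_smul_mem' a.ne_zero (mem_span_one_self _)

theorem rep_mk_mem_span {v : V} (hv : v ≠ 0) : (mk K v hv).rep ∈ span K {v} := by
  obtain ⟨a, ha⟩ := exists_smul_eq_mk_rep K v hv
  rw [← ha, Units.smul_def]
  exact smul_mem_span_one _ _

theorem mem_closure_iff {A : Set (ℙ K V)} {p : ℙ K V} :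
    p ∈ (projGeometry K V).closure A ↔ p.rep ∈ span K (Projectivization.rep '' A) := by
  change p ∈ flatClosure (ProjIsFlat K V) A ↔ _
  rw [flatClosure_proj]
  rfl

theorem eq_of_rep_mem_span {p q : ℙ K V} (h : p.rep ∈ span K {q.rep}) : p = q := by
  rw [← p.mk_rep]
  exact mk_eq_of_mem _ h

theorem injective_of_linearIndependent {ι : Type*} {w : ι → ℙ K V}
    (hw : LinearIndependent K fun i => (w i).rep) : Function.Injective w := fun i j hij =>
  hw.injective (by simp only [hij])

theorem independent_range {ι : Type*} {w : ι → ℙ K V}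
    (hw : LinearIndependent K fun i => (w i).rep) :
    (projGeometry K V).Independent (Set.range w) := by
  rintro _ ⟨i, rfl⟩ h
  rw [mem_closure_iff] at h
  refine linearIndependent_iff_notMem_span.1 hw i (span_mono ?_ h)
  rintro _ ⟨_, ⟨⟨j, rfl⟩, hj⟩, rfl⟩
  refine ⟨j, ⟨trivial, fun hji => hj ?_⟩, rfl⟩
  rw [Set.mem_singleton_iff.1 hji]
  rfl

theorem hasDim_of_linearIndependent {ι : Type*} {v : ι → V} (hv : LinearIndependent K v) {r : ℕ}
    (hr : ENat.card ι = r + 1) :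
    (projGeometry K V).HasDim {p | p.submodule ≤ span K (Set.range v)} r := by
  choose a ha using fun i => exists_smul_eq_mk_rep K (v i) (hv.ne_zero i)
  have hw : LinearIndependent K fun i => (mk K (v i) (hv.ne_zero i)).rep := by
    have := hv.units_smul a
    convert this using 1
    ext i
    exact (ha i).symm
  refine ⟨_, ⟨independent_range hw, ?_⟩, ?_⟩
  · ext p
    rw [mem_closure_iff]
    refine Iff.trans ?_ (proj_submodule_le_iff p _).symm
    suffices span K (Projectivization.rep '' Set.range fun i => mk K (v i) (hv.ne_zero i)) =
        span K (Set.range v) by rw [this]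
    refine le_antisymm (span_le.2 ?_) (span_le.2 ?_)
    · rintro _ ⟨_, ⟨i, rfl⟩, rfl⟩
      exact mem_of_mem_span_one (rep_mk_mem_span _) (subset_span ⟨i, rfl⟩)
    · rintro _ ⟨i, rfl⟩
      exact mem_of_mem_span_one (mem_span_rep_mk (hv.ne_zero i)) (subset_span ⟨_, ⟨i, rfl⟩, rfl⟩)
  · rw [← Set.image_univ, (injective_of_linearIndependent hw).encard_image, Set.encard_univ, hr]

variable (X : Set (ℙ K V))

theorem mem_sub_closure_iff {A : Set X} {x : X} : x ∈ ((projGeometry K V).sub X).closure A ↔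
    x.1.rep ∈ span K ((fun a : X => a.1.rep) '' A) := by
  change x ∈ flatClosure ((projGeometry K V).SubIsFlat X) A ↔ _
  rw [Geometry.flatClosure_sub, Set.mem_preimage, mem_closure_iff, Set.image_image]

theorem sub_hasDim_of_linearIndependent {ι : Type*} {w : ι → X}
    (hw : LinearIndependent K fun i => (w i).1.rep) {r : ℕ} (hr : ENat.card ι = r + 1) :
    ((projGeometry K V).sub X).HasDim
      (((projGeometry K V).sub X).closure (Set.range w)) r := by
  refine ⟨_, ⟨?_, rfl⟩, ?_⟩
  · rintro _ ⟨i, rfl⟩ h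
    rw [mem_sub_closure_iff] at h
    refine linearIndependent_iff_notMem_span.1 hw i (span_mono ?_ h)
    rintro _ ⟨_, ⟨⟨j, rfl⟩, hj⟩, rfl⟩
    refine ⟨j, ⟨trivial, fun hji => hj ?_⟩, rfl⟩
    rw [Set.mem_singleton_iff.1 hji]
    rfl
  · have hinj : Function.Injective w := fun i j hij => hw.injective (by simp only [hij])
    rw [← Set.image_univ, hinj.encard_image, Set.encard_univ, hr]

/-- Every plane of a subgeometry with enough points contains, besides a given point, three points
which span it. -/
theorem exists_span_of_enoughPoints (hX : ((projGeometry K V).sub X).EnoughPoints) {y p q : X}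
    (hi : LinearIndependent K ![y.1.rep, p.1.rep, q.1.rep]) :
    ∃ S : Set X, y.1.rep ∈ span K ((fun a : X => a.1.rep) '' S) ∧
      ∀ w ∈ S, w.1.rep ∈ span K {y.1.rep, p.1.rep, q.1.rep} ∧ w ≠ y := by
  have hplane : ((projGeometry K V).sub X).IsPlane
      (((projGeometry K V).sub X).closure (Set.range ![y, p, q])) := by
    refine sub_hasDim_of_linearIndependent X (ι := Fin 3) (r := 2) ?_ (by simp; rfl)
    convert hi using 1
    ext i
    fin_cases i <;> rfl
  obtain ⟨Q, hQP, hQ4, hQ⟩ := hX.2 _ hplane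
  have hQP' : ∀ w ∈ Q, w.1.rep ∈ span K {y.1.rep, p.1.rep, q.1.rep} := by
    intro w hw
    have := (mem_sub_closure_iff X).1 (hQP hw)
    refine span_mono ?_ this
    rintro _ ⟨_, ⟨i, rfl⟩, rfl⟩
    fin_cases i <;> simp
  -- Deleting `y` from the four points, whether or not it is one of them, leaves at least three.
  obtain ⟨T, hTQ, hT3⟩ : ∃ T ⊆ Q \ {y}, T.encard = 3 := by
    refine Set.exists_subset_encard_eq ?_
    have := Set.encard_tsub_one_le_encard_sdiff_singleton Q y
    rwa [hQ4, show (4 : ℕ∞) - 1 = 3 from rfl] at this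
  have hTline := hQ T (fun w hw => (hTQ hw).1) hT3
  obtain ⟨a, b, c, hab, hac, hbc, rfl⟩ := Set.encard_eq_three.1 hT3
  have h2 : b.1.rep ∉ span K {a.1.rep} := fun hh =>
    hab (Subtype.ext (eq_of_rep_mem_span hh)).symm
  have h3 : c.1.rep ∉ span K {a.1.rep, b.1.rep} := by
    intro hh
    refine hTline ⟨((projGeometry K V).sub X).closure (Set.range ![a, b]), ?_, ?_⟩
    · refine sub_hasDim_of_linearIndependent X (ι := Fin 2) (r := 1) ?_ (by simp; rfl)
      have : LinearIndependent K ![a.1.rep, b.1.rep] := by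
        rw [LinearIndependent.pair_iff' a.1.rep_nonzero]
        exact fun k hk => h2 (mem_span_singleton.2 ⟨k, hk⟩)
      convert this using 1
      ext i
      fin_cases i <;> rfl
    · rintro w (rfl | rfl | rfl)
      · exact Geometry.subset_closure _ _ ⟨0, rfl⟩
      · exact Geometry.subset_closure _ _ ⟨1, rfl⟩
      · rw [mem_sub_closure_iff]
        refine span_mono ?_ hh
        rintro _ (rfl | rfl)
        · exact ⟨a, ⟨0, rfl⟩, rfl⟩
        · exact ⟨b, ⟨1, rfl⟩, rfl⟩
  refine ⟨{a, b, c}, ?_, fun w hw => ⟨hQP' w (hTQ hw).1, (hTQ hw).2⟩⟩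
  have hi' := linearIndependent_three_of_notMem a.1.rep_nonzero h2 h3
  have hle : span K (Set.range ![a.1.rep, b.1.rep, c.1.rep]) ≤
      span K (Set.range ![y.1.rep, p.1.rep, q.1.rep]) := by
    refine span_le.2 ?_
    rintro _ ⟨i, rfl⟩
    have hmem : ∀ w ∈ Q, w.1.rep ∈ span K (Set.range ![y.1.rep, p.1.rep, q.1.rep]) :=
      fun w hw => mem_of_mem_span_three (hQP' w hw) (subset_span ⟨0, rfl⟩)
        (subset_span ⟨1, rfl⟩) (subset_span ⟨2, rfl⟩)
    fin_cases i
    · exact hmem a (hTQ (by simp)).1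
    · exact hmem b (hTQ (by simp)).1
    · exact hmem c (hTQ (by simp)).1
  have := FiniteDimensional.span_of_finite K (Set.finite_range ![y.1.rep, p.1.rep, q.1.rep])
  have heq := Submodule.eq_of_le_of_finrank_eq hle (by
    rw [finrank_span_eq_card hi', finrank_span_eq_card hi])
  have hy : y.1.rep ∈ span K (Set.range ![a.1.rep, b.1.rep, c.1.rep]) := by
    rw [heq]
    exact subset_span ⟨0, rfl⟩
  refine span_mono ?_ hy
  rintro _ ⟨i, rfl⟩
  fin_cases i
  · exact ⟨a, by simp, rfl⟩
  · exact ⟨b, by simp, rfl⟩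
  · exact ⟨c, by simp, rfl⟩

/-- The nonzero vectors representing the points of `X`. -/
def vectors : Set V := {v | ∃ hv : v ≠ 0, mk K v hv ∈ X}

variable {X}

theorem mem_vectors_of_mem_span {v : V} (hv : v ≠ 0) {p : ℙ K V} (hp : p ∈ X)
    (h : v ∈ span K {p.rep}) : v ∈ vectors X :=
  ⟨hv, by rwa [mk_eq_of_mem hv h]⟩

theorem rep_mem_vectors {p : ℙ K V} (hp : p ∈ X) : p.rep ∈ vectors X :=
  ⟨p.rep_nonzero, by rwa [mk_rep]⟩

/-- Take `h` vanishing on the vector subspace of the hyperplane. A point with `h v ≠ 0` has its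
class outside the hyperplane, hence in `X / p`, so the line joining it to `p` contains a point of
`X` other than `p`, which can be scaled to have coefficient 1 at `v`. -/
theorem exists_functional_of_isAffinoProjective {p : ℙ K V}
    (h : ((projGeometry K V).quotient {p}
        ((projGeometry K V).isFlat_singleton p)).IsAffinoProjective
          ((projGeometry K V).quotImage {p} X)) :
    ∃ h : V →ₗ[K] K, h ≠ 0 ∧ h p.rep = 0 ∧
      ∀ v, h v ≠ 0 → ∃ s : K, v + s • p.rep ∈ vectors X := by
  obtain ⟨H, ⟨⟨S, hS, hpS, rfl⟩, hne, -⟩, hcov⟩ := h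
  have hpull := (projGeometry K V).quotPull_quotImage {p} hS hpS
  obtain ⟨U, rfl⟩ := hS
  have hU : U < ⊤ := by
    refine lt_top_iff_ne_top.2 ?_
    rintro rfl
    refine hne (Set.eq_univ_of_forall fun z => ?_)
    obtain ⟨x, rfl⟩ := Quotient.exists_rep z
    exact ⟨x, show x.1.submodule ≤ ⊤ from le_top, rfl⟩
  obtain ⟨h, h0, hUh⟩ := U.exists_le_ker_of_lt_top hU
  have hp : h p.rep = 0 := hUh ((proj_submodule_le_iff p U).1 (hpS rfl))
  refine ⟨h, h0, hp, fun v hv => ?_⟩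
  have hv0 : v ≠ 0 := fun h0 => hv (by rw [h0, map_zero])
  have hvp : mk K v hv0 ∉ ({p} : Set (ℙ K V)) := by
    intro hh
    have h1 := mem_span_rep_mk (K := K) hv0
    rw [Set.mem_singleton_iff.1 hh] at h1
    obtain ⟨a, rfl⟩ := mem_span_singleton.1 h1
    exact hv (by rw [map_smul, hp, smul_zero])
  rcases hcov.symm.subset (Set.mem_univ ((projGeometry K V).toQuot {p} ⟨mk K v hv0, hvp⟩)) with
    ⟨z, hzX, hz⟩ | hz
  · have h1 : (projGeometry K V).closure (insert z.1 {p}) =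
        (projGeometry K V).closure (insert (mk K v hv0) {p}) := Quotient.exact hz
    have h2 : z.1 ∈ (projGeometry K V).closure (insert (mk K v hv0) {p}) :=
      h1 ▸ Geometry.subset_closure _ _ (Set.mem_insert _ _)
    rw [mem_closure_iff, Set.image_pair] at h2
    have h3 : z.1.rep ∈ span K {v, p.rep} := mem_of_mem_span_two h2
      (mem_of_mem_span_one (rep_mk_mem_span hv0) (left_mem_span_two _ _))
      (right_mem_span_two _ _)
    obtain ⟨a, b, hab⟩ := mem_span_pair.1 h3
    have ha : a ≠ 0 := by
      rintro rfl
      refine z.2 (Set.mem_singleton_iff.2 (eq_of_rep_mem_span ?_))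
      rw [← hab, zero_smul, zero_add]
      exact smul_mem_span_one _ _
    have h4 : v + (a⁻¹ * b) • p.rep = a⁻¹ • z.1.rep := by
      rw [← hab]; match_scalars <;> simp [ha]
    refine ⟨a⁻¹ * b, mem_vectors_of_mem_span ?_ hzX ?_⟩
    · rw [h4]
      exact smul_ne_zero (inv_ne_zero ha) z.1.rep_nonzero
    · rw [h4]
      exact smul_mem_span_one _ _
  · exfalso
    have h1 : mk K v hv0 ∈ (projGeometry K V).quotPull {p}
        ((projGeometry K V).quotImage {p} {q : ℙ K V | q.submodule ≤ U}) := fun _ => hz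
    rw [hpull] at h1
    refine hv (hUh (show v ∈ U from ?_))
    exact mem_of_mem_span_one (mem_span_rep_mk hv0) ((proj_submodule_le_iff _ U).1 h1)

variable {K' V' : Type*} [DivisionRing K'] [AddCommGroup V'] [Module K' V']

open Classical in
/-- A map between vector spaces representing a map between sets of points. -/
noncomputable def liftRep (φ : X → ℙ K' V') (v : V) : V' :=
  if h : ∃ hv : v ≠ 0, mk K v hv ∈ X then (φ ⟨mk K v h.1, h.2⟩).rep else 0

theorem liftRep_eq (φ : X → ℙ K' V') {v : V} (hv : v ≠ 0) (h : mk K v hv ∈ X) :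
    liftRep φ v = (φ ⟨mk K v hv, h⟩).rep :=
  dif_pos ⟨hv, h⟩

theorem liftRep_rep (φ : X → ℙ K' V') (x : X) : liftRep φ x.1.rep = (φ x).rep := by
  have h : mk K x.1.rep x.1.rep_nonzero = x.1 := mk_rep _
  rw [liftRep_eq φ x.1.rep_nonzero (by rw [h]; exact x.2)]
  congr 2
  exact Subtype.ext h

theorem exists_of_mem_vectors (φ : X → ℙ K' V') {v : V} (hv : v ∈ vectors X) :
    ∃ x : X, liftRep φ v = (φ x).rep ∧ v ∈ span K {x.1.rep} ∧ x.1.rep ∈ span K {v} := by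
  obtain ⟨hv0, hv⟩ := hv
  exact ⟨⟨_, hv⟩, liftRep_eq φ hv0 hv, mem_span_rep_mk hv0, rep_mk_mem_span hv0⟩

/-- The preimage of the flat spanned by the images of `S` is the trace of a subspace. That subspace
contains `S`, hence everything depending on `S`. -/
theorem spanMorphism_liftRep {φ : X → ℙ K' V'}
    (hφ : ((projGeometry K V).sub X).IsMorphism (projGeometry K' V') φ) :
    SpanMorphism K K' (vectors X) (liftRep φ) := by
  intro S hS x hx hxS
  obtain ⟨T, ⟨U, rfl⟩, hU⟩ := hφ {p | p.submodule ≤ span K' (liftRep φ '' S)} ⟨_, rfl⟩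
  have key : ∀ z : X, (φ z).rep ∈ span K' (liftRep φ '' S) ↔ z.1.rep ∈ U := fun z => by
    rw [← proj_submodule_le_iff, ← proj_submodule_le_iff]
    exact Set.ext_iff.1 hU z
  obtain ⟨z, hz, hxz, hzx⟩ := exists_of_mem_vectors φ hx
  rw [hz, key]
  refine mem_of_mem_span_one hzx (span_le.2 (fun v hv => ?_) hxS)
  obtain ⟨y, hy, hvy, -⟩ := exists_of_mem_vectors φ (hS hv)
  refine mem_of_mem_span_one hvy ((key y).1 ?_)
  rw [← hy]
  exact subset_span ⟨v, hv, rfl⟩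

/-- A span of three vectors has a basis of at most three elements. The empty basis has no natural
number as its dimension and is excluded by `X` being nonempty. -/
theorem exists_liftRep_notMem {φ : X → ℙ K' V'} [Nonempty X]
    (himage : ∀ (S : Set (ℙ K' V')) (r : ℕ), r ≤ 2 → (projGeometry K' V').HasDim S r →
      ¬ Set.range φ ⊆ S) (y z w : V') : ∃ x ∈ vectors X, liftRep φ x ∉ span K' {y, z, w} := by
  by_contra! hcon
  obtain ⟨b, hb, hspan, hli⟩ := exists_linearIndependent K' {y, z, w}
  have hmem : ∀ x : X, (φ x).rep ∈ span K' b := fun x => by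
    rw [hspan, ← liftRep_rep]
    exact hcon _ (rep_mem_vectors x.2)
  have hb3 : b.encard ≤ 3 := by
    classical
    refine (Set.encard_le_encard (t := (({y, z, w} : Finset V') : Set V'))
      (by simpa using hb)).trans ?_
    rw [Set.encard_coe_eq_coe_finsetCard]
    exact_mod_cast Finset.card_le_three
  have hb0 : b.encard ≠ 0 := by
    intro h0
    rw [Set.encard_eq_zero] at h0
    obtain ⟨x⟩ := ‹Nonempty X›
    have := hmem x
    rw [h0, span_empty, Submodule.mem_bot] at this
    exact (φ x).rep_nonzero this
  obtain ⟨n, hn⟩ : ∃ n : ℕ, b.encard = n :=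
    ENat.ne_top_iff_exists.1 (ne_top_of_le_ne_top (by simp) hb3) |>.imp fun _ h => h.symm
  rw [hn] at hb3 hb0
  have hn3 : n ≤ 3 := by exact_mod_cast hb3
  have hn0 : n ≠ 0 := by exact_mod_cast hb0
  obtain ⟨r, rfl⟩ := Nat.exists_eq_succ_of_ne_zero hn0
  refine himage _ r (by omega) (hasDim_of_linearIndependent hli (r := r) ?_) ?_
  · rw [ENat.card_coe_set_eq, hn]
    simp
  · rintro _ ⟨x, rfl⟩
    refine (proj_submodule_le_iff _ _).2 ?_
    rw [Subtype.range_coe]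
    exact hmem x

/-- Because `q.rep` is nonzero, the equality of spans already encodes that the partial map is
defined at `p`. -/
theorem mem_partialProj_iff {σ : K →+* K'} (Φ : V →ₛₗ[σ] V') (p : ℙ K V) (q : ℙ K' V') :
    q ∈ partialProj Φ p ↔ span K' {q.rep} = span K' {Φ p.rep} := by
  constructor
  · rintro ⟨h, rfl⟩
    exact span_one_eq_iff.2 ⟨rep_mk_mem_span h, mem_span_rep_mk h⟩
  · intro h
    have h0 : Φ p.rep ≠ 0 := by
      intro h0
      rw [h0, Submodule.span_zero_singleton, Submodule.span_singleton_eq_bot] at h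
      exact q.rep_nonzero h
    exact ⟨h0, mk_eq_of_mem h0 (h ▸ mem_span_one_self _)⟩

end Projectivization

/-! ### The theorem -/

open Projectivization

theorem theorem4 {K V K' V' : Type*} [DivisionRing K] [AddCommGroup V] [Module K V]
    [DivisionRing K'] [AddCommGroup V'] [Module K' V']
    (hK : 4 ≤ ENat.card K ∨ (ENat.card K = 3 ∧ ringChar K' = 3))
    (X : Set (ℙ K V)) (hX : ((projGeometry K V).sub X).EnoughPoints)
    (φ : X → ℙ K' V')
    (hφ : ((projGeometry K V).sub X).IsMorphism (projGeometry K' V') φ)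
    (himage : ∀ (S : Set (ℙ K' V')) (r : ℕ), r ≤ 2 → (projGeometry K' V').HasDim S r →
      ¬ Set.range φ ⊆ S)
    (hloc : ∃ x₁ x₂ : X, φ x₁ ≠ φ x₂ ∧ ∀ x ∈ ({x₁, x₂} : Set X),
      ((projGeometry K V).quotient {x.1}
        ((projGeometry K V).isFlat_singleton x.1)).IsAffinoProjective
          ((projGeometry K V).quotImage {x.1} X)) :
    ∃! f : ℙ K V →. ℙ K' V', IsPartialProjectiveMorphism f ∧ ∀ x : X, φ x ∈ f x.1 := by
  classical
  have hKtwo : ∃ k : K, k ≠ 0 ∧ k ≠ 1 := by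
    obtain ⟨k, hk⟩ := exists_notMem_of_lt_card ({0, 1} : Finset K) (by
      have h2 : (({0, 1} : Finset K).card : ℕ∞) ≤ 2 := by exact_mod_cast Finset.card_le_two
      refine h2.trans_lt ?_
      rcases hK with hK | ⟨hK, -⟩
      · exact lt_of_lt_of_le (by norm_num) hK
      · rw [hK]; norm_num)
    exact ⟨k, by simpa using hk⟩
  have hKthree : (∃ α β γ : K, α ≠ 0 ∧ β ≠ 0 ∧ γ ≠ 0 ∧ α ≠ β ∧ α ≠ γ ∧ β ≠ γ) ∨
      ((3 : K) = 0 ∧ (3 : K') = 0) := by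
    rcases hK with hK | ⟨hK, hK'⟩
    · left
      obtain ⟨k, hk0, hk1⟩ := hKtwo
      obtain ⟨l, hl⟩ := exists_notMem_of_lt_card ({0, 1, k} : Finset K) (by
        have h3 : (({0, 1, k} : Finset K).card : ℕ∞) ≤ 3 := by exact_mod_cast Finset.card_le_three
        exact (h3.trans_lt (by norm_num)).trans_le hK)
      have hl : l ≠ 0 ∧ l ≠ 1 ∧ l ≠ k := by simpa using hl
      exact ⟨1, k, l, one_ne_zero, hk0, hl.1, hk1.symm, hl.2.1.symm, hl.2.2.symm⟩
    · refine Or.inr ⟨three_eq_zero_of_card hK, ?_⟩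
      have := ringChar.Nat.cast_ringChar (R := K')
      rw [hK'] at this
      exact_mod_cast this
  obtain ⟨x₁, x₂, hx, hxloc⟩ := hloc
  have : Nonempty X := ⟨x₁⟩
  have hf := spanMorphism_liftRep hφ
  have hr := exists_liftRep_notMem himage
  obtain ⟨h₁, h₁0, hhx₁, hD₁⟩ := exists_functional_of_isAffinoProjective (hxloc x₁ (by simp))
  obtain ⟨h₂, h₂0, hhx₂, hD₂⟩ := exists_functional_of_isAffinoProjective (hxloc x₂ (by simp))
  have hfx : span K' {liftRep φ x₁.1.rep} ⊓ span K' {liftRep φ x₂.1.rep} = ⊥ := by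
    rw [liftRep_rep, liftRep_rep, eq_bot_iff]
    rintro w ⟨hw₁, hw₂⟩
    by_contra hw
    exact hx (eq_of_rep_mem_span (mem_of_mem_span_one (mem_span_one_symm hw₁ hw) hw₂))
  obtain ⟨σ, Φ, hΦ⟩ := hf.exists_semilinear_of_quadrangle
    (fun v hv => by
      obtain ⟨x, hx, -⟩ := exists_of_mem_vectors φ hv
      rw [hx]
      exact (φ x).rep_nonzero)
    hKtwo hKthree (rep_mem_vectors x₁.2) (rep_mem_vectors x₂.2) hfx h₁0 h₂0 hhx₁ hhx₂ hD₁ hD₂ hr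
    (fun y hy p hp q hq hi => by
      obtain ⟨y', hfy, hyy', hy'y⟩ := exists_of_mem_vectors φ hy
      obtain ⟨p', hfp, hpp', hp'p⟩ := exists_of_mem_vectors φ hp
      obtain ⟨q', hfq, hqq', hq'q⟩ := exists_of_mem_vectors φ hq
      obtain ⟨-, hi2, hi3⟩ := notMem_span_two_of_linearIndependent hi
      -- Dependent points have dependent images, so independence of the images passes back to the
      -- points.
      have hi' : LinearIndependent K ![y'.1.rep, p'.1.rep, q'.1.rep] := by
        rw [hfy, hfp, ← liftRep_rep φ y', ← liftRep_rep φ p'] at hi2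
        rw [hfy, hfp, hfq, ← liftRep_rep φ y', ← liftRep_rep φ p', ← liftRep_rep φ q'] at hi3
        refine linearIndependent_three_of_notMem y'.1.rep_nonzero (fun hh => hi2 ?_)
          fun hh => hi3 ?_
        · obtain ⟨a, ha⟩ := mem_span_singleton.1 hh
          exact hf.one (rep_mem_vectors p'.2) (rep_mem_vectors y'.2) a ha.symm
        · obtain ⟨a, b, hab⟩ := mem_span_pair.1 hh
          exact hf.two (rep_mem_vectors q'.2) (rep_mem_vectors y'.2) (rep_mem_vectors p'.2) a b
            hab.symm
      obtain ⟨S, hyS, hS⟩ := exists_span_of_enoughPoints X hX hi'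
      refine ⟨(fun a : X => a.1.rep) '' S, ?_, mem_of_mem_span_one hyy' hyS, ?_⟩
      · rintro _ ⟨w, -, rfl⟩
        exact rep_mem_vectors w.2
      · rintro _ ⟨w, hw, rfl⟩
        obtain ⟨h1, h2⟩ := hS w hw
        refine ⟨mem_of_mem_span_three h1 ?_ ?_ ?_, fun hh => h2 (Subtype.ext ?_)⟩
        · exact mem_of_mem_span_one hy'y (subset_span (by simp))
        · exact mem_of_mem_span_one hp'p (subset_span (by simp))
        · exact mem_of_mem_span_one hq'q (subset_span (by simp))
        · exact eq_of_rep_mem_span (mem_of_mem_span_one hh hyy'))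
  refine ⟨partialProj Φ, ⟨⟨σ, Φ, rfl⟩, fun x => ?_⟩, ?_⟩
  · rw [mem_partialProj_iff, ← liftRep_rep φ x]
    exact hΦ _ (rep_mem_vectors x.2)
  · rintro _ ⟨⟨τ, Ψ, rfl⟩, hΨ⟩
    have hΨ' : ∀ v ∈ vectors X, span K' {liftRep φ v} = span K' {Ψ v} := by
      rintro v ⟨hv0, hv⟩
      obtain ⟨h, heq⟩ := (mem_partialProj_mk Ψ v hv0 _).1 (hΨ ⟨_, hv⟩)
      rw [liftRep_eq φ hv0 hv, ← heq]
      exact span_one_eq_iff.2 ⟨rep_mk_mem_span h, mem_span_rep_mk h⟩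
    obtain ⟨l, hl⟩ := exists_eq_smul_of_span_eq hKtwo (rep_mem_vectors x₁.2) (rep_mem_vectors x₂.2) hfx
      h₁0 h₂0 hD₁ hD₂ hr Φ Ψ hΦ hΨ'
    -- A zero factor would make `Ψ` vanish, although it represents `φ` at `x₁`.
    have hl0 : l ≠ 0 := by
      rintro rfl
      have h1 := hΨ' _ (rep_mem_vectors x₁.2)
      rw [hl, zero_smul, liftRep_rep, Submodule.span_zero_singleton,
        Submodule.span_singleton_eq_bot] at h1
      exact (φ x₁).rep_nonzero h1
    refine PFun.ext fun p q => ?_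
    rw [mem_partialProj_iff, mem_partialProj_iff, hl]
    have : span K' {l • Φ p.rep} = span K' {Φ p.rep} :=
      span_one_eq_iff.2 ⟨smul_mem_span_one _ _, mem_of_smul_mem' hl0 (mem_span_one_self _)⟩
    rw [this]
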